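/- Consider Mastermind with $n$ positions and $k$ colors: a codeword $c\in[k]^n$ is hidden, and the codebreaker adaptively makes queries $q\in[k]^n$ until the query equals $c$. In black-peg Mastermind each query $q$ is answered by the number $b_c(q)=|\{i: q_i=c_i\}|$ of black pegs. In black-white-peg Mastermind it is answered by $b_c(q)$ and by the number of white pegs $w_c(q)=\max_{\sigma} b_c(q_{\sigma(1)},\dots,q_{\sigma(n)})-b_c(q)$, where $\sigma$ ranges over the permutations of $\{1,\dots,n\}$. The randomized query complexity is the infimum over all randomized strategies of the maximum over all codewords of the expected number of queries made, including the final query that equals $c$. The randomized query complexity of black-white-peg Mastermind is \[\Theta\left(\frac{n\log k}{\log n}+\frac kn\right)\] uniformly over all integers $n\ge 2$ and $k\ge 2$, and the randomized query complexity of black-peg Mastermind is \[\Theta\left(\frac{n\log k}{\log n}+k\right)\] uniformly over all integers $n\ge 2$ and $k\ge 1$; that is, in both cases the lower and the upper bound hold for all these $n$ and $k$ with positive absolute constants. -/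

import Mathlib

open scoped ENNReal

namespace Mastermind

/-- Strings of `n` colors out of `k`; both codewords and queries are of this form. -/
abbrev Codeword (n k : ℕ) : Type := Fin n → Fin k

/-- The number of black pegs: positions at which the query `q` agrees with the codeword `c`. -/
def black {n k : ℕ} (c q : Codeword n k) : ℕ :=
  (Finset.univ.filter fun i => q i = c i).card

/-- The number of white pegs: the number of additional correct positions that one can maximally
obtain by permuting the entries of `q`. The identity is one of the permutations, so the
subtraction does not truncate. -/
def white {n k : ℕ} (c q : Codeword n k) : ℕ :=
  (Finset.univ.sup fun σ : Equiv.Perm (Fin n) => black c (q ∘ σ)) - black c q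

/-- The answer to a query in the black-white-peg game. -/
def blackWhite {n k : ℕ} (c q : Codeword n k) : ℕ × ℕ := (black c q, white c q)

/-- A deterministic strategy chooses the next query from the list of all answers received so far
(latest answer first). The earlier queries are determined by the strategy and these answers. -/
abbrev DetStrategy (A : Type) (n k : ℕ) : Type := List A → Codeword n k

/-- The answers to the first `t` queries (latest first) when strategy `s` plays against the
codeword `c` and a query `q` is answered by `answer c q`. -/
def history {A : Type} {n k : ℕ} (answer : Codeword n k → Codeword n k → A)
    (s : DetStrategy A n k) (c : Codeword n k) : ℕ → List A
  | 0 => []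
  | t + 1 => answer c (s (history answer s c t)) :: history answer s c t

/-- The number of queries that strategy `s` makes until it queries the codeword `c` itself, this
last query included. It is `∞` if the codeword is never queried. -/
noncomputable def numQueries {A : Type} {n k : ℕ} (answer : Codeword n k → Codeword n k → A)
    (s : DetStrategy A n k) (c : Codeword n k) : ℝ≥0∞ :=
  ⨅ (t : ℕ) (_ : s (history answer s c t) = c), ((t : ℝ≥0∞) + 1)

/-- The randomized query complexity: the infimum over all randomized strategies (probability
measures on the deterministic strategies, with the product sigma-algebra) of the maximum over all
codewords of the expected number of queries needed to win the game. -/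
noncomputable def randQueryComplexity {A : Type} {n k : ℕ}
    (answer : Codeword n k → Codeword n k → A) : ℝ≥0∞ :=
  ⨅ (μ : MeasureTheory.Measure (DetStrategy A n k)) (_ : MeasureTheory.IsProbabilityMeasure μ),
    ⨆ c : Codeword n k, ∫⁻ s, numQueries answer s c ∂μ

/-- The randomized query complexity of Mastermind with black-peg answers only. -/
noncomputable def bmm (n k : ℕ) : ℝ≥0∞ :=
  randQueryComplexity (black : Codeword n k → Codeword n k → ℕ)

/-- The randomized query complexity of Mastermind with black-peg and white-peg answers. -/
noncomputable def bwmm (n k : ℕ) : ℝ≥0∞ :=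
  randQueryComplexity (blackWhite : Codeword n k → Codeword n k → ℕ × ℕ)

end Mastermind

/-!
All strategies are described by decision trees (`Mastermind.Learn`) that find the codeword on a set
of codewords. A finite family of trees such that each codeword is found by at least half of them,
with `T` queries, gives a randomized strategy with an expected number of `O(T)` queries
(`Mastermind.randQueryComplexity_le_of_half`).

**Upper bounds.** The core is a solution of Mastermind with `n` colors and `n` positions, blanks
allowed, by `O(n)` queries (`Mastermind.exists_blank_solver`). The color classes are cut by random
bisection until each piece holds one occurrence of its color; the expected number of bisections is
`O(n)`. The `n` resulting tokens, pairs of a color and a set of positions, have to be located. Two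
queries give the value of a *signed* query, which assigns a signed token to each position. Tokens
walk down a ternary tree of height about `log n` with the positions as leaves; one step of a token
is decided by three tests with results in `{0, 1}`. Tests are answered together, by the recursive
weighing scheme of Cantor and Mills, which saves a logarithmic factor (`Mastermind.cmSum_injective`,
`Mastermind.learn_tests`). The scheme needs its tests distributed geometrically over the levels of
the tree. To achieve this, the tokens are divided at random into groups that start one after the
other, so that at any time the groups are on different levels modulo the number of groups; a
second moment estimate shows that the groups are balanced (`Mastermind.rare_unbalanced`,
`Mastermind.learn_locations`).

* Black-peg Mastermind reduces to this game by `n + 1` queries that give a query without black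
  pegs, which then serves as a supply of blanks, and `k` monochromatic queries
  (`Mastermind.bmm_le_linear`).
* With white pegs and `k > n`, a query with distinct colors counts how many of these occur. So
  `k / n` queries count the occurring colors in groups of size `n`, random bisection separates them,
  and to identify them is again Mastermind with blanks: the separating sets play the role of the
  positions, and the numbers of the colors within their set the role of the colors
  (`Mastermind.bwmm_le_linear`).
* With few colors, `k ^ 2 ≤ n`, a union bound shows that `O(n log k / log n)` random queries
  distinguish all codewords, as Chvátal proved
  (`Mastermind.exists_distinguishing_of_few_colors`). The probability that a query does not
  distinguish two codewords is estimated by flipping fair coins that decide which of the two agrees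
  with the query in the positions where one of them does.

In the remaining cases `n` and `k` compare in such a way that a linear bound, or that for the
black-peg game, is of the right order.

**Lower bounds.** By averaging over a family of codewords it suffices to treat deterministic
strategies (`Mastermind.le_randQueryComplexity`). A query has at most `(n + 1) ^ 2` answers, so few
codewords are found early (`Mastermind.information_bound_le_bwmm`). If only a family of `k` codewords
with one hidden color is considered, then each query tests at most one color in the black-peg game,
and at most `n` colors in the black-white-peg game (`Mastermind.le_randQueryComplexity_of_hidden`).
-/

namespace Mastermind

/-! ### Learning a function of the secret by adaptive queries -/

section

/-- `Learn 𝒬 F D κ`: if the secret `c` is known to lie in `D`, then the value `F c` can be found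
by asking, adaptively, for values `q c` of functions `q ∈ 𝒬`, with at most `κ c` questions when
the secret is `c`. The derivation is the decision tree: at a leaf `F` is constant on the set of
secrets that are still possible. -/
inductive Learn {C A β : Type} (𝒬 : Set (C → A)) (F : C → β) : Set C → (C → ℕ) → Prop
  | done {D : Set C} {κ : C → ℕ} (h : ∀ c ∈ D, ∀ c' ∈ D, F c = F c') : Learn 𝒬 F D κ
  | ask {D : Set C} {κ κ' : C → ℕ} (q : C → A) (hq : q ∈ 𝒬)
      (hκ : ∀ c ∈ D, κ' c + 1 ≤ κ c)
      (h : ∀ a, Learn 𝒬 F (D ∩ {c | q c = a}) κ') : Learn 𝒬 F D κ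

namespace Learn

variable {C A β γ : Type} {𝒬 : Set (C → A)} {F : C → β} {G : C → γ} {D D' : Set C} {κ κ' : C → ℕ}

theorem mono (h : Learn 𝒬 F D κ) : ∀ {D' : Set C} {κ' : C → ℕ}, D' ⊆ D → (∀ c ∈ D', κ c ≤ κ' c) →
    Learn 𝒬 F D' κ' := by
  induction h with
  | done h => exact fun hD _ => done fun c hc c' hc' => h c (hD hc) c' (hD hc')
  | ask q hq hκ _ ih =>
    intro D' κ'' hD hκ'
    exact ask q hq (fun c hc => (hκ c (hD hc)).trans (hκ' c hc)) fun a =>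
      ih a (Set.inter_subset_inter_left _ hD) fun _ _ => le_rfl

/-- Two learning phases in a row: the second may depend on what the first one found. -/
theorem bind (h : Learn 𝒬 F D κ) : ∀ {κ' : C → ℕ}, (∀ b, Learn 𝒬 G (D ∩ {c | F c = b}) κ') →
    Learn 𝒬 G D (fun c => κ c + κ' c) := by
  induction h with
  | @done D κ h =>
    intro κ' h'
    rcases D.eq_empty_or_nonempty with rfl | ⟨c, hc⟩
    · exact done (by simp)
    · exact (h' (F c)).mono (fun c' hc' => ⟨hc', h c' hc' c hc⟩) fun _ _ => Nat.le_add_left _ _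
  | @ask D κ κ₁ q hq hκ _ ih =>
    intro κ' h'
    refine ask q hq (κ' := fun c => κ₁ c + κ' c) (fun c hc => by have := hκ c hc; omega) fun a =>
      ih a fun b => (h' b).mono (fun c hc => ⟨hc.1.1, hc.2⟩) fun _ _ => le_rfl

theorem map (h : Learn 𝒬 F D κ) (hG : ∀ c ∈ D, ∀ c' ∈ D, F c = F c' → G c = G c') :
    Learn 𝒬 G D κ :=
  (h.bind (G := G) (κ' := fun _ => 0) fun _ => done fun c hc c' hc' =>
    hG c hc.1 c' hc'.1 (hc.2.trans hc'.2.symm)).mono subset_rfl fun _ _ => le_rfl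

theorem query {q : C → A} (hq : q ∈ 𝒬) : Learn 𝒬 q D fun _ => 1 :=
  ask q hq (κ' := fun _ => 0) (fun _ _ => le_rfl) fun _ => done fun _ hc _ hc' =>
    hc.2.trans hc'.2.symm

/-- Simulation of one query game in another one. -/
theorem sim {C' A' : Type} {𝒬' : Set (C' → A')} {F : C' → β} {D' : Set C'} {κ : C' → ℕ}
    (h : Learn 𝒬' F D' κ) (φ : C → C') (r : ℕ) : ∀ {D : Set C}, (∀ c ∈ D, φ c ∈ D') →
    (∀ q ∈ 𝒬', Learn 𝒬 (fun c => q (φ c)) D fun _ => r) →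
    Learn 𝒬 (fun c => F (φ c)) D fun c => r * κ (φ c) := by
  induction h with
  | done h => exact fun hD _ => done fun c hc c' hc' => h _ (hD c hc) _ (hD c' hc')
  | @ask D' κ κ' q hq hκ _ ih =>
    intro D hD hr
    refine ((hr q hq).bind (κ' := fun c => r * κ' (φ c)) fun a =>
      ih a (fun c hc => ⟨hD c hc.1, hc.2⟩) fun q' hq' =>
        (hr q' hq').mono Set.inter_subset_left fun _ _ => le_rfl).mono subset_rfl fun c hc => ?_
    calc r + r * κ' (φ c) = r * (κ' (φ c) + 1) := by ring
      _ ≤ r * κ (φ c) := Nat.mul_le_mul_left _ (hκ _ (hD c hc))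

theorem finset {ι : Type} (s : Finset ι) {f : ι → C → β} {κ : ι → C → ℕ}
    (h : ∀ i ∈ s, Learn 𝒬 (f i) D (κ i)) :
    Learn 𝒬 (fun c (i : s) => f i c) D fun c => ∑ i ∈ s, κ i c := by
  classical
  induction s using Finset.induction_on with
  | empty => exact done fun c _ c' _ => by funext ⟨i, hi⟩; simp at hi
  | insert i s hi ih =>
    refine ((ih fun j hj => h j (Finset.mem_insert_of_mem hj)).bind
      (G := fun c (j : (insert i s : Finset ι)) => f j c) fun b =>
      ((h i (Finset.mem_insert_self _ _)).mono (D' := D ∩ {c | (fun (j : s) => f j c) = b})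
        Set.inter_subset_left fun _ _ => le_rfl).map ?_).mono subset_rfl fun c _ => ?_
    · intro c hc c' hc' he
      funext ⟨j, hj⟩
      rcases Finset.mem_insert.1 hj with rfl | hj
      · exact he
      · exact congrFun (hc.2.trans hc'.2.symm) ⟨j, hj⟩
    · rw [Finset.sum_insert hi, add_comm]

/-- All values of a finite family can be learned one after the other. -/
theorem family {ι : Type} [Fintype ι] {f : ι → C → β} {κ : ι → C → ℕ}
    (h : ∀ i, Learn 𝒬 (f i) D (κ i)) :
    Learn 𝒬 (fun c i => f i c) D fun c => ∑ i, κ i c :=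
  (finset Finset.univ fun i _ => h i).map fun _ _ _ _ he => by
    funext i; exact congrFun he ⟨i, Finset.mem_univ i⟩

theorem pair {r s : C → ℕ} (h : Learn 𝒬 F D r) (h' : Learn 𝒬 G D s) :
    Learn 𝒬 (fun c => (F c, G c)) D fun c => r c + s c :=
  h.bind fun b => (h'.mono (D' := D ∩ {c | F c = b}) Set.inter_subset_left fun _ _ => le_rfl).map
    fun _ hc _ hc' he => Prod.ext (hc.2.trans hc'.2.symm) he

/-- A learning process in rounds, each of cost at most `w`. -/
theorem iterate {K : ℕ → C → β} {w : ℕ} (h0 : ∀ c ∈ D, ∀ c' ∈ D, K 0 c = K 0 c')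
    (h : ∀ τ b, Learn 𝒬 (K (τ + 1)) (D ∩ {c | K τ c = b}) fun _ => w) (τ : ℕ) :
    Learn 𝒬 (K τ) D fun _ => τ * w := by
  induction τ with
  | zero => exact done h0
  | succ τ ih => exact (ih.bind (h τ)).mono subset_rfl fun _ _ => by rw [add_mul, one_mul]

end Learn

/-! ### From decision trees to randomized strategies -/

variable {A : Type} {n k : ℕ}

/-- The queries that the codebreaker can make, as functions of the codeword. -/
def queries (answer : Codeword n k → Codeword n k → A) : Set (Codeword n k → A) :=
  Set.range fun q c => answer c q

/-- A decision tree that finds the codeword is a deterministic strategy that queries the codeword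
after at most as many other queries. -/
theorem Learn.exists_strategy [Nonempty (Codeword n k)] {answer : Codeword n k → Codeword n k → A}
    {D : Set (Codeword n k)} {κ : Codeword n k → ℕ}
    (h : Learn (queries answer) (fun c => c) D κ) :
    ∃ s : DetStrategy A n k, ∀ c ∈ D, ∃ t ≤ κ c, s (history answer s c t) = c := by
  induction h with
  | @done D κ h =>
    rcases D.eq_empty_or_nonempty with rfl | ⟨c, hc⟩
    · exact ⟨fun _ => Classical.arbitrary _, by simp⟩
    · exact ⟨fun _ => c, fun c' hc' => ⟨0, Nat.zero_le _, h c hc c' hc'⟩⟩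
  | @ask D κ κ' q hq hκ _ ih =>
    obtain ⟨q, rfl⟩ := hq
    choose S hS using ih
    -- The first answer is the last entry of the history.
    let s : DetStrategy A n k := fun l =>
      if hl : l = [] then q else S (l.getLast hl) l.dropLast
    have hist : ∀ c t, history answer s c (t + 1) =
        history answer (S (answer c q)) c t ++ [answer c q] := by
      intro c t
      induction t with
      | zero => simp [history, s]
      | succ t iht =>
        rw [history, iht]
        simp [history, s]
    refine ⟨s, fun c hc => ?_⟩
    obtain ⟨t, ht, hst⟩ := hS (answer c q) c ⟨hc, rfl⟩
    refine ⟨t + 1, le_trans (by omega) (hκ c hc), ?_⟩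
    rw [hist]
    simpa [s] using hst

theorem numQueries_le {answer : Codeword n k → Codeword n k → A} {s : DetStrategy A n k}
    {c : Codeword n k} {t : ℕ} (h : s (history answer s c t) = c) :
    numQueries answer s c ≤ (t : ℝ≥0∞) + 1 :=
  iInf₂_le t h

/-- A uniformly random choice among finitely many deterministic strategies is a randomized
strategy. -/
theorem randQueryComplexity_le_of_uniform [Countable A] {Ω : Type} [Fintype Ω] [Nonempty Ω]
    {answer : Codeword n k → Codeword n k → A} (s : Ω → DetStrategy A n k) {B : ℝ≥0∞}
    (h : ∀ c, ∑ ω, numQueries answer (s ω) c ≤ Fintype.card Ω * B) :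
    randQueryComplexity answer ≤ B := by
  have h0 : (Fintype.card Ω : ℝ≥0∞) ≠ 0 := by simp
  have h1 : (Fintype.card Ω : ℝ≥0∞) ≠ ⊤ := by simp
  let μ : MeasureTheory.Measure (DetStrategy A n k) :=
    ∑ ω, (Fintype.card Ω : ℝ≥0∞)⁻¹ • MeasureTheory.Measure.dirac (s ω)
  have hμ : MeasureTheory.IsProbabilityMeasure μ := ⟨by
    simp [μ, ENNReal.mul_inv_cancel h0 h1]⟩
  refine (iInf₂_le μ hμ).trans (iSup_le fun c => ?_)
  simp only [μ, MeasureTheory.lintegral_finsetSum_measure, MeasureTheory.lintegral_smul_measure,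
    MeasureTheory.lintegral_dirac, smul_eq_mul]
  rw [← Finset.mul_sum]
  calc (Fintype.card Ω : ℝ≥0∞)⁻¹ * ∑ ω, numQueries answer (s ω) c
      ≤ (Fintype.card Ω : ℝ≥0∞)⁻¹ * (Fintype.card Ω * B) := by gcongr; exact h c
    _ = B := by rw [← mul_assoc, ENNReal.inv_mul_cancel h0 h1, one_mul]

end

/-! ### Amplification of the success probability -/

section

variable {A : Type} {n k : ℕ}

theorem length_history (answer : Codeword n k → Codeword n k → A) (s : DetStrategy A n k)
    (c : Codeword n k) (t : ℕ) : (history answer s c t).length = t := by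
  induction t with
  | zero => rfl
  | succ t ih => simp [history, ih]

/-- The first `i` of `r` independent trials all fail with probability at most `2⁻¹ ^ i` if one
trial fails with probability at most `1 / 2`. -/
theorem two_pow_mul_card_pi_le {Ω : Type} [Fintype Ω] [DecidableEq Ω] (r : ℕ) (B : Finset Ω)
    (hB : 2 * B.card ≤ Fintype.card Ω) (i : ℕ) (hi : i ≤ r) :
    2 ^ i * (Finset.univ.filter fun ω : Fin r → Ω => ∀ j : Fin r, (j : ℕ) < i → ω j ∈ B).card ≤
      Fintype.card Ω ^ r := by
  have h1 : (Finset.univ.filter fun ω : Fin r → Ω => ∀ j : Fin r, (j : ℕ) < i → ω j ∈ B) =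
      Fintype.piFinset fun j : Fin r => if (j : ℕ) < i then B else Finset.univ := by
    ext ω
    simp only [Finset.mem_filter, Finset.mem_univ, true_and, Fintype.mem_piFinset]
    refine forall_congr' fun j => ?_
    by_cases hj : (j : ℕ) < i <;> simp [hj]
  have h2 : 2 ^ i = ∏ j : Fin r, if (j : ℕ) < i then 2 else 1 := by
    rw [Finset.prod_ite, Finset.prod_const, Finset.prod_const_one, mul_one]
    congr 1
    rw [Fin.card_filter_val_lt, min_eq_right hi]
  rw [h1, Fintype.card_piFinset, h2, ← Finset.prod_mul_distrib]
  calc _ ≤ ∏ _j : Fin r, Fintype.card Ω := Finset.prod_le_prod' fun j _ => by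
        split_ifs <;> simp [Finset.card_univ, hB]
    _ = _ := by simp

/-- If, for every codeword, at least half of the decision trees of a finite family find it with at
most `T` queries, then the randomized query complexity is `O(T)`: play random members of the
family one after the other, for `T + 1` queries each, and after very many failures query all
codewords. -/
theorem randQueryComplexity_le_of_half [Countable A] [Nonempty (Codeword n k)] {Ω : Type}
    [Fintype Ω] [Nonempty Ω] {answer : Codeword n k → Codeword n k → A}
    (good : Ω → Set (Codeword n k)) (T : ℕ)
    (hlearn : ∀ ω, Learn (queries answer) (fun c => c) (good ω) fun _ => T)
    (hgood : ∀ c, 2 * Nat.card {ω // c ∉ good ω} ≤ Fintype.card Ω) :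
    randQueryComplexity answer ≤ 2 * (T + 1) + 1 := by
  classical
  choose s hs using fun ω => (hlearn ω).exists_strategy
  set r := Fintype.card (Codeword n k) with hr
  let e := Fintype.equivFin (Codeword n k)
  -- A history of length `i * (T + 1) + m` belongs to phase `i` and begins with the `m` answers
  -- of this phase. All codewords are queried after the `r` phases.
  let S : (Fin r → Ω) → DetStrategy A n k := fun ω l =>
    if h : l.length / (T + 1) < r then s (ω ⟨_, h⟩) (l.take (l.length % (T + 1)))
    else if h' : l.length - r * (T + 1) < r then e.symm ⟨_, h'⟩ else Classical.arbitrary _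
  have phase : ∀ ω c (i : Fin r) m, m ≤ T →
      history answer (S ω) c (i * (T + 1) + m) =
        history answer (s (ω i)) c m ++ history answer (S ω) c (i * (T + 1)) ∧
      S ω (history answer (S ω) c (i * (T + 1) + m)) =
        s (ω i) (history answer (s (ω i)) c m) := by
    intro ω c i m
    have key : ∀ m ≤ T, history answer (S ω) c (i * (T + 1) + m) =
        history answer (s (ω i)) c m ++ history answer (S ω) c (i * (T + 1)) →
        S ω (history answer (S ω) c (i * (T + 1) + m)) =
          s (ω i) (history answer (s (ω i)) c m) := by
      intro m hm h
      have hl := length_history answer (S ω) c (i * (T + 1) + m)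
      have hd : (i * (T + 1) + m) / (T + 1) = i := by
        rw [add_comm, Nat.add_mul_div_right _ _ (Nat.succ_pos T),
          Nat.div_eq_of_lt (Nat.lt_succ_of_le hm), zero_add]
      have hmod : (i * (T + 1) + m) % (T + 1) = m := by
        rw [add_comm, Nat.add_mul_mod_self_right, Nat.mod_eq_of_lt (Nat.lt_succ_of_le hm)]
      have hlt : (history answer (S ω) c (i * (T + 1) + m)).length / (T + 1) < r := by
        rw [hl, hd]; exact i.2
      have hfin : (⟨_, hlt⟩ : Fin r) = i := Fin.ext (by simp only [hl, hd])
      simp only [S]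
      rw [dif_pos hlt, hfin, hl, hmod]
      congr 1
      change List.take m (history answer (S ω) c (i * (T + 1) + m)) = _
      rw [h, List.take_append_of_le_length (by rw [length_history]),
        List.take_of_length_le (by rw [length_history])]
    induction m with
    | zero => exact fun hm => ⟨rfl, key 0 hm rfl⟩
    | succ m ih =>
      intro hm
      obtain ⟨h1, h2⟩ := ih (by omega)
      have h3 : history answer (S ω) c (i * (T + 1) + (m + 1)) =
          history answer (s (ω i)) c (m + 1) ++ history answer (S ω) c (i * (T + 1)) := by
        rw [← add_assoc, history, h2, h1, history, List.cons_append]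
      exact ⟨h3, key _ hm h3⟩
  have final : ∀ ω c, ∃ t < r * (T + 1) + r, S ω (history answer (S ω) c t) = c := by
    intro ω c
    refine ⟨r * (T + 1) + e c, by have := (e c).2; omega, ?_⟩
    have hl := length_history answer (S ω) c (r * (T + 1) + e c)
    have hge : ¬ (history answer (S ω) c (r * (T + 1) + e c)).length / (T + 1) < r := by
      rw [hl, not_lt, Nat.le_div_iff_mul_le (Nat.succ_pos T)]
      exact Nat.le_add_right _ _
    have hlt : (history answer (S ω) c (r * (T + 1) + e c)).length - r * (T + 1) < r := by
      rw [hl, Nat.add_sub_cancel_left]; exact (e c).2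
    have hfin : (⟨_, hlt⟩ : Fin r) = e c := Fin.ext (by simp only [hl, Nat.add_sub_cancel_left])
    simp only [S]
    rw [dif_neg hge, dif_pos hlt, hfin, Equiv.symm_apply_apply]
  have bound : ∀ ω c, numQueries answer (S ω) c ≤
      ∑ i ∈ Finset.range r, ((T : ℝ≥0∞) + 1) *
          (if ∀ j : Fin r, (j : ℕ) < i → c ∉ good (ω j) then 1 else 0) +
        r * (if ∀ j : Fin r, (j : ℕ) < r → c ∉ good (ω j) then 1 else 0) := by
    intro ω c
    by_cases hall : ∀ j : Fin r, c ∉ good (ω j)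
    · obtain ⟨t, ht, hst⟩ := final ω c
      refine (numQueries_le hst).trans ?_
      simp only [hall, not_false_eq_true, implies_true, if_true, mul_one, Finset.sum_const,
        Finset.card_range, nsmul_eq_mul]
      exact_mod_cast (show t + 1 ≤ r * (T + 1) + r by omega)
    · push Not at hall
      have hex : ∃ i : ℕ, ∃ h : i < r, c ∈ good (ω ⟨i, h⟩) := by
        obtain ⟨j, hj⟩ := hall; exact ⟨j, j.2, hj⟩
      obtain ⟨hi, hci⟩ := Nat.find_spec hex
      set i := Nat.find hex
      obtain ⟨t, ht, hst⟩ := hs _ c hci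
      have h2 := (phase ω c ⟨i, hi⟩ t ht).2
      rw [hst] at h2
      refine (numQueries_le h2).trans (le_trans ?_ le_self_add)
      calc (((i * (T + 1) + t : ℕ) : ℝ≥0∞) + 1) ≤ ∑ j ∈ Finset.range (i + 1), ((T : ℝ≥0∞) + 1) := by
            rw [Finset.sum_const, Finset.card_range, nsmul_eq_mul]
            exact_mod_cast (show i * (T + 1) + t + 1 ≤ (i + 1) * (T + 1) by
              rw [add_mul]; omega)
        _ = ∑ j ∈ Finset.range (i + 1), ((T : ℝ≥0∞) + 1) *
          (if ∀ j' : Fin r, (j' : ℕ) < j → c ∉ good (ω j') then 1 else 0) := by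
            refine Finset.sum_congr rfl fun j hj => ?_
            rw [if_pos, mul_one]
            intro j' hj' hc
            have := Nat.find_min' hex ⟨j'.2, hc⟩
            have := Finset.mem_range.1 hj
            omega
        _ ≤ _ := Finset.sum_le_sum_of_subset (by
            intro j hj
            rw [Finset.mem_range] at *
            omega)
  have count : ∀ c, ∀ i ≤ r, ∑ ω : Fin r → Ω,
      (if ∀ j : Fin r, (j : ℕ) < i → c ∉ good (ω j) then (1 : ℝ≥0∞) else 0) ≤
        (Fintype.card (Fin r → Ω) : ℝ≥0∞) * (2⁻¹) ^ i := by
    intro c i hi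
    have hB : 2 * (Finset.univ.filter fun ω => c ∉ good ω).card ≤ Fintype.card Ω := by
      have := hgood c
      rwa [Nat.card_eq_fintype_card, Fintype.card_subtype] at this
    have h := two_pow_mul_card_pi_le r _ hB i hi
    simp only [Finset.mem_filter, Finset.mem_univ, true_and] at h
    rw [Finset.sum_boole, Fintype.card_fun, Fintype.card_fin, ← ENNReal.inv_pow, ← div_eq_mul_inv,
      ENNReal.le_div_iff_mul_le (by simp) (by simp), mul_comm]
    exact_mod_cast h
  have geom : ∑ i ∈ Finset.range r, (2⁻¹ : ℝ≥0∞) ^ i ≤ 2 :=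
    (ENNReal.sum_le_tsum _).trans (by rw [ENNReal.tsum_geometric, ENNReal.one_sub_inv_two, inv_inv])
  refine randQueryComplexity_le_of_uniform S fun c => ?_
  calc ∑ ω, numQueries answer (S ω) c
      ≤ ∑ ω : Fin r → Ω, (∑ i ∈ Finset.range r, ((T : ℝ≥0∞) + 1) *
          (if ∀ j : Fin r, (j : ℕ) < i → c ∉ good (ω j) then 1 else 0) +
        r * (if ∀ j : Fin r, (j : ℕ) < r → c ∉ good (ω j) then 1 else 0)) :=
        Finset.sum_le_sum fun ω _ => bound ω c
    _ = ∑ i ∈ Finset.range r, ((T : ℝ≥0∞) + 1) * ∑ ω : Fin r → Ω,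
          (if ∀ j : Fin r, (j : ℕ) < i → c ∉ good (ω j) then 1 else 0) +
        r * ∑ ω : Fin r → Ω, (if ∀ j : Fin r, (j : ℕ) < r → c ∉ good (ω j) then 1 else 0) := by
        rw [Finset.sum_add_distrib, Finset.sum_comm, Finset.mul_sum]
        simp only [Finset.mul_sum]
    _ ≤ ∑ i ∈ Finset.range r, ((T : ℝ≥0∞) + 1) *
          ((Fintype.card (Fin r → Ω) : ℝ≥0∞) * (2⁻¹) ^ i) +
        r * ((Fintype.card (Fin r → Ω) : ℝ≥0∞) * (2⁻¹) ^ r) := by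
        gcongr with i hi
        · exact count c i (Finset.mem_range.1 hi).le
        · exact count c r le_rfl
    _ = (Fintype.card (Fin r → Ω) : ℝ≥0∞) * (((T : ℝ≥0∞) + 1) *
          ∑ i ∈ Finset.range r, (2⁻¹ : ℝ≥0∞) ^ i + r * (2⁻¹) ^ r) := by
        rw [mul_add, Finset.mul_sum, Finset.mul_sum]
        congr 1
        · exact Finset.sum_congr rfl fun i _ => by ring
        · ring
    _ ≤ (Fintype.card (Fin r → Ω) : ℝ≥0∞) * (2 * (T + 1) + 1) := by
        refine mul_le_mul' le_rfl (add_le_add ?_ ?_)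
        · rw [mul_comm]; gcongr
        · rw [← ENNReal.inv_pow, ← div_eq_mul_inv]
          refine ENNReal.div_le_of_le_mul ?_
          rw [one_mul]
          exact_mod_cast (Nat.lt_two_pow_self (n := r)).le

end

/-! ### Weighing with signs: the Cantor–Mills recursion on a ternary tree -/

section

/-- The answer to the signed query with index `q` in the weighing scheme of configuration `J`, if
the tests in the slots of the scheme have the results `s`. In a vertex of the ternary tree, with
`j` the first entry of `J`, the two children other than `j` run the remaining scheme in parallel.
With their answers `a` and `b`, the scheme of the vertex asks for `a + b` and, together with one
more test `x` in child `j`, for `a - b + x`; the parity then reveals `x`. Here `s ρ i` is the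
result of the `i`-th test in the child with address `ρ`. -/
def cmSum : (List (Fin 3) → List Bool → ℤ) → List (Fin 3) → List Bool → ℤ
  | s, j :: J, b :: q =>
    cmSum (fun ρ => s ((j + 1) :: ρ)) J q +
      (if b then -1 else 1) * cmSum (fun ρ => s ((j + 2) :: ρ)) J q + if b then s [j] q else 0
  | _, [], _ => 0
  | _, _ :: _, [] => 0

/-- The vertex with address `ρ` hosts tests in the configuration `J`: `ρ` agrees with `J` in its
last entry and nowhere before. -/
def Compat : List (Fin 3) → List (Fin 3) → Prop
  | j :: _, [d] => d = j
  | j :: J, d :: d' :: ρ => d ≠ j ∧ Compat J (d' :: ρ)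
  | _, _ => False

theorem fin_three_cases (d j : Fin 3) : d = j ∨ d = j + 1 ∨ d = j + 2 := by
  revert d j; decide

/-- The weighing scheme determines all test results that it involves. -/
theorem cmSum_injective (J : List (Fin 3)) : ∀ (s s' : List (Fin 3) → List Bool → ℤ),
    (∀ ρ i, s ρ i = 0 ∨ s ρ i = 1) → (∀ ρ i, s' ρ i = 0 ∨ s' ρ i = 1) →
    (∀ q : List Bool, q.length = J.length → cmSum s J q = cmSum s' J q) →
    ∀ ρ i, Compat J ρ → i.length + ρ.length = J.length → s ρ i = s' ρ i := by
  induction J with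
  | nil => intro s s' _ _ _ ρ i hρ; simp [Compat] at hρ
  | cons j J ih =>
    intro s s' hs hs' h ρ i hρ hl
    have key : ∀ q : List Bool, q.length = J.length → s [j] q = s' [j] q ∧
        cmSum (fun ρ => s ((j + 1) :: ρ)) J q = cmSum (fun ρ => s' ((j + 1) :: ρ)) J q ∧
        cmSum (fun ρ => s ((j + 2) :: ρ)) J q = cmSum (fun ρ => s' ((j + 2) :: ρ)) J q := by
      intro q hq
      have h1 := h (false :: q) (by simp [hq])
      have h2 := h (true :: q) (by simp [hq])
      simp only [cmSum, Bool.false_eq_true, if_false, if_true] at h1 h2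
      have h3 := hs [j] q
      have h4 := hs' [j] q
      omega
    match ρ, hρ with
    | [d], hρ =>
      obtain rfl : d = j := hρ
      exact (key i (by simpa using hl)).1
    | d :: d' :: ρ, hρ =>
      obtain ⟨hd, hρ⟩ := hρ
      have hl' : i.length + (d' :: ρ).length = J.length := by
        simp only [List.length_cons] at hl ⊢; omega
      rcases fin_three_cases d j with rfl | rfl | rfl
      · exact absurd rfl hd
      · exact ih _ _ (fun ρ i => hs _ i) (fun ρ i => hs' _ i) (fun q hq => (key q hq).2.1) _ i hρ hl'
      · exact ih _ _ (fun ρ i => hs _ i) (fun ρ i => hs' _ i) (fun q hq => (key q hq).2.2) _ i hρ hl'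

/-- The part that a leaf `p` of the ternary tree plays in the signed query with index `q` of
configuration `J`: the sign, and the slot whose test uses the leaf. -/
def route : List (Fin 3) → List Bool → List (Fin 3) → Option (Bool × List (Fin 3) × List Bool)
  | j :: J, b :: q, d :: p =>
    if d = j then (if b then some (true, [j], q) else none)
    else (route J q p).map fun r => (if b ∧ d = j + 2 then !r.1 else r.1, d :: r.2.1, r.2.2)
  | _, _, _ => none

@[simp] theorem cmSum_zero (J : List (Fin 3)) (q : List Bool) : cmSum (fun _ _ => 0) J q = 0 := by
  induction J generalizing q with
  | nil => rfl
  | cons j J ih => cases q <;> simp [cmSum, ih]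

theorem cmSum_sum {ι : Type} (t : Finset ι) (J : List (Fin 3)) : ∀ (q : List Bool)
    (s : ι → List (Fin 3) → List Bool → ℤ),
    cmSum (fun ρ i => ∑ x ∈ t, s x ρ i) J q = ∑ x ∈ t, cmSum (s x) J q := by
  induction J with
  | nil => intro q s; simp [cmSum]
  | cons j J ih =>
    intro q s
    cases q with
    | nil => simp [cmSum]
    | cons b q =>
      simp only [cmSum]
      rw [ih q fun x ρ => s x ((j + 1) :: ρ), ih q fun x ρ => s x ((j + 2) :: ρ),
        Finset.sum_add_distrib, Finset.sum_add_distrib, Finset.mul_sum]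
      congr 1
      split_ifs <;> simp

theorem fin_three_add_one_ne (j : Fin 3) : j + 1 ≠ j ∧ j + 2 ≠ j ∧ j + 1 ≠ j + 2 := by
  revert j; decide

/-- The contribution of a single leaf `p` to a signed query. -/
theorem cmSum_prefix (J : List (Fin 3)) : ∀ (q : List Bool) (p : List (Fin 3))
    (f : List (Fin 3) → List Bool → ℤ),
    cmSum (fun ρ i => if ρ <+: p then f ρ i else 0) J q =
      (route J q p).elim 0 fun r => (if r.1 then 1 else -1) * f r.2.1 r.2.2 := by
  induction J with
  | nil => intro q p f; simp [cmSum, route]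
  | cons j J ih =>
    intro q p f
    rcases q with _ | ⟨b, q⟩
    · simp [cmSum, route]
    rcases p with _ | ⟨d, p⟩
    · simp [cmSum, route]
    obtain ⟨h1, h2, h3⟩ := fin_three_add_one_ne j
    have hother : ∀ e, e ≠ d →
        cmSum (fun ρ i => if e :: ρ <+: d :: p then f (e :: ρ) i else 0) J q = 0 := by
      intro e he
      simp [List.cons_prefix_cons, he]
    have hsame : cmSum (fun ρ i => if d :: ρ <+: d :: p then f (d :: ρ) i else 0) J q =
        (route J q p).elim 0 fun r => (if r.1 then 1 else -1) * f (d :: r.2.1) r.2.2 := by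
      simp only [List.cons_prefix_cons, true_and]
      exact ih q p fun ρ => f (d :: ρ)
    simp only [cmSum]
    rcases fin_three_cases d j with rfl | rfl | rfl
    · rw [hother _ h1, hother _ h2]
      cases b <;> simp [route, List.cons_prefix_cons]
    · rw [hsame, hother _ h3.symm]
      cases b <;> cases hr : route J q p <;>
        simp [route, List.cons_prefix_cons, h1, h1.symm, h3, hr]
    · rw [hsame, hother _ h3]
      cases b <;> cases hr : route J q p <;>
        simp [route, List.cons_prefix_cons, h2, h2.symm, hr]
      all_goals split_ifs <;> simp_all

theorem exists_lists (α : Type) [Fintype α] [DecidableEq α] (L : ℕ) : ∃ S : Finset (List α),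
    S.card = Fintype.card α ^ L ∧ ∀ x, x ∈ S ↔ x.length = L :=
  ⟨(Finset.univ : Finset (List.Vector α L)).map
      ⟨List.Vector.toList, List.Vector.toList_injective⟩, by
    rw [Finset.card_map, Finset.card_univ, card_vector], fun x => by
    rw [Finset.mem_map]
    exact ⟨fun ⟨v, _, h⟩ => h ▸ v.toList_length, fun h => ⟨⟨x, h⟩, Finset.mem_univ _, rfl⟩⟩⟩

/-- The number of slots at a vertex, over all configurations. -/
theorem exists_slots (ρ : List (Fin 3)) (hρ : ρ ≠ []) : ∀ L : ℕ, ρ.length ≤ L →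
    ∃ S : Finset (List (Fin 3) × List Bool), S.card = 2 ^ (L - 1) * 3 ^ (L - ρ.length) ∧
      ∀ x ∈ S, x.1.length = L ∧ Compat x.1 ρ ∧ x.2.length + ρ.length = L := by
  classical
  induction ρ with
  | nil => exact absurd rfl hρ
  | cons d ρ ih =>
    rintro (_ | L) hL
    · simp at hL
    rcases ρ with _ | ⟨d', ρ⟩
    · obtain ⟨S, hS, hS'⟩ := exists_lists (Fin 3) L
      obtain ⟨B, hB, hB'⟩ := exists_lists Bool L
      refine ⟨(S ×ˢ B).map ⟨fun x => (d :: x.1, x.2), fun x y h => by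
        simpa [Prod.ext_iff] using h⟩, ?_, ?_⟩
      · simp [hS, hB, mul_comm]
      · rintro ⟨J, i⟩ h
        simp only [Finset.mem_map, Finset.mem_product] at h
        obtain ⟨⟨J', i'⟩, ⟨h1, h2⟩, h⟩ := h
        obtain ⟨rfl, rfl⟩ := Prod.mk.inj h
        simp only [hS', hB'] at h1 h2
        simp [h1, h2, Compat]
    · obtain ⟨S, hS, hS'⟩ := ih (by simp) L (by simpa using hL)
      obtain ⟨h1, h2, h3⟩ := fin_three_add_one_ne d
      have hinj : ∀ e : Fin 3, Function.Injective
          fun x : List (Fin 3) × List Bool => (e :: x.1, x.2) := fun e x y h => by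
        simpa [Prod.ext_iff] using h
      refine ⟨S.map ⟨_, hinj (d + 1)⟩ ∪ S.map ⟨_, hinj (d + 2)⟩, ?_, ?_⟩
      · rw [Finset.card_union_of_disjoint, Finset.card_map, Finset.card_map, hS]
        · obtain ⟨L, rfl⟩ : ∃ L', L = L' + 1 := ⟨L - 1, by simp at hL; omega⟩
          have : L + 1 + 1 - (d :: d' :: ρ).length = L + 1 - (d' :: ρ).length := by
            simp only [List.length_cons]; omega
          rw [this]
          simp only [Nat.add_sub_cancel]
          ring
        · rw [Finset.disjoint_left]
          simp only [Finset.mem_map, Function.Embedding.coeFn_mk, not_exists, not_and]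
          rintro _ ⟨x, _, rfl⟩ y _ h
          simp only [Prod.mk.injEq, List.cons.injEq] at h
          exact h3 h.1.1.symm
      · intro x hx
        simp only [Finset.mem_union, Finset.mem_map, Function.Embedding.coeFn_mk] at hx
        rcases hx with ⟨y, hy, rfl⟩ | ⟨y, hy, rfl⟩
        · obtain ⟨a, b, c⟩ := hS' y hy
          exact ⟨by simp [a], ⟨h1.symm, b⟩, by simp only [List.length_cons] at c ⊢; omega⟩
        · obtain ⟨a, b, c⟩ := hS' y hy
          exact ⟨by simp [a], ⟨h2.symm, b⟩, by simp only [List.length_cons] at c ⊢; omega⟩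

end

/-! ### Locating single occurrences with signed queries -/

section

variable {C A Tk : Type} {n : ℕ} {𝒬 : Set (C → A)} {D : Set C}

open Classical in
/-- The answer to a signed query. The tokens in `𝒯` have unknown locations `loc c t`; the query
puts at most one signed token on each position and counts, with signs, those that are put on their
location. -/
noncomputable def signedVal (𝒯 : Finset Tk) (loc : C → Tk → Fin n)
    (u : Fin n → Option (Bool × Tk)) (c : C) : ℤ :=
  ∑ p, (u p).elim 0 fun r =>
    if r.2 ∈ 𝒯 ∧ loc c r.2 = p then (if r.1 then 1 else -1) else 0

open Classical in
/-- Many tests of the form "is the token `tk x` at a leaf below `ad x`?" are answered by few signed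
queries if they are spread over the ternary tree: the vertex `ρ` may host a number of tests that
is, up to a factor, the number of signed queries divided by `3 ^ ρ.length`. -/
theorem learn_tests {I : Type} {𝒯 : Finset Tk} {loc : C → Tk → Fin n}
    (hq : ∀ u, Learn 𝒬 (signedVal 𝒯 loc u) D fun _ => 2) (pos : Fin n → List (Fin 3))
    (𝓘 : Finset I) (tk : I → Tk) (ad reg : I → List (Fin 3)) {L G : ℕ}
    (htk : ∀ x ∈ 𝓘, tk x ∈ 𝒯) (hreg : ∀ x ∈ 𝓘, reg x <+: ad x ∧ reg x ≠ [] ∧ (reg x).length ≤ L)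
    (hcap : ∀ ρ, (𝓘.filter fun x => reg x = ρ).card ≤ G * (2 ^ (L - 1) * 3 ^ (L - ρ.length))) :
    Learn 𝒬 (fun c x => x ∈ 𝓘 ∧ ad x <+: pos (loc c (tk x))) D
      fun _ => 2 * (G * (3 ^ L * 2 ^ L)) := by
  have hslot : ∀ ρ, ∃ f : {x // x ∈ 𝓘.filter fun x => reg x = ρ} →
      Fin G × (List (Fin 3) × List Bool), Function.Injective f ∧ ∀ x, (f x).2.1.length = L ∧
        Compat (f x).2.1 ρ ∧ (f x).2.2.length + ρ.length = L := by
    intro ρ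
    rcases (𝓘.filter fun x => reg x = ρ).eq_empty_or_nonempty with he | ⟨x, hx⟩
    · have : IsEmpty {x // x ∈ 𝓘.filter fun x => reg x = ρ} := by rw [he]; infer_instance
      exact ⟨isEmptyElim, fun x => isEmptyElim x, fun x => isEmptyElim x⟩
    · obtain ⟨hxI, rfl⟩ := Finset.mem_filter.1 hx
      obtain ⟨S, hS, hS'⟩ := exists_slots (reg x) (hreg x hxI).2.1 L (hreg x hxI).2.2
      obtain ⟨f, hf⟩ := Function.Embedding.exists_of_card_le_finset
        (α := {y // y ∈ 𝓘.filter fun y => reg y = reg x})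
        (s := (Finset.univ : Finset (Fin G)) ×ˢ S) (by
          rw [Fintype.card_coe, Finset.card_product, hS]; simpa using hcap (reg x))
      refine ⟨f, f.injective, fun y => hS' _ ?_⟩
      have := hf ⟨y, rfl⟩
      simpa using this
  choose f hf hfS using hslot
  -- The test in a given slot.
  let asg : Fin G → List (Fin 3) → List (Fin 3) → List Bool → Option I := fun r J ρ i =>
    if h : ∃ x, f ρ x = (r, J, i) then some h.choose.1 else none
  have asg_some : ∀ {r J ρ i x}, asg r J ρ i = some x → x ∈ 𝓘 ∧ reg x = ρ := by
    intro r J ρ i x h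
    by_cases h' : ∃ x, f ρ x = (r, J, i)
    · simp only [asg, dif_pos h', Option.some.injEq] at h
      exact h ▸ Finset.mem_filter.1 h'.choose.2
    · rw [show asg r J ρ i = none from dif_neg h'] at h
      cases h
  have asg_surj : ∀ x ∈ 𝓘, ∃ r J i, J.length = L ∧ Compat J (reg x) ∧
      i.length + (reg x).length = L ∧ asg r J (reg x) i = some x := by
    intro x hx
    let y : {y // y ∈ 𝓘.filter fun y => reg y = reg x} := ⟨x, by simp [hx]⟩
    obtain ⟨h1, h2, h3⟩ := hfS _ y
    refine ⟨(f _ y).1, _, _, h1, h2, h3, ?_⟩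
    have h' : ∃ z, f (reg x) z = ((f _ y).1, (f _ y).2.1, (f _ y).2.2) := ⟨y, rfl⟩
    simp only [asg, dif_pos h']
    rw [hf _ (h'.choose_spec.trans rfl : f _ h'.choose = f _ y)]
  let s : Fin G → List (Fin 3) → C → List (Fin 3) → List Bool → ℤ := fun r J c ρ i =>
    (asg r J ρ i).elim 0 fun x => if ad x <+: pos (loc c (tk x)) then 1 else 0
  have hs01 : ∀ r J c ρ i, s r J c ρ i = 0 ∨ s r J c ρ i = 1 := by
    intro r J c ρ i
    simp only [s]
    cases asg r J ρ i with
    | none => simp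
    | some x => simp only [Option.elim_some]; split_ifs <;> simp
  let u : Fin G → List (Fin 3) → List Bool → Fin n → Option (Bool × Tk) := fun r J q p =>
    (route J q (pos p)).bind fun rt => (asg r J rt.2.1 rt.2.2).bind fun x =>
      if ad x <+: pos p then some (rt.1, tk x) else none
  have hsu : ∀ r J q c, cmSum (s r J c) J q = signedVal 𝒯 loc (u r J q) c := by
    intro r J q c
    have h1 : s r J c = fun ρ i => ∑ p : Fin n, if ρ <+: pos p then (asg r J ρ i).elim 0 fun x =>
        if ad x <+: pos p ∧ loc c (tk x) = p then (1 : ℤ) else 0 else 0 := by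
      funext ρ i
      simp only [s]
      cases hx : asg r J ρ i with
      | none => simp
      | some x =>
        obtain ⟨hxI, rfl⟩ := asg_some hx
        simp only [Option.elim_some]
        rw [Finset.sum_eq_single (loc c (tk x)) (fun p _ hp => by simp [hp.symm]) (by simp)]
        by_cases had : ad x <+: pos (loc c (tk x))
        · simp [had, (hreg x hxI).1.trans had]
        · simp [had]
    rw [h1, cmSum_sum]
    refine Finset.sum_congr rfl fun p _ => ?_
    rw [cmSum_prefix J q (pos p) fun ρ i => (asg r J ρ i).elim 0 fun x =>
      if ad x <+: pos p ∧ loc c (tk x) = p then (1 : ℤ) else 0]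
    simp only [u]
    cases route J q (pos p) with
    | none => simp
    | some rt =>
      simp only [Option.elim_some, Option.bind_some]
      cases hx : asg r J rt.2.1 rt.2.2 with
      | none => simp
      | some x =>
        have hxT := htk x (asg_some hx).1
        by_cases had : ad x <+: pos p <;> simp [had, hxT]
  obtain ⟨JS, hJS, hJS'⟩ := exists_lists (Fin 3) L
  obtain ⟨BS, hBS, hBS'⟩ := exists_lists Bool L
  have hfam := Learn.finset (𝒬 := 𝒬) (D := D) ((Finset.univ : Finset (Fin G)) ×ˢ (JS ×ˢ BS))
    (f := fun x c => cmSum (s x.1 x.2.1 c) x.2.1 x.2.2) (κ := fun _ _ => 2) (fun x _ => by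
      simpa only [hsu] using hq (u x.1 x.2.1 x.2.2))
  refine (hfam.map ?_).mono subset_rfl fun c _ => ?_
  · intro c _ c' _ h
    funext x
    rw [eq_iff_iff]
    refine and_congr_right fun hx => ?_
    obtain ⟨r, J, i, hJ, hcomp, hi, hxa⟩ := asg_surj x hx
    have h2 := cmSum_injective J (s r J c) (s r J c') (hs01 _ _ _) (hs01 _ _ _) (fun q hqJ =>
      congrFun h ⟨(r, J, q), by simp [hJS', hBS', hJ, hqJ]⟩) (reg x) i hcomp (by omega)
    simp only [s, hxa, Option.elim_some] at h2
    by_cases h3 : ad x <+: pos (loc c (tk x)) <;>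
      by_cases h4 : ad x <+: pos (loc c' (tk x)) <;> simp_all
  · simp [hJS, hBS, mul_comm]

theorem sub_mod_injective {τ L a b : ℕ} (ha : a ≤ τ) (hb : b ≤ τ) (haL : a < L) (hbL : b < L)
    (h : (τ - a) % L = (τ - b) % L) : a = b := by
  refine Nat.ModEq.eq_of_lt_of_lt (m := L) ?_ haL hbL
  have h1 : τ - a + a ≡ τ - b + a [MOD L] := Nat.ModEq.add_right a h
  rw [Nat.sub_add_cancel ha] at h1
  have h2 : τ - b + b ≡ τ - b + a [MOD L] := by rwa [Nat.sub_add_cancel hb]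
  exact (Nat.ModEq.add_left_cancel' _ h2).symm

open Classical in
/-- The locations of all tokens can be found with few signed queries. The tokens are divided into
`L` groups that slide down the ternary tree one level per round, group `b` starting in round `b`.
In every round the groups are on different levels modulo `L`; a group on level `l` uses the part
of the weighing schemes that belongs to the level `l % L`. The division has to be balanced on the
first `L` levels. -/
theorem learn_locations {𝒯 : Finset Tk} {loc : C → Tk → Fin n}
    (hq : ∀ u, Learn 𝒬 (signedVal 𝒯 loc u) D fun _ => 2) (pos : Fin n → List (Fin 3)) {H : ℕ}
    (hpos : Function.Injective pos) (hH : ∀ p, (pos p).length = H) {L G : ℕ} (hLH : L ≤ H)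
    (hG : 36 * 3 ^ H ≤ L * (G * 6 ^ L)) (g : Tk → Fin L)
    (hg : ∀ c ∈ D, ∀ b ρ, ρ.length < L →
      L * (𝒯.filter fun t => g t = b ∧ ρ <+: pos (loc c t)).card ≤ 2 * 3 ^ (H - ρ.length)) :
    Learn 𝒬 (fun c t => if t ∈ 𝒯 then some (loc c t) else none) D
      fun _ => (H + L) * (2 * (G * (3 ^ L * 2 ^ L))) := by
  let K : ℕ → C → Tk → List (Fin 3) := fun τ c t =>
    if t ∈ 𝒯 then (pos (loc c t)).take (τ - g t) else []
  refine (Learn.iterate (K := K) (w := 2 * (G * (3 ^ L * 2 ^ L))) ?_ ?_ (H + L)).map ?_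
  · intro c _ c' _; funext t; simp [K]
  · intro τ κ
    rcases (D ∩ {c | K τ c = κ}).eq_empty_or_nonempty with he | ⟨c₀, hc₀, hκ₀⟩
    · rw [he]; exact .done (by simp)
    have hκ : ∀ c ∈ D ∩ {c | K τ c = κ}, ∀ t ∈ 𝒯, κ t = (pos (loc c t)).take (τ - g t) := by
      intro c hc t ht
      have : K τ c t = κ t := congrFun hc.2 t
      simpa [K, ht] using this.symm
    let 𝓘 : Finset (Tk × Fin 3) :=
      (𝒯.filter fun t => (g t : ℕ) ≤ τ ∧ τ - g t < H) ×ˢ Finset.univ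
    have hI : ∀ x, x ∈ 𝓘 ↔ x.1 ∈ 𝒯 ∧ (g x.1 : ℕ) ≤ τ ∧ τ - g x.1 < H := by simp [𝓘]
    have hlen : ∀ x ∈ 𝓘, (κ x.1).length = τ - g x.1 := by
      intro x hx
      obtain ⟨h1, h2, h3⟩ := (hI x).1 hx
      rw [hκ c₀ ⟨hc₀, hκ₀⟩ _ h1, List.length_take, hH]; omega
    let ad : Tk × Fin 3 → List (Fin 3) := fun x => κ x.1 ++ [x.2]
    let reg : Tk × Fin 3 → List (Fin 3) := fun x => (ad x).take ((τ - g x.1) % L + 1)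
    have hmod : ∀ x : Tk × Fin 3, (τ - g x.1) % L < L := fun x => Nat.mod_lt _ (g x.1).pos
    have hreglen : ∀ x ∈ 𝓘, (reg x).length = (τ - g x.1) % L + 1 := by
      intro x hx
      have := Nat.mod_le (τ - g x.1) L
      simp only [reg, ad, List.length_take, List.length_append, hlen x hx, List.length_singleton]
      omega
    have hcap : ∀ ρ, (𝓘.filter fun x => reg x = ρ).card ≤
        G * (2 ^ (L - 1) * 3 ^ (L - ρ.length)) := by
      intro ρ
      rcases (𝓘.filter fun x => reg x = ρ).eq_empty_or_nonempty with he | ⟨y, hy⟩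
      · simp [he]
      obtain ⟨hyI, rfl⟩ := Finset.mem_filter.1 hy
      obtain ⟨hy1, hy2, hy3⟩ := (hI y).1 hyI
      have hl := hreglen y hyI
      set lam := (τ - g y.1) % L with hlam
      have hlamL : lam < L := hmod y
      set σ := (reg y).take lam with hσ
      have hσlen : σ.length = lam := by rw [hσ, List.length_take, hl]; omega
      have hsub : (𝓘.filter fun x => reg x = reg y) ⊆
          (𝒯.filter fun t => g t = g y.1 ∧ σ <+: pos (loc c₀ t)) ×ˢ Finset.univ := by
        intro x hx
        obtain ⟨hxI, hxy⟩ := Finset.mem_filter.1 hx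
        obtain ⟨hx1, hx2, hx3⟩ := (hI x).1 hxI
        have hlx := hreglen x hxI
        have hxlam : (τ - g x.1) % L = lam := by rw [hxy] at hlx; omega
        refine Finset.mem_product.2 ⟨Finset.mem_filter.2 ⟨hx1, ?_, ?_⟩, Finset.mem_univ _⟩
        · exact Fin.ext (sub_mod_injective hx2 hy2 (g x.1).2 (g y.1).2 (hxlam.trans hlam))
        · rw [hσ, ← hxy]
          have h1 : (reg x).take lam = (κ x.1).take lam := by
            simp only [reg, ad, List.take_take]
            rw [min_eq_left (by omega), List.take_append_of_le_length]
            rw [hlen x hxI, ← hxlam]; exact Nat.mod_le _ _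
          rw [h1, hκ c₀ ⟨hc₀, hκ₀⟩ _ hx1]
          exact (List.take_prefix _ _).trans (List.take_prefix _ _)
      have h1 := Finset.card_le_card hsub
      have h2 := hg c₀ hc₀ (g y.1) σ (by omega)
      rw [Finset.card_product, Finset.card_univ, Fintype.card_fin] at h1
      rw [hσlen] at h2
      rw [hl]
      have hL0 : 0 < L := by omega
      refine Nat.le_of_mul_le_mul_left (c := L * (36 * 3 ^ lam)) ?_ (by positivity)
      set N := (𝒯.filter fun t => g t = g y.1 ∧ σ <+: pos (loc c₀ t)).card
      calc L * (36 * 3 ^ lam) * (𝓘.filter fun x => reg x = reg y).card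
          ≤ L * (36 * 3 ^ lam) * (N * 3) := Nat.mul_le_mul_left _ h1
        _ = 108 * 3 ^ lam * (L * N) := by ring
        _ ≤ 108 * 3 ^ lam * (2 * 3 ^ (H - lam)) := Nat.mul_le_mul_left _ h2
        _ = 6 * (36 * 3 ^ (lam + (H - lam))) := by rw [pow_add]; ring
        _ = 6 * (36 * 3 ^ H) := by rw [Nat.add_sub_cancel' (by omega)]
        _ ≤ 6 * (L * (G * 6 ^ L)) := Nat.mul_le_mul_left _ hG
        _ = 6 * (L * (G * (2 ^ (L - 1 + 1) * 3 ^ (lam + (L - (lam + 1)) + 1)))) := by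
          rw [Nat.sub_add_cancel hL0, show lam + (L - (lam + 1)) + 1 = L by omega, ← mul_pow]
          norm_num
        _ = L * (36 * 3 ^ lam) * (G * (2 ^ (L - 1) * 3 ^ (L - (lam + 1)))) := by
          rw [pow_succ, pow_succ, pow_add]; ring
    have hstep := learn_tests (𝒬 := 𝒬) (D := D ∩ {c | K τ c = κ}) (𝒯 := 𝒯) (loc := loc)
      (fun u => (hq u).mono Set.inter_subset_left fun _ _ => le_rfl) pos 𝓘 Prod.fst ad reg
      (L := L) (G := G) (fun x hx => ((hI x).1 hx).1)
      (fun x hx => ⟨List.take_prefix _ _, by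
        rw [← List.length_pos_iff, hreglen x hx]; omega, by
        rw [hreglen x hx]; exact hmod x⟩) hcap
    refine hstep.map fun c hc c' hc' h => ?_
    funext t
    by_cases ht : t ∈ 𝒯
    swap
    · simp [K, ht]
    simp only [K, ht, if_true]
    by_cases hgt : (g t : ℕ) ≤ τ
    swap
    · rw [show τ + 1 - (g t : ℕ) = 0 by omega]; simp
    by_cases hlH : τ - g t < H
    · set l := τ - (g t : ℕ) with hl
      rw [show τ + 1 - (g t : ℕ) = l + 1 by omega]
      have hlt : l < (pos (loc c t)).length := by rw [hH]; exact hlH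
      let j := (pos (loc c t))[l]
      have e1 : (pos (loc c t)).take (l + 1) = κ t ++ [j] := by
        rw [hκ c hc t ht, List.take_concat_get' _ _ hlt]
      have hin : (t, j) ∈ 𝓘 := (hI _).2 ⟨ht, hgt, hlH⟩
      have e2 : (t, j) ∈ 𝓘 ∧ ad (t, j) <+: pos (loc c' t) := by
        rw [← congrFun h (t, j)]
        exact ⟨hin, by simp only [ad]; rw [← e1]; exact List.take_prefix _ _⟩
      have e3 := List.prefix_iff_eq_take.1 e2.2
      have e4 : (ad (t, j)).length = l + 1 := by
        simp only [ad, List.length_append, List.length_singleton]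
        rw [hlen (t, j) hin]
      rw [e1, ← e4]
      exact e3
    · have e : ∀ c ∈ D ∩ {c | K τ c = κ}, (pos (loc c t)).take (τ + 1 - g t) = κ t := by
        intro c hc
        rw [hκ c hc t ht, List.take_of_length_le (by rw [hH]; omega),
          List.take_of_length_le (by rw [hH]; omega)]
      rw [e c hc, e c' hc']
  · intro c _ c' _ h
    funext t
    by_cases ht : t ∈ 𝒯
    · have h' := congrFun h t
      have hgL := (g t).2
      simp only [K, ht, if_true] at h' ⊢
      rw [List.take_of_length_le (by rw [hH]; omega),
        List.take_of_length_le (by rw [hH]; omega)] at h'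
      rw [hpos h']
    · simp [ht]

end

/-! ### Rare events and second moments on finite probability spaces -/

section

/-- `Rare K P`: under the uniform distribution on `Ω`, the event `P` has probability at most
`1 / K`. -/
def Rare {Ω : Type} (K : ℕ) (P : Ω → Prop) : Prop :=
  K * Nat.card {ω // P ω} ≤ Nat.card Ω

namespace Rare

variable {Ω Ω' : Type} [Finite Ω] [Finite Ω'] {K : ℕ} {P Q : Ω → Prop}

theorem mono (h : Rare K P) (hQ : ∀ ω, Q ω → P ω) : Rare K Q :=
  (Nat.mul_le_mul_left _ (Nat.card_le_card_of_injective (Subtype.map id hQ)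
    (Subtype.map_injective hQ Function.injective_id))).trans h

theorem or (hP : Rare (2 * K) P) (hQ : Rare (2 * K) Q) : Rare K fun ω => P ω ∨ Q ω := by
  classical
  have := Fintype.ofFinite Ω
  unfold Rare at *
  simp only [Nat.card_eq_fintype_card, Fintype.card_subtype] at *
  rw [Finset.filter_or]
  have := Finset.card_union_le (Finset.univ.filter P) (Finset.univ.filter Q)
  nlinarith

theorem prod {Q : Ω → Ω' → Prop} (h : ∀ ω, Rare K (Q ω)) :
    Rare K fun x : Ω × Ω' => Q x.1 x.2 := by
  classical
  have := Fintype.ofFinite Ω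
  have := Fintype.ofFinite Ω'
  unfold Rare at *
  rw [Nat.card_congr (Equiv.subtypeProdEquivSigmaSubtype Q), Nat.card_sigma, Finset.mul_sum,
    Nat.card_prod, Nat.card_eq_fintype_card (α := Ω)]
  exact (Finset.sum_le_card_nsmul _ _ _ fun ω _ => h ω).trans (by simp)

theorem fst {Ω Ω' : Type} {P : Ω → Prop} (h : Rare K P) : Rare K fun x : Ω × Ω' => P x.1 := by
  unfold Rare at *
  rw [Nat.card_congr (Equiv.prodSubtypeFstEquivSubtypeProd (β := Ω') (p := P)), Nat.card_prod,
    Nat.card_prod, ← mul_assoc]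
  exact Nat.mul_le_mul_right _ h

theorem markov {Ω : Type} [Fintype Ω] {f : Ω → ℕ} {E T : ℕ} (hf : ∑ ω, f ω ≤ Fintype.card Ω * E)
    (hT : 0 < T) (hET : E * K ≤ T) : Rare K fun ω => T ≤ f ω := by
  classical
  unfold Rare
  simp only [Nat.card_eq_fintype_card, Fintype.card_subtype]
  have h1 : (Finset.univ.filter fun ω => T ≤ f ω).card * T ≤ ∑ ω, f ω :=
    (Finset.card_nsmul_le_sum _ _ _ fun ω hω => (Finset.mem_filter.1 hω).2).trans
      (Finset.sum_le_univ_sum_of_nonneg fun _ => Nat.zero_le _)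
  refine Nat.le_of_mul_le_mul_left (c := T) ?_ hT
  calc T * (K * (Finset.univ.filter fun ω => T ≤ f ω).card)
      = K * ((Finset.univ.filter fun ω => T ≤ f ω).card * T) := by ring
    _ ≤ K * (Fintype.card Ω * E) := Nat.mul_le_mul_left _ (h1.trans hf)
    _ = E * K * Fintype.card Ω := by ring
    _ ≤ T * Fintype.card Ω := Nat.mul_le_mul_right _ hET

end Rare

theorem sum_pi_prod {ι β : Type} [Fintype ι] [DecidableEq ι] [Fintype β] (φ : ι → β → ℤ) :
    ∑ g : ι → β, ∏ l, φ l (g l) = ∏ l, ∑ x, φ l x := by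
  rw [Finset.prod_univ_sum, Fintype.piFinset_univ]

theorem sum_pi_single {ι β : Type} [Fintype ι] [DecidableEq ι] [Fintype β] (i : ι) (f : β → ℤ) :
    Fintype.card β * ∑ g : ι → β, f (g i) = Fintype.card (ι → β) * ∑ x, f x := by
  have h := sum_pi_prod fun (l : ι) (x : β) => if l = i then f x else 1
  have h1 : ∀ g : ι → β, ∏ l, (if l = i then f (g l) else 1) = f (g i) := fun g => by simp
  simp only [h1] at h
  rw [h, ← Finset.mul_prod_erase _ _ (Finset.mem_univ i)]
  have h2 : ∏ l ∈ Finset.univ.erase i, ∑ x : β, (if l = i then f x else 1) =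
      ∏ l ∈ Finset.univ.erase i, (Fintype.card β : ℤ) :=
    Finset.prod_congr rfl fun l hl => by simp [Finset.ne_of_mem_erase hl]
  rw [h2]
  have h3 : (Fintype.card (ι → β) : ℤ) =
      Fintype.card β * ∏ l ∈ Finset.univ.erase i, (Fintype.card β : ℤ) := by
    rw [Finset.mul_prod_erase Finset.univ (fun _ => (Fintype.card β : ℤ)) (Finset.mem_univ i)]
    simp
  rw [h3]
  simp only [if_true]
  ring

theorem sum_pi_mul {ι β : Type} [Fintype ι] [DecidableEq ι] [Fintype β] {i j : ι} (hij : i ≠ j)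
    (f f' : β → ℤ) (hf : ∑ x, f x = 0) : ∑ g : ι → β, f (g i) * f' (g j) = 0 := by
  have h := sum_pi_prod fun (l : ι) (x : β) => if l = i then f x else if l = j then f' x else 1
  have h1 : ∀ g : ι → β,
      ∏ l, (if l = i then f (g l) else if l = j then f' (g l) else 1) = f (g i) * f' (g j) := by
    intro g
    rw [Fintype.prod_eq_mul i j hij fun l hl => by simp [hl.1, hl.2]]
    simp [hij.symm]
  simp only [h1] at h
  rw [h]
  exact Finset.prod_eq_zero (Finset.mem_univ i) (by simpa using hf)

/-- Second moment of the number of hits of a uniformly random function `g`, where position `i ∈ T`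
is hit if `g i` satisfies `p i`, which `a` of the values do. -/
theorem sum_sq_hits_le {ι β : Type} [Fintype ι] [DecidableEq ι] [Fintype β] (T : Finset ι)
    (p : ι → β → Prop) [∀ i, DecidablePred (p i)] (a : ℕ)
    (ha : ∀ i ∈ T, (Finset.univ.filter (p i)).card = a) :
    ∑ g : ι → β, ((Fintype.card β * (T.filter fun i => p i (g i)).card : ℤ) - T.card * a) ^ 2 ≤
      Fintype.card (ι → β) * (T.card * (a * Fintype.card β)) := by
  set k : ℤ := (Fintype.card β : ℤ) with hk
  let W : ι → β → ℤ := fun i x => (if p i x then k else 0) - a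
  have hW : ∀ i ∈ T, ∑ x, W i x = 0 := by
    intro i hi
    simp only [W, Finset.sum_sub_distrib, ← Finset.sum_filter, Finset.sum_const, ha i hi,
      Finset.card_univ, nsmul_eq_mul]
    ring
  have hW2 : ∀ i ∈ T, ∑ g : ι → β, W i (g i) * W i (g i) ≤
      Fintype.card (ι → β) * (a * Fintype.card β) := by
    intro i hi
    have h1 := sum_pi_single (β := β) i fun x => W i x * W i x
    have h2 : ∑ x, W i x * W i x = k * (k * a - a * a) := by
      have : ∀ x, W i x * W i x = (if p i x then k * k - 2 * (k * a) else 0) + a * a := by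
        intro x; simp only [W]; split_ifs <;> ring
      simp only [this, Finset.sum_add_distrib, ← Finset.sum_filter, Finset.sum_const, ha i hi,
        Finset.card_univ, nsmul_eq_mul]
      ring
    rw [h2] at h1
    have hk0 : 0 ≤ k := by positivity
    rcases hk0.eq_or_lt with h0 | h0
    · have : IsEmpty β := by
        rw [← Fintype.card_eq_zero_iff]; exact_mod_cast (show (Fintype.card β : ℤ) = 0 from h0.symm)
      have : IsEmpty (ι → β) := ⟨fun g => isEmptyElim (g i)⟩
      simp
    · refine le_of_mul_le_mul_left (a := k) ?_ h0
      rw [h1]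
      have : (0 : ℤ) ≤ Fintype.card (ι → β) := by positivity
      have h3 : k * (k * a - a * a) ≤ k * (a * k) := by nlinarith [mul_self_nonneg (a : ℤ)]
      calc _ ≤ (Fintype.card (ι → β) : ℤ) * (k * (a * k)) := mul_le_mul_of_nonneg_left h3 this
        _ = _ := by ring
  have hX : ∀ g : ι → β, k * (T.filter fun i => p i (g i)).card - T.card * a =
      ∑ i ∈ T, W i (g i) := by
    intro g
    simp only [W, Finset.sum_sub_distrib, ← Finset.sum_filter, Finset.sum_const, nsmul_eq_mul]
    ring
  calc _ = ∑ g : ι → β, ∑ i ∈ T, ∑ j ∈ T, W i (g i) * W j (g j) := by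
        refine Finset.sum_congr rfl fun g _ => ?_
        rw [hX, sq, Finset.sum_mul_sum]
    _ = ∑ i ∈ T, ∑ j ∈ T, ∑ g : ι → β, W i (g i) * W j (g j) := by
        rw [Finset.sum_comm]
        exact Finset.sum_congr rfl fun i _ => Finset.sum_comm
    _ = ∑ i ∈ T, ∑ g : ι → β, W i (g i) * W i (g i) := by
        refine Finset.sum_congr rfl fun i hi => Finset.sum_eq_single i (fun j _ hj => ?_)
          fun h => absurd hi h
        exact sum_pi_mul hj.symm _ _ (hW i hi)
    _ ≤ ∑ i ∈ T, (Fintype.card (ι → β) : ℤ) * (a * Fintype.card β) :=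
        Finset.sum_le_sum fun i hi => hW2 i hi
    _ = _ := by rw [Finset.sum_const, nsmul_eq_mul]; ring

/-! ### Separating the elements of a set by random bisection -/

variable {U : Type} [DecidableEq U]

/-- Number of sets that are bisected when the elements of `X` in `S` are separated, where the set
on level `i` is bisected by the function `h i`, for at most `d` levels. -/
def splitCost : (d : ℕ) → (Fin d → U → Bool) → Finset U → Finset U → ℕ
  | 0, _, _, _ => 0
  | d + 1, h, S, X =>
    if (X ∩ S).card ≤ 1 then 0
    else 1 + splitCost d (Fin.tail h) (S.filter fun x => h 0 x = false) X +
      splitCost d (Fin.tail h) (S.filter fun x => h 0 x = true) X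

/-- The sets with exactly one element of `X` that the bisection of `S` ends with. -/
def splitSets : (d : ℕ) → (Fin d → U → Bool) → Finset U → Finset U → Finset (Finset U)
  | 0, _, S, X => if (X ∩ S).card = 1 then {S} else ∅
  | d + 1, h, S, X =>
    if (X ∩ S).card = 0 then ∅ else if (X ∩ S).card = 1 then {S}
    else splitSets d (Fin.tail h) (S.filter fun x => h 0 x = false) X ∪
      splitSets d (Fin.tail h) (S.filter fun x => h 0 x = true) X

theorem splitSets_spec (d : ℕ) : ∀ (h : Fin d → U → Bool) (S X R : Finset U),
    R ∈ splitSets d h S X → R ⊆ S ∧ (X ∩ R).card = 1 := by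
  induction d with
  | zero =>
    intro h S X R hR
    simp only [splitSets] at hR
    split_ifs at hR with h1
    · obtain rfl := Finset.mem_singleton.1 hR; exact ⟨subset_rfl, h1⟩
    · simp at hR
  | succ d ih =>
    intro h S X R hR
    simp only [splitSets] at hR
    split_ifs at hR with h0 h1
    · simp at hR
    · obtain rfl := Finset.mem_singleton.1 hR; exact ⟨subset_rfl, h1⟩
    · rcases Finset.mem_union.1 hR with hR | hR
      all_goals
        obtain ⟨h2, h3⟩ := ih _ _ _ _ hR
        exact ⟨h2.trans (Finset.filter_subset _ _), h3⟩

theorem splitSets_disjoint (d : ℕ) : ∀ (h : Fin d → U → Bool) (S X R R' : Finset U),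
    R ∈ splitSets d h S X → R' ∈ splitSets d h S X → R ≠ R' → Disjoint R R' := by
  induction d with
  | zero =>
    intro h S X R R' hR hR' hne
    simp only [splitSets] at hR hR'
    split_ifs at hR hR' <;> simp_all
  | succ d ih =>
    intro h S X R R' hR hR' hne
    simp only [splitSets] at hR hR'
    split_ifs at hR hR'
    · simp at hR
    · simp_all
    · have hd : Disjoint (S.filter fun x => h 0 x = false) (S.filter fun x => h 0 x = true) :=
        Finset.disjoint_filter.2 fun x _ h1 h2 => by simp [h1] at h2
      rcases Finset.mem_union.1 hR with hR | hR <;> rcases Finset.mem_union.1 hR' with hR' | hR'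
      · exact ih _ _ _ _ _ hR hR' hne
      · exact hd.mono (splitSets_spec _ _ _ _ _ hR).1 (splitSets_spec _ _ _ _ _ hR').1
      · exact (hd.mono (splitSets_spec _ _ _ _ _ hR').1 (splitSets_spec _ _ _ _ _ hR).1).symm
      · exact ih _ _ _ _ _ hR hR' hne

/-- If two elements of `X` are not separated after `d` levels, then their set was bisected `d`
times. So a cost of less than `d` implies that all elements are separated. -/
theorem exists_mem_splitSets (d : ℕ) : ∀ (h : Fin d → U → Bool) (S X : Finset U),
    splitCost d h S X < d → ∀ x ∈ X, x ∈ S → ∃ R ∈ splitSets d h S X, x ∈ R := by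
  induction d with
  | zero => intro h S X hc; omega
  | succ d ih =>
    intro h S X hc x hx hxS
    have hpos : (X ∩ S).card ≠ 0 := Finset.card_ne_zero_of_mem (Finset.mem_inter.2 ⟨hx, hxS⟩)
    simp only [splitSets, if_neg hpos]
    split_ifs with h1
    · exact ⟨S, by simp, hxS⟩
    · simp only [splitCost] at hc
      rw [if_neg (by omega)] at hc
      cases hb : h 0 x
      · obtain ⟨R, hR, hxR⟩ := ih (Fin.tail h) (S.filter fun x => h 0 x = false) X (by omega) x hx
          (by simp [hxS, hb])
        exact ⟨R, Finset.mem_union_left _ hR, hxR⟩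
      · obtain ⟨R, hR, hxR⟩ := ih (Fin.tail h) (S.filter fun x => h 0 x = true) X (by omega) x hx
          (by simp [hxS, hb])
        exact ⟨R, Finset.mem_union_right _ hR, hxR⟩

theorem card_inter_split (S X : Finset U) (b : U → Bool) :
    (X ∩ S.filter fun x => b x = false).card + (X ∩ S.filter fun x => b x = true).card =
      (X ∩ S).card := by
  rw [← Finset.card_filter_add_card_filter_not (s := X ∩ S) fun x => b x = false]
  congr 2
  · ext x; simp [and_assoc]
  · ext x; simp [and_assoc]

/-- The bisection is a learning process: every bisection of a set costs one query, for the number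
of elements in one of the two parts. -/
theorem learn_splitSets {C A : Type} {𝒬 : Set (C → A)} (X : C → Finset U) (d : ℕ) :
    ∀ (h : Fin d → U → Bool) (S : Finset U) (D : Set C),
    (∀ S' ⊆ S, Learn 𝒬 (fun c => (X c ∩ S').card) D fun _ => 1) →
    (∀ c ∈ D, ∀ c' ∈ D, (X c ∩ S).card = (X c' ∩ S).card) →
    Learn 𝒬 (fun c => splitSets d h S (X c)) D fun c => splitCost d h S (X c) := by
  induction d with
  | zero =>
    intro h S D _ hD
    exact .done fun c hc c' hc' => by simp only [splitSets, hD c hc c' hc']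
  | succ d ih =>
    intro h S D hq hD
    rcases D.eq_empty_or_nonempty with rfl | ⟨c₀, hc₀⟩
    · exact .done (by simp)
    by_cases hm : (X c₀ ∩ S).card ≤ 1
    · refine .done fun c hc c' hc' => ?_
      simp only [splitSets, hD c hc c₀ hc₀, hD c' hc' c₀ hc₀]
      split_ifs <;> first | rfl | omega
    set S0 := S.filter fun x => h 0 x = false with hS0
    set S1 := S.filter fun x => h 0 x = true with hS1
    refine (((hq S0 (Finset.filter_subset _ _)).bind
      (G := fun c => (splitSets d (Fin.tail h) S0 (X c), splitSets d (Fin.tail h) S1 (X c)))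
      fun a => ((ih (Fin.tail h) S0 (D ∩ {c | (X c ∩ S0).card = a}) ?_ ?_).pair
        (ih (Fin.tail h) S1 (D ∩ {c | (X c ∩ S0).card = a}) ?_ ?_))).map ?_).mono subset_rfl ?_
    · exact fun S' hS' => (hq S' (hS'.trans (Finset.filter_subset _ _))).mono
        Set.inter_subset_left fun _ _ => le_rfl
    · exact fun c hc c' hc' => hc.2.trans hc'.2.symm
    · exact fun S' hS' => (hq S' (hS'.trans (Finset.filter_subset _ _))).mono
        Set.inter_subset_left fun _ _ => le_rfl
    · intro c hc c' hc'
      have h1 := card_inter_split S (X c) (h 0)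
      have h2 := card_inter_split S (X c') (h 0)
      have h3 := hD c hc.1 c' hc'.1
      have h4 : (X c ∩ S0).card = (X c' ∩ S0).card := hc.2.trans hc'.2.symm
      simp only [← hS0, ← hS1] at h1 h2
      omega
    · intro c hc c' hc' he
      have h3 := hD c hc c' hc'
      simp only [Prod.mk.injEq] at he
      simp only [splitSets, h3, ← hS0, ← hS1, he.1, he.2]
    · intro c hc
      simp only [splitCost, ← hS0, ← hS1]
      rw [if_neg (by rw [hD c hc c₀ hc₀]; exact hm)]
      omega

theorem four_mul_card_le [Fintype U] {x y : U} (hxy : x ≠ y) (v : Bool) :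
    4 * (Finset.univ.filter fun b : U → Bool => b x = v ∧ b y = v).card ≤
      Fintype.card (U → Bool) := by
  have h := Finset.card_le_card_of_injOn
    (s := (Finset.univ.filter fun b : U → Bool => b x = v ∧ b y = v) ×ˢ
      (Finset.univ : Finset (Bool × Bool))) (t := Finset.univ)
    (fun z => Function.update (Function.update z.1 x z.2.1) y z.2.2) (fun _ _ => by simp) (by
      rintro ⟨b, s, t⟩ hb ⟨b', s', t'⟩ hb' he
      simp only [Finset.coe_product, Set.mem_prod, Finset.mem_coe, Finset.mem_filter,
        Finset.mem_univ, true_and, and_true] at hb hb'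
      have hx := congrFun he x
      have hy := congrFun he y
      simp only [Function.update_self, ne_eq, hxy, not_false_eq_true, Function.update_of_ne]
        at hx hy
      have hbb : b = b' := by
        funext z
        by_cases hzx : z = x
        · rw [hzx, hb.1, hb'.1]
        by_cases hzy : z = y
        · rw [hzy, hb.2, hb'.2]
        simpa [Function.update_of_ne, hzx, hzy] using congrFun he z
      rw [hbb, hx, hy])
  rw [Finset.card_product, Finset.card_univ, Finset.card_univ] at h
  simpa [mul_comm] using h

/-- The expected cost of separating `m ≥ 1` elements by random bisection is at most `2 * m - 2`.
In the induction, a bisection into parts with `m₀ + m₁ = m` elements costs `1` and lowers the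
bound by `2`, unless a part is empty, which has probability at most `1 / 2`. -/
theorem sum_splitCost_le [Fintype U] (d : ℕ) : ∀ S X : Finset U,
    ∑ h : Fin d → U → Bool, splitCost d h S X ≤
      Fintype.card (Fin d → U → Bool) * (2 * ((X ∩ S).card - 1)) := by
  induction d with
  | zero => intro S X; simp [splitCost]
  | succ d ih =>
    intro S X
    by_cases hm : (X ∩ S).card ≤ 1
    · simp [splitCost, hm]
    set m := (X ∩ S).card with hmdef
    set M := Fintype.card (Fin d → U → Bool) with hM
    set B := Fintype.card (U → Bool) with hB
    have hcard : Fintype.card (Fin (d + 1) → U → Bool) = B * M := by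
      rw [← Fintype.card_congr (Fin.consEquiv fun _ => U → Bool), Fintype.card_prod]
    obtain ⟨x, hx, y, hy, hxy⟩ := Finset.one_lt_card.1 (not_le.1 hm)
    have hempty : ∀ v, 4 * (Finset.univ.filter fun b : U → Bool =>
        (X ∩ S.filter fun x => b x = v).card = 0).card ≤ B := by
      intro v
      refine (Nat.mul_le_mul_left 4 (Finset.card_le_card ?_)).trans (four_mul_card_le hxy !v)
      intro b hb
      have hb' := (Finset.mem_filter.1 hb).2
      rw [Finset.card_eq_zero, Finset.eq_empty_iff_forall_notMem] at hb'
      have key : ∀ z ∈ X ∩ S, b z = !v := by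
        intro z hz
        have h1 := hb' z
        simp only [Finset.mem_inter, Finset.mem_filter, not_and] at h1
        exact Bool.eq_not_of_ne (h1 (Finset.mem_inter.1 hz).1 (Finset.mem_inter.1 hz).2)
      exact Finset.mem_filter.2 ⟨Finset.mem_univ _, key x hx, key y hy⟩
    rw [← (Fin.consEquiv fun _ => U → Bool).sum_comp, Fintype.sum_prod_type, hcard]
    have h1 : ∀ b : U → Bool,
        ∑ h : Fin d → U → Bool, splitCost (d + 1) (Fin.consEquiv (fun _ => U → Bool) (b, h)) S X ≤
        M * ((2 * m - 3) + 2 * (if (X ∩ S.filter fun x => b x = false).card = 0 then 1 else 0) +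
          2 * (if (X ∩ S.filter fun x => b x = true).card = 0 then 1 else 0)) := by
      intro b
      have h2 : ∀ h : Fin d → U → Bool,
          splitCost (d + 1) (Fin.consEquiv (fun _ => U → Bool) (b, h)) S X =
          1 + splitCost d h (S.filter fun x => b x = false) X +
            splitCost d h (S.filter fun x => b x = true) X := by
        intro h
        simp only [splitCost, ← hmdef, if_neg hm]
        rfl
      simp only [h2, Finset.sum_add_distrib, Finset.sum_const, Finset.card_univ, smul_eq_mul,
        mul_one, ← hM]
      refine (add_le_add (add_le_add le_rfl (ih _ _)) (ih _ _)).trans ?_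
      rw [← mul_one_add, ← mul_add]
      refine Nat.mul_le_mul_left _ ?_
      have h3 := card_inter_split S X b
      split_ifs <;> omega
    calc _ ≤ ∑ b : U → Bool, M * ((2 * m - 3) +
          2 * (if (X ∩ S.filter fun x => b x = false).card = 0 then 1 else 0) +
          2 * (if (X ∩ S.filter fun x => b x = true).card = 0 then 1 else 0)) :=
          Finset.sum_le_sum fun b _ => h1 b
      _ = M * (B * (2 * m - 3) + 2 * (Finset.univ.filter fun b : U → Bool =>
            (X ∩ S.filter fun x => b x = false).card = 0).card +
          2 * (Finset.univ.filter fun b : U → Bool =>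
            (X ∩ S.filter fun x => b x = true).card = 0).card) := by
          rw [← Finset.mul_sum, Finset.sum_add_distrib, Finset.sum_add_distrib, ← Finset.mul_sum,
            ← Finset.mul_sum, Finset.sum_boole, Finset.sum_boole]
          simp [hB]
      _ ≤ M * (B * (2 * m - 3) + B) := by
          refine Nat.mul_le_mul_left _ ?_
          have := hempty false
          have := hempty true
          omega
      _ = B * M * (2 * (m - 1)) := by
          obtain ⟨m', hm'⟩ : ∃ m', m = m' + 2 := ⟨m - 2, by omega⟩
          rw [hm', show 2 * (m' + 2) - 3 = 2 * m' + 1 by omega,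
            show m' + 2 - 1 = m' + 1 by omega]
          ring

end

/-! ### Random groups of tokens are balanced -/

section

theorem eight_mul_sum_pow (L : ℕ) : 8 * ∑ l ∈ Finset.range L, 9 ^ l + 1 = 9 ^ L := by
  induction L with
  | zero => rfl
  | succ L ih => rw [Finset.sum_range_succ, pow_succ]; omega

theorem four_mul_sq_le (L : ℕ) : 4 * L ^ 2 ≤ 9 ^ L := by
  rcases L with _ | L
  · simp
  induction L with
  | zero => norm_num
  | succ L ih =>
    calc 4 * (L + 1 + 1) ^ 2 ≤ 4 * (3 * (L + 1)) ^ 2 := by gcongr; omega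
      _ = 9 * (4 * (L + 1) ^ 2) := by ring
      _ ≤ 9 * 9 ^ (L + 1) := by gcongr
      _ = 9 ^ (L + 1 + 1) := by ring

theorem card_prefix_le {Tk : Type} {n H : ℕ} (𝒯 : Finset Tk) (loc : Tk → Fin n)
    (hloc : Set.InjOn loc 𝒯) (pos : Fin n → List (Fin 3)) (hpos : Function.Injective pos)
    (hH : ∀ p, (pos p).length = H) (ρ : List (Fin 3)) [DecidablePred fun t => ρ <+: pos (loc t)] :
    (𝒯.filter fun t => ρ <+: pos (loc t)).card ≤ 3 ^ (H - ρ.length) := by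
  obtain ⟨S, hS, hS'⟩ := exists_lists (Fin 3) (H - ρ.length)
  rw [Fintype.card_fin] at hS
  rw [← hS]
  refine Finset.card_le_card_of_injOn (fun t => (pos (loc t)).drop ρ.length) ?_ ?_
  · intro t ht
    simp [hS', hH]
  · intro t ht t' ht' he
    simp only [Finset.coe_filter, Set.mem_ofPred_eq] at ht ht'
    obtain ⟨r, hr⟩ := ht.2
    obtain ⟨r', hr'⟩ := ht'.2
    simp only [← hr, ← hr', List.drop_left] at he
    exact hloc ht.1 ht'.1 (hpos (by rw [← hr, ← hr', he]))

open Classical in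
/-- If the tokens are divided at random into `L` groups, then with high probability no group has
more than twice the expected number of tokens in any vertex on the first `L` levels. -/
theorem rare_unbalanced {Tk : Type} [Fintype Tk] {n H L : ℕ} (𝒯 : Finset Tk) (loc : Tk → Fin n)
    (hloc : Set.InjOn loc 𝒯) (pos : Fin n → List (Fin 3)) (hpos : Function.Injective pos)
    (hH : ∀ p, (pos p).length = H) (hLH : 4 * L ≤ H) :
    Rare 32 fun g : Tk → Fin L => ∃ b ρ, ρ.length < L ∧
      2 * 3 ^ (H - ρ.length) < L * (𝒯.filter fun t => g t = b ∧ ρ <+: pos (loc t)).card := by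
  choose S hS hS' using exists_lists (Fin 3)
  set N := Fintype.card (Tk → Fin L) with hN
  let bad : ℕ × List (Fin 3) × Fin L → Finset (Tk → Fin L) := fun x =>
    Finset.univ.filter fun g => 2 * 3 ^ (H - x.2.1.length) <
      L * (𝒯.filter fun t => g t = x.2.2 ∧ x.2.1 <+: pos (loc t)).card
  have hbad : ∀ l < L, ∀ ρ ∈ S l, ∀ b, 3 ^ H * (bad (l, ρ, b)).card ≤ N * L * 3 ^ l := by
    intro l hl ρ hρ b
    rw [hS'] at hρ
    set T := 𝒯.filter fun t => ρ <+: pos (loc t) with hT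
    set M := 3 ^ (H - l) with hM
    have hTM : T.card ≤ M := by
      have := card_prefix_le 𝒯 loc hloc pos hpos hH ρ
      rwa [hρ] at this
    have h1 := sum_sq_hits_le (β := Fin L) T (fun _ x => x = b) 1
      (fun _ _ => by simp [Finset.filter_eq'])
    rw [Fintype.card_fin, ← hN] at h1
    have h2 : ((bad (l, ρ, b)).card : ℤ) * M ^ 2 ≤ ∑ g : Tk → Fin L,
        ((L * (T.filter fun i => g i = b).card : ℤ) - T.card * 1) ^ 2 := by
      rw [← nsmul_eq_mul]
      refine (Finset.card_nsmul_le_sum _ _ _ fun g hg => ?_).trans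
        (Finset.sum_le_univ_sum_of_nonneg fun _ => sq_nonneg _)
      have hg := (Finset.mem_filter.1 hg).2
      have h3 : (𝒯.filter fun t => g t = b ∧ ρ <+: pos (loc t)) = T.filter fun i => g i = b := by
        rw [hT, Finset.filter_filter]
        exact Finset.filter_congr fun _ _ => and_comm
      simp only [hρ, h3, ← hM] at hg
      have hg' : (2 * M : ℤ) < L * (T.filter fun i => g i = b).card := by exact_mod_cast hg
      have hTM' : (T.card : ℤ) ≤ M := by exact_mod_cast hTM
      exact pow_le_pow_left₀ (by positivity) (by linarith) 2
    have h4 : (bad (l, ρ, b)).card * M ^ 2 ≤ N * (T.card * (1 * L)) := by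
      exact_mod_cast h2.trans h1
    have h5 : (bad (l, ρ, b)).card * M ≤ N * L := by
      have hM0 : 0 < M := by positivity
      refine Nat.le_of_mul_le_mul_left (c := M) ?_ hM0
      calc M * ((bad (l, ρ, b)).card * M) = (bad (l, ρ, b)).card * M ^ 2 := by ring
        _ ≤ N * (T.card * (1 * L)) := h4
        _ ≤ N * (M * (1 * L)) := by gcongr
        _ = M * (N * L) := by ring
    calc 3 ^ H * (bad (l, ρ, b)).card = 3 ^ l * ((bad (l, ρ, b)).card * M) := by
          rw [hM, show 3 ^ H = 3 ^ (l + (H - l)) by rw [Nat.add_sub_cancel' (by omega)], pow_add]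
          ring
      _ ≤ 3 ^ l * (N * L) := Nat.mul_le_mul_left _ h5
      _ = N * L * 3 ^ l := by ring
  let idx : Finset (ℕ × List (Fin 3) × Fin L) :=
    (Finset.range L).biUnion fun l => (S l ×ˢ Finset.univ).image fun x => (l, x)
  have hsum : 3 ^ H * ∑ x ∈ idx, (bad x).card ≤ N * L ^ 2 * ∑ l ∈ Finset.range L, 9 ^ l := by
    rw [Finset.mul_sum, Finset.sum_biUnion, Finset.mul_sum]
    · refine Finset.sum_le_sum fun l hl => ?_
      rw [Finset.sum_image (by intro x _ y _ h; exact (Prod.mk.inj h).2)]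
      calc _ ≤ ∑ x ∈ S l ×ˢ (Finset.univ : Finset (Fin L)), N * L * 3 ^ l :=
            Finset.sum_le_sum fun x hx => hbad l (Finset.mem_range.1 hl) x.1
              (Finset.mem_product.1 hx).1 x.2
        _ = N * L ^ 2 * 9 ^ l := by
            rw [Finset.sum_const, Finset.card_product, hS, Finset.card_univ, Fintype.card_fin,
              Fintype.card_fin, smul_eq_mul, show 9 = 3 * 3 from rfl, mul_pow]
            ring
    · intro l _ l' _ hne
      simp only [Function.onFun]
      rw [Finset.disjoint_left]
      rintro x hx hx'
      obtain ⟨y, _, rfl⟩ := Finset.mem_image.1 hx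
      obtain ⟨y', _, hy'⟩ := Finset.mem_image.1 hx'
      exact hne (Prod.mk.inj hy').1.symm
  have hcover : (Finset.univ.filter fun g : Tk → Fin L => ∃ b ρ, ρ.length < L ∧
      2 * 3 ^ (H - ρ.length) < L * (𝒯.filter fun t => g t = b ∧ ρ <+: pos (loc t)).card) ⊆
        idx.biUnion bad := by
    intro g hg
    obtain ⟨b, ρ, hρ, hg⟩ := (Finset.mem_filter.1 hg).2
    refine Finset.mem_biUnion.2 ⟨(ρ.length, ρ, b), ?_, Finset.mem_filter.2 ⟨Finset.mem_univ _, hg⟩⟩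
    simp [idx, hρ, hS']
  have h1 := (Finset.card_le_card hcover).trans Finset.card_biUnion_le
  unfold Rare
  rw [Nat.card_eq_fintype_card, Nat.card_eq_fintype_card, Fintype.card_subtype]
  set Z := (Finset.univ.filter fun g : Tk → Fin L => ∃ b ρ, ρ.length < L ∧
      2 * 3 ^ (H - ρ.length) < L * (𝒯.filter fun t => g t = b ∧ ρ <+: pos (loc t)).card).card
  have h81 : 9 ^ L * 9 ^ L ≤ 3 ^ H := by
    calc 9 ^ L * 9 ^ L = 3 ^ (4 * L) := by rw [← mul_pow, pow_mul]; norm_num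
      _ ≤ 3 ^ H := Nat.pow_le_pow_right (by norm_num) hLH
  refine Nat.le_of_mul_le_mul_left (c := 3 ^ H) ?_ (by positivity)
  calc 3 ^ H * (32 * Z) ≤ 3 ^ H * (32 * ∑ x ∈ idx, (bad x).card) := by gcongr
    _ = 32 * (3 ^ H * ∑ x ∈ idx, (bad x).card) := by ring
    _ ≤ 32 * (N * L ^ 2 * ∑ l ∈ Finset.range L, 9 ^ l) := by gcongr
    _ = N * (4 * L ^ 2) * (8 * ∑ l ∈ Finset.range L, 9 ^ l) := by ring
    _ ≤ N * 9 ^ L * 9 ^ L := by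
      have := eight_mul_sum_pow L
      have := four_mul_sq_le L
      gcongr
      omega
    _ = N * (9 ^ L * 9 ^ L) := by ring
    _ ≤ N * 3 ^ H := by gcongr
    _ = 3 ^ H * N := by ring

/-! ### Mastermind with blanks and as many colors as positions -/

/-- The queries of black-peg Mastermind with `n` positions and `n` colors in which positions may
be left blank. -/
def blankQueries (n : ℕ) : Set ((Fin n → Fin n) → ℕ) :=
  Set.range fun (q : Fin n → Option (Fin n)) c => (Finset.univ.filter fun i => q i = some (c i)).card

/-- The positions with color `f`. -/
def colorClass {n k : ℕ} (c : Fin n → Fin k) (f : Fin k) : Finset (Fin n) :=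
  Finset.univ.filter fun i => c i = f

/-- The position with color `t.1` in the set `t.2`. -/
noncomputable def tokenLoc {n : ℕ} [NeZero n] (c : Fin n → Fin n)
    (t : Fin n × Finset (Fin n)) : Fin n :=
  Classical.epsilon fun i => i ∈ t.2 ∧ c i = t.1

theorem tokenLoc_eq_iff {n : ℕ} [NeZero n] {c : Fin n → Fin n} {t : Fin n × Finset (Fin n)}
    (h : (colorClass c t.1 ∩ t.2).card = 1) (i : Fin n) :
    tokenLoc c t = i ↔ i ∈ t.2 ∧ c i = t.1 := by
  obtain ⟨j, hj⟩ := Finset.card_eq_one.1 h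
  have hm : ∀ i, (i ∈ t.2 ∧ c i = t.1) ↔ i = j := by
    intro i
    rw [← Finset.mem_singleton (a := j), ← hj]
    simp [colorClass, and_comm]
  have hs : tokenLoc c t ∈ t.2 ∧ c (tokenLoc c t) = t.1 :=
    Classical.epsilon_spec (p := fun i => i ∈ t.2 ∧ c i = t.1) ⟨j, (hm j).2 rfl⟩
  rw [hm] at hs
  rw [hs, hm, eq_comm]

/-- The pairs of a color and a set of positions that separate the positions of equal color. -/
def tokens {n d : ℕ} (h : Fin d → Fin n → Bool) (c : Fin n → Fin n) :
    Finset (Fin n × Finset (Fin n)) :=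
  Finset.univ.filter fun t => t.2 ∈ splitSets d h Finset.univ (colorClass c t.1)

theorem injOn_tokenLoc {n d : ℕ} [NeZero n] (h : Fin d → Fin n → Bool) (c : Fin n → Fin n) :
    Set.InjOn (tokenLoc c) (tokens h c) := by
  intro t ht t' ht' he
  simp only [tokens, Finset.coe_filter, Finset.mem_univ, true_and, Set.mem_ofPred_eq] at ht ht'
  have h1 := (tokenLoc_eq_iff (splitSets_spec _ _ _ _ _ ht).2 _).1 rfl
  have h2 := (tokenLoc_eq_iff (splitSets_spec _ _ _ _ _ ht').2 _).1 he.symm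
  have hf : t.1 = t'.1 := h1.2.symm.trans h2.2
  refine Prod.ext hf ?_
  by_contra hne
  rw [← hf] at ht'
  exact Finset.disjoint_left.1 (splitSets_disjoint _ _ _ _ _ _ ht ht' hne) h1.1 h2.1

theorem exists_height (n : ℕ) (hn : 1 ≤ n) :
    ∃ H L : ℕ, 1 ≤ L ∧ 4 * L ≤ H ∧ H ≤ 7 * L ∧ n ≤ 3 ^ H ∧ 3 ^ H ≤ 81 * n := by
  refine ⟨max (Nat.clog 3 n) 4, max (Nat.clog 3 n) 4 / 4, ?_, ?_, ?_, ?_, ?_⟩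
  · omega
  · omega
  · omega
  · exact (Nat.le_pow_clog (by norm_num) n).trans
      (Nat.pow_le_pow_right (by norm_num) (le_max_left _ _))
  · rcases le_total (Nat.clog 3 n) 4 with h | h
    · rw [max_eq_right h]; omega
    · rw [max_eq_left h]
      have h1 := Nat.pow_pred_clog_lt_self (b := 3) (by norm_num) (x := n) (by
        by_contra hn1
        have : n = 1 := by omega
        simp [this] at h)
      obtain ⟨m, hm⟩ : ∃ m, Nat.clog 3 n = m + 1 := ⟨Nat.clog 3 n - 1, by omega⟩
      rw [hm] at h1 ⊢
      rw [pow_succ]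
      simp only [Nat.pred_eq_sub_one, Nat.add_sub_cancel] at h1
      omega

/-- Mastermind with blanks and `n` colors is solved by `O(n)` queries: there is a finite family of
decision trees of this depth such that every codeword is found by most of them. -/
theorem exists_blank_solver (n : ℕ) (hn : 1 ≤ n) :
    ∃ (Ω : Type) (_ : Fintype Ω) (_ : Nonempty Ω) (good : Ω → Set (Fin n → Fin n)),
      (∀ ω, Learn (blankQueries n) (fun c => c) (good ω) fun _ => 50000 * n) ∧
      ∀ c, Rare 16 fun ω => c ∉ good ω := by
  classical
  have : NeZero n := ⟨by omega⟩
  obtain ⟨H, L, hL1, hLH, hHL, hnH, hHn⟩ := exists_height n hn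
  have : NeZero L := ⟨by omega⟩
  obtain ⟨e⟩ : Nonempty (Fin n ↪ (Fin H → Fin 3)) := by
    rw [Function.Embedding.nonempty_iff_card_le]; simpa using hnH
  let pos : Fin n → List (Fin 3) := fun p => List.ofFn (e p)
  have hpos : Function.Injective pos := List.ofFn_injective.comp e.injective
  have hH : ∀ p, (pos p).length = H := fun p => by simp [pos]
  set G := 36 * 3 ^ H / (L * 6 ^ L) + 1 with hG
  have hG1 : 36 * 3 ^ H ≤ L * (G * 6 ^ L) := by
    have h := Nat.lt_div_mul_add (a := 36 * 3 ^ H) (b := L * 6 ^ L) (by positivity)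
    calc 36 * 3 ^ H ≤ 36 * 3 ^ H / (L * 6 ^ L) * (L * 6 ^ L) + L * 6 ^ L := h.le
      _ = L * (G * 6 ^ L) := by rw [hG]; ring
  have hG2 : L * (G * 6 ^ L) ≤ 37 * 3 ^ H := by
    have h := Nat.div_mul_le_self (36 * 3 ^ H) (L * 6 ^ L)
    have h' : L * 6 ^ L ≤ 3 ^ H := by
      calc L * 6 ^ L ≤ 2 ^ L * 6 ^ L := by gcongr; exact Nat.lt_two_pow_self.le
        _ = 12 ^ L := by rw [← mul_pow]; norm_num
        _ ≤ 81 ^ L := Nat.pow_le_pow_left (by norm_num) _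
        _ = 3 ^ (4 * L) := by rw [pow_mul]; norm_num
        _ ≤ 3 ^ H := Nat.pow_le_pow_right (by norm_num) hLH
    calc L * (G * 6 ^ L) = 36 * 3 ^ H / (L * 6 ^ L) * (L * 6 ^ L) + L * 6 ^ L := by rw [hG]; ring
      _ ≤ 37 * 3 ^ H := by omega
  have hcost : (H + L) * (2 * (G * (3 ^ L * 2 ^ L))) ≤ 592 * (81 * n) := by
    calc (H + L) * (2 * (G * (3 ^ L * 2 ^ L))) ≤ (8 * L) * (2 * (G * (3 ^ L * 2 ^ L))) := by
          gcongr; omega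
      _ = 16 * (L * (G * 6 ^ L)) := by rw [← mul_pow]; ring
      _ ≤ 16 * (37 * 3 ^ H) := by gcongr
      _ = 592 * 3 ^ H := by ring
      _ ≤ _ := by gcongr
  let Unbal : (Fin n → Fin n) → (Fin (64 * n) → Fin n → Bool) →
      (Fin n × Finset (Fin n) → Fin L) → Prop := fun c h g => ∃ b ρ, ρ.length < L ∧
    2 * 3 ^ (H - ρ.length) <
      L * ((tokens h c).filter fun t => g t = b ∧ ρ <+: pos (tokenLoc c t)).card
  let cost : (Fin n → Fin n) → (Fin (64 * n) → Fin n → Bool) → ℕ := fun c h =>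
    ∑ f, splitCost (64 * n) h Finset.univ (colorClass c f)
  refine ⟨(Fin (64 * n) → Fin n → Bool) × (Fin n × Finset (Fin n) → Fin L), inferInstance,
    inferInstance, fun ω => {c | ¬ (64 * n ≤ cost c ω.1 ∨ Unbal c ω.1 ω.2)}, ?_, ?_⟩
  · rintro ⟨h, g⟩
    set D : Set (Fin n → Fin n) := {c | ¬ (64 * n ≤ cost c h ∨ Unbal c h g)} with hD
    have hclass : ∀ f S (D : Set (Fin n → Fin n)), Learn (blankQueries n)
        (fun c => (colorClass c f ∩ S).card) D fun _ => 1 := by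
      intro f S D
      have : (fun c : Fin n → Fin n => (colorClass c f ∩ S).card) ∈ blankQueries n := by
        refine ⟨fun i => if i ∈ S then some f else none, ?_⟩
        funext c
        refine congrArg Finset.card ?_
        ext i
        by_cases hi : i ∈ S <;> simp [hi, colorClass, eq_comm]
      exact Learn.query this
    have hcounts := Learn.family (𝒬 := blankQueries n) (D := D)
      (f := fun f c => (colorClass c f ∩ Finset.univ).card) (κ := fun _ _ => 1)
      fun f => hclass f Finset.univ D
    have htok : Learn (blankQueries n) (fun c => tokens h c) D fun c => n + cost c h := by
      refine (hcounts.bind (G := fun c f => splitSets (64 * n) h Finset.univ (colorClass c f))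
        (κ' := fun c => cost c h) fun b => Learn.family fun f => ?_).map ?_ |>.mono subset_rfl ?_
      · exact learn_splitSets (fun c => colorClass c f) (64 * n) h Finset.univ _
          (fun S _ => hclass f S _)
          fun c hc c' hc' => congrFun (hc.2.trans hc'.2.symm) f
      · intro c _ c' _ he
        simp only [tokens]
        ext t
        simp only [Finset.mem_filter, Finset.mem_univ, true_and]
        rw [show splitSets (64 * n) h Finset.univ (colorClass c t.1) =
          splitSets (64 * n) h Finset.univ (colorClass c' t.1) from congrFun he t.1]
      · intro c _; simp
    have hloc : ∀ 𝒯, Learn (blankQueries n) (fun c => c) (D ∩ {c | tokens h c = 𝒯})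
        fun _ => (H + L) * (2 * (G * (3 ^ L * 2 ^ L))) := by
      intro 𝒯
      have hone : ∀ c ∈ D ∩ {c | tokens h c = 𝒯}, ∀ t ∈ 𝒯, (colorClass c t.1 ∩ t.2).card = 1 := by
        intro c hc t ht
        rw [← hc.2] at ht
        exact (splitSets_spec _ _ _ _ _ (Finset.mem_filter.1 ht).2).2
      refine (learn_locations (𝒯 := 𝒯) (loc := tokenLoc) ?_ pos hpos hH (by omega) hG1 g ?_).map ?_
      · intro u
        -- The positive and the negative part of a signed query are asked separately.
        let q : Bool → Fin n → Option (Fin n) := fun s p => (u p).bind fun r =>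
          if r.1 = s ∧ r.2 ∈ 𝒯 ∧ p ∈ r.2.2 then some r.2.1 else none
        have hqq : ∀ s, Learn (blankQueries n) (fun c : Fin n → Fin n =>
            (Finset.univ.filter fun i => q s i = some (c i)).card) (D ∩ {c | tokens h c = 𝒯})
            fun _ => 1 := fun s => Learn.query ⟨q s, rfl⟩
        have hval : ∀ c ∈ D ∩ {c | tokens h c = 𝒯}, signedVal 𝒯 tokenLoc u c =
            ((Finset.univ.filter fun i => q true i = some (c i)).card : ℤ) -
              (Finset.univ.filter fun i => q false i = some (c i)).card := by
          intro c hc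
          rw [signedVal, Finset.card_filter, Finset.card_filter]
          push_cast
          rw [← Finset.sum_sub_distrib]
          refine Finset.sum_congr rfl fun p _ => ?_
          simp only [q]
          obtain hu | ⟨s, t, hu⟩ : u p = none ∨ ∃ s t, u p = some (s, t) := by
            rcases u p with _ | ⟨s, t⟩ <;> simp
          · simp [hu]
          · simp only [hu]
            by_cases ht : t ∈ 𝒯
            · simp only [Option.elim_some, ht, true_and, Option.bind_some,
                tokenLoc_eq_iff (hone c hc t ht)]
              by_cases hp : p ∈ t.2 <;> by_cases hcp : c p = t.1 <;>
                cases s <;> simp [hp, hcp, eq_comm (a := t.1)]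
            · simp [ht]
        refine ((hqq true).pair (hqq false)).map fun c hc c' hc' he => ?_
        simp only [Prod.mk.injEq] at he
        rw [hval c hc, hval c' hc', he.1, he.2]
      · intro c hc b ρ hρ
        have h1 := hc.1
        simp only [hD, Set.mem_ofPred_eq, not_or, Unbal, not_exists, not_and, not_lt] at h1
        have h2 := h1.2 b ρ hρ
        rwa [show tokens h c = 𝒯 from hc.2] at h2
      · intro c hc c' hc' he
        funext i
        have h1 := hc.1
        simp only [hD, Set.mem_ofPred_eq, not_or, not_le] at h1
        obtain ⟨S, hS, hiS⟩ := exists_mem_splitSets (64 * n) h Finset.univ (colorClass c (c i))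
          ((Finset.single_le_sum (f := fun f => splitCost (64 * n) h Finset.univ (colorClass c f))
            (fun _ _ => Nat.zero_le _) (Finset.mem_univ (c i))).trans_lt h1.1) i
          (by simp [colorClass]) (Finset.mem_univ _)
        have ht : (c i, S) ∈ 𝒯 := by
          rw [← hc.2]; exact Finset.mem_filter.2 ⟨Finset.mem_univ _, hS⟩
        have h2 : tokenLoc c (c i, S) = i :=
          (tokenLoc_eq_iff (t := (c i, S)) (hone c hc _ ht) i).2 ⟨hiS, rfl⟩
        have h3 := congrFun he (c i, S)
        simp only [ht, if_true, Option.some.injEq, h2] at h3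
        exact ((tokenLoc_eq_iff (t := (c i, S)) (hone c' hc' _ ht) i).1 h3.symm).2.symm
    refine (htok.bind hloc).mono subset_rfl fun c hc => ?_
    simp only [Set.mem_ofPred_eq, not_or, not_le] at hc
    have := hc.1
    omega
  · intro c
    have h1 : Rare 32 fun h => 64 * n ≤ cost c h := by
      refine Rare.markov (E := 2 * n) ?_ (by omega) (by omega)
      simp only [cost]
      rw [Finset.sum_comm]
      refine (Finset.sum_le_sum fun f _ => sum_splitCost_le (64 * n) Finset.univ _).trans ?_
      rw [← Finset.mul_sum]
      refine Nat.mul_le_mul_left _ ?_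
      have h2 : ∑ f, (colorClass c f).card = n := by
        have := Finset.card_eq_sum_card_fiberwise (s := Finset.univ) (t := Finset.univ) (f := c)
          (fun _ _ => by simp)
        simpa [colorClass] using this.symm
      rw [← Finset.mul_sum]
      refine Nat.mul_le_mul_left _ ?_
      calc _ ≤ ∑ f, (colorClass c f).card := Finset.sum_le_sum fun f _ => by simp
        _ = n := h2
    have h2 : Rare 32 fun ω : (Fin (64 * n) → Fin n → Bool) × (Fin n × Finset (Fin n) → Fin L) =>
        Unbal c ω.1 ω.2 :=
      Rare.prod fun h => rare_unbalanced (tokens h c) (tokenLoc c) (injOn_tokenLoc h c) pos hpos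
        hH hLH
    exact (Rare.or (K := 16) h1.fst h2).mono fun ω hω => not_not.1 hω

end

/-! ### Black-peg Mastermind with linearly many queries -/

section

theorem exists_code {α : Type} {n : ℕ} [NeZero n] (S : Finset α) :
    ∃ e : α → Fin n, S.card ≤ n → Set.InjOn e S := by
  classical
  by_cases h : S.card ≤ n
  · obtain ⟨f⟩ : Nonempty (S ↪ Fin n) := by
      rw [Function.Embedding.nonempty_iff_card_le]; simpa using h
    refine ⟨fun a => if ha : a ∈ S then f ⟨a, ha⟩ else 0, fun _ a ha b hb hab => ?_⟩
    simp only [Finset.mem_coe] at ha hb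
    simpa [ha, hb] using hab
  · exact ⟨fun _ => 0, fun h' => absurd h' h⟩

/-- A numbering of the elements of a set with at most `n` elements by elements of `Fin n`. -/
noncomputable def code {α : Type} (n : ℕ) [NeZero n] (S : Finset α) : α → Fin n :=
  (exists_code S).choose

theorem code_injOn {α : Type} {n : ℕ} [NeZero n] {S : Finset α} (h : S.card ≤ n) :
    Set.InjOn (code n S) S :=
  (exists_code S).choose_spec h

variable {n k : ℕ}

/-- The colors that occur in a codeword. -/
def colors (c : Codeword n k) : Finset (Fin k) := Finset.univ.image c

theorem mem_colors (c : Codeword n k) (i : Fin n) : c i ∈ colors c :=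
  Finset.mem_image_of_mem _ (Finset.mem_univ i)

theorem card_colors_le (c : Codeword n k) : (colors c).card ≤ n :=
  Finset.card_image_le.trans (by simp)

/-- The codeword with its colors renumbered by elements of `Fin n`. -/
noncomputable def normalize [NeZero n] (c : Codeword n k) : Fin n → Fin n :=
  fun i => code n (colors c) (c i)

/-- If the set of colors of the codeword and a query without black pegs are known, then Mastermind
with blanks can be simulated. -/
theorem learn_of_blank {A : Type} [NeZero n] {𝒬 : Set (Codeword n k → A)} {D : Set (Codeword n k)}
    (hq : ∀ q, Learn 𝒬 (fun c => black c q) D fun _ => 1) (z : Codeword n k)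
    (hz : ∀ c ∈ D, ∀ i, z i ≠ c i) (X : Finset (Fin k)) (hX : ∀ c ∈ D, colors c = X)
    {D' : Set (Fin n → Fin n)} {T : ℕ}
    (h : Learn (blankQueries n) (fun c => c) D' fun _ => T) (hD : ∀ c ∈ D, normalize c ∈ D') :
    Learn 𝒬 (fun c => c) D fun _ => T := by
  classical
  have hinj : ∀ c ∈ D, Set.InjOn (code n X) X := fun c hc =>
    code_injOn (hX c hc ▸ card_colors_le c)
  refine ((h.sim normalize 1 hD ?_).map ?_).mono subset_rfl fun c _ => by simp
  · rintro _ ⟨q, rfl⟩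
    let q' : Codeword n k := fun i =>
      if hi : ∃ x ∈ X, q i = some (code n X x) then hi.choose else z i
    refine (hq q').map fun c hc c' hc' he => ?_
    have key : ∀ c ∈ D,
        (Finset.univ.filter fun i => q i = some (normalize c i)).card = black c q' := by
      intro c hc
      refine congrArg Finset.card (Finset.filter_congr fun i _ => ?_)
      have hci : c i ∈ X := hX c hc ▸ mem_colors c i
      simp only [normalize, q', hX c hc]
      constructor
      · intro hi
        have hex : ∃ x ∈ X, q i = some (code n X x) := ⟨c i, hci, hi⟩
        rw [dif_pos hex]
        exact (hinj c hc hci hex.choose_spec.1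
          (Option.some.inj (hi.symm.trans hex.choose_spec.2))).symm
      · intro hi
        by_cases hex : ∃ x ∈ X, q i = some (code n X x)
        · rw [dif_pos hex] at hi
          rw [hex.choose_spec.2, hi]
        · rw [dif_neg hex] at hi
          exact absurd hi (hz c hc i)
    exact (key c hc).trans (he.trans (key c' hc').symm)
  · intro c hc c' hc' he
    funext i
    have h1 : normalize c i = normalize c' i := congrFun he i
    simp only [normalize, hX c hc, hX c' hc'] at h1
    exact hinj c hc (hX c hc ▸ mem_colors c i) (hX c' hc' ▸ mem_colors c' i) h1

theorem black_const_eq_zero_iff (c : Codeword n k) (f : Fin k) :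
    black c (fun _ => f) = 0 ↔ f ∉ colors c := by
  rw [black, Finset.card_eq_zero, Finset.filter_eq_empty_iff]
  simp [colors, eq_comm]

/-- Changing a monochromatic query in one position tells whether this position has the color. -/
theorem black_update_const (c : Codeword n k) {f g : Fin k} (hfg : f ≠ g) (p : Fin n) :
    c p = f ↔ black c (Function.update (fun _ => f) p g) < black c fun _ => f := by
  have h0 : ∀ q : Codeword n k, black c q =
      (if q p = c p then 1 else 0) + ((Finset.univ.erase p).filter fun i => q i = c i).card := by
    intro q
    rw [black, ← Finset.insert_erase (Finset.mem_univ p), Finset.filter_insert]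
    split_ifs
    · rw [Finset.card_insert_of_notMem (by simp), Finset.erase_insert_eq_erase,
        Finset.erase_idem, add_comm]
    · rw [Finset.erase_insert_eq_erase, Finset.erase_idem, zero_add]
  have h1 : ((Finset.univ.erase p).filter fun i => Function.update (fun _ => f) p g i = c i) =
      (Finset.univ.erase p).filter fun i => f = c i :=
    Finset.filter_congr fun i hi => by rw [Function.update_of_ne (Finset.ne_of_mem_erase hi)]
  rw [h0, h0 fun _ => f, h1, Function.update_self]
  by_cases hf : f = c p
  · simp [hf.symm, hfg.symm]
  · simp only [hf, if_false, zero_add, add_lt_iff_neg_right, not_lt_zero, iff_false]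
    exact fun h => hf h.symm

theorem learn_black (q : Codeword n k) (D : Set (Codeword n k)) :
    Learn (queries black) (fun c => black c q) D fun _ => 1 :=
  Learn.query ⟨q, rfl⟩

/-- A query without black pegs is obtained from the `n + 1` answers that tell the positions of one
color, and the set of occurring colors from the `k` monochromatic queries. -/
theorem bmm_le_linear (hn : 1 ≤ n) (hk : 2 ≤ k) : bmm n k ≤ ((200000 * (n + k) : ℕ) : ℝ≥0∞) := by
  classical
  have : NeZero n := ⟨by omega⟩
  have : NeZero k := ⟨by omega⟩
  obtain ⟨Ω, _, _, good, hgood, hrare⟩ := exists_blank_solver n hn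
  let f : Fin k := ⟨0, by omega⟩
  let g : Fin k := ⟨1, by omega⟩
  have hfg : f ≠ g := by simp [f, g]
  have hlearn : ∀ ω, Learn (queries black) (fun c : Codeword n k => c) {c | normalize c ∈ good ω}
      fun _ => (n + 1) + k + 50000 * n := by
    intro ω
    set D : Set (Codeword n k) := {c | normalize c ∈ good ω} with hD
    have h1 := (Learn.family (𝒬 := queries (n := n) (k := k) black) (D := D)
      (f := fun p c => black c (Function.update (fun _ => f) p g)) (κ := fun _ _ => 1)
      fun p => learn_black _ D).pair (learn_black (fun _ => f) D)
    have h2 : Learn (queries black) (fun c : Codeword n k => fun p => if c p = f then g else f) D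
        fun _ => n + 1 := by
      refine (h1.map fun c _ c' _ he => ?_).mono subset_rfl fun c _ => by simp
      simp only [Prod.mk.injEq] at he
      funext p
      simp only [black_update_const _ hfg, he.2]
      rw [congrFun he.1 p]
    have h3 : Learn (queries black) (fun c : Codeword n k => colors c) D fun _ => k := by
      refine ((Learn.family (𝒬 := queries (n := n) (k := k) black) (D := D)
        (f := fun x c => black c fun _ => x) (κ := fun _ _ => 1) fun x => learn_black _ D).map
        fun c _ c' _ he => ?_).mono subset_rfl fun c _ => by simp
      ext x
      rw [← not_iff_not, ← black_const_eq_zero_iff, ← black_const_eq_zero_iff]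
      rw [congrFun he x]
    refine (h2.pair h3).bind fun ⟨z, X⟩ => ?_
    refine learn_of_blank (fun q => learn_black q _) z ?_ X ?_ (hgood ω) fun c hc => hc.1
    · intro c hc i
      have h4 : (if c i = f then g else f) = z i := congrFun (congrArg Prod.fst hc.2) i
      rw [← h4]
      split_ifs with h5
      · rw [h5]; exact hfg.symm
      · exact fun h => h5 h.symm
    · intro c hc
      exact congrArg Prod.snd hc.2
  refine (randQueryComplexity_le_of_half _ _ hlearn fun c => ?_).trans ?_
  · have := hrare (normalize c)
    unfold Rare at this
    rw [Nat.card_eq_fintype_card (α := Ω)] at this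
    change 16 * Nat.card {ω // normalize c ∉ good ω} ≤ _ at this
    simp only [Set.mem_ofPred_eq]
    omega
  · exact_mod_cast (show 2 * (n + 1 + k + 50000 * n + 1) + 1 ≤ 200000 * (n + k) by omega)

/-! ### Finding the colors with black and white pegs -/

theorem learn_blackWhite (q : Codeword n k) (D : Set (Codeword n k)) :
    Learn (queries blackWhite) (fun c => blackWhite c q) D fun _ => 1 :=
  Learn.query ⟨q, rfl⟩

theorem learn_black_of_blackWhite (q : Codeword n k) (D : Set (Codeword n k)) :
    Learn (queries blackWhite) (fun c => black c q) D fun _ => 1 :=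
  (learn_blackWhite q D).map fun _ _ _ _ he => congrArg Prod.fst he

theorem black_add_white (c q : Codeword n k) :
    black c q + white c q = Finset.univ.sup fun σ : Equiv.Perm (Fin n) => black c (q ∘ σ) := by
  rw [white, add_tsub_cancel_of_le]
  exact Finset.le_sup (f := fun σ : Equiv.Perm (Fin n) => black c (q ∘ σ))
    (Finset.mem_univ (Equiv.refl _))

/-- A query without repeated colors, except for a color that does not occur in the codeword, is
answered by the number of its colors that do occur. -/
theorem black_add_white_eq_card (c q : Codeword n k) (z : Fin k) (hz : z ∉ colors c)
    (hq : ∀ i j, q i = q j → q i ≠ z → i = j) :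
    black c q + white c q = (colors c ∩ colors q).card := by
  classical
  rw [black_add_white]
  refine le_antisymm (Finset.sup_le fun σ _ => ?_) ?_
  · refine Finset.card_le_card_of_injOn c ?_ ?_
    · intro i hi
      have hi := (Finset.mem_filter.1 hi).2
      refine Finset.mem_coe.2 (Finset.mem_inter.2 ⟨mem_colors c i, ?_⟩)
      rw [← hi]
      exact mem_colors q (σ i)
    · intro i hi j hj he
      have hi := (Finset.mem_filter.1 hi).2
      have hj := (Finset.mem_filter.1 hj).2
      refine σ.injective (hq _ _ (hi.trans (he.trans hj.symm)) fun h => hz ?_)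
      rw [← h]
      rw [show q (σ i) = c i from hi]
      exact mem_colors c i
  · have hc : ∀ y : {y // y ∈ colors c ∩ colors q}, ∃ i, c i = y := fun y => by
      simpa [colors] using (Finset.mem_inter.1 y.2).1
    have hq' : ∀ y : {y // y ∈ colors c ∩ colors q}, ∃ i, q i = y := fun y => by
      simpa [colors] using (Finset.mem_inter.1 y.2).2
    choose a ha using hc
    choose b hb using hq'
    have hai : Function.Injective a := fun x y h => Subtype.ext (by rw [← ha x, ← ha y, h])
    have hbi : Function.Injective b := fun x y h => Subtype.ext (by rw [← hb x, ← hb y, h])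
    let e : {i // i ∈ Set.range a} ≃ {i // i ∈ Set.range b} :=
      (Equiv.ofInjective a hai).symm.trans (Equiv.ofInjective b hbi)
    refine le_trans ?_ (Finset.le_sup (f := fun σ : Equiv.Perm (Fin n) => black c (q ∘ σ))
      (Finset.mem_univ (Equiv.extendSubtype e)))
    have hσ : ∀ y, Equiv.extendSubtype e (a y) = b y := by
      intro y
      rw [Equiv.extendSubtype_apply_of_mem e (a y) ⟨y, rfl⟩]
      have : (⟨a y, ⟨y, rfl⟩⟩ : {i // i ∈ Set.range a}) = Equiv.ofInjective a hai y := rfl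
      simp only [e, Equiv.trans_apply, this, Equiv.symm_apply_apply]
      rfl
    rw [← Fintype.card_coe, ← Finset.card_univ]
    refine Finset.card_le_card_of_injOn a (fun y _ => ?_) hai.injOn
    simp [hσ, ha, hb]

/-- A known absent color fills the unused positions, so that sets of up to `n` colors can be
tested. -/
theorem learn_card_colors_inter {D : Set (Codeword n k)} [NeZero n] (z : Fin k)
    (hz : ∀ c ∈ D, z ∉ colors c) (T : Finset (Fin k)) (hT : T.card ≤ n) :
    Learn (queries blackWhite) (fun c => (colors c ∩ T).card) D fun _ => 1 := by
  classical
  have hinj := code_injOn (n := n) hT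
  let q : Codeword n k := fun i => if h : ∃ t ∈ T, code n T t = i then h.choose else z
  have hqT : ∀ i, q i = z ∨ q i ∈ T ∧ code n T (q i) = i := by
    intro i
    by_cases h : ∃ t ∈ T, code n T t = i
    · right; simp only [q, dif_pos h]; exact h.choose_spec
    · left; simp only [q, dif_neg h]
  have hqt : ∀ t ∈ T, q (code n T t) = t := by
    intro t ht
    have h : ∃ t' ∈ T, code n T t' = code n T t := ⟨t, ht, rfl⟩
    simp only [q, dif_pos h]
    exact hinj h.choose_spec.1 ht h.choose_spec.2
  refine (learn_blackWhite q D).map fun c hc c' hc' he => ?_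
  have key : ∀ c ∈ D, (colors c ∩ T).card = black c q + white c q := by
    intro c hc
    rw [black_add_white_eq_card c q z (hz c hc)]
    · congr 1
      ext x
      simp only [Finset.mem_inter, and_congr_right_iff]
      intro hx
      constructor
      · intro hxT
        rw [← hqt x hxT]
        exact mem_colors q _
      · intro hxq
        obtain ⟨i, _, rfl⟩ := Finset.mem_image.1 hxq
        exact ((hqT i).resolve_left fun h => hz c hc (h ▸ hx)).1
    · intro i j hij hi
      have h1 := ((hqT i).resolve_left hi).2
      have h2 := ((hqT j).resolve_left (hij ▸ hi)).2
      rw [← h1, ← h2, hij]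
  rw [key c hc, key c' hc']
  simp only [blackWhite, Prod.mk.injEq] at he
  rw [he.1, he.2]

end

/-! ### Black-white-peg Mastermind with many colors -/

section

variable {n k : ℕ}

/-- An element of `X ∩ R`. -/
noncomputable def commonElement [NeZero k] (X R : Finset (Fin k)) : Fin k :=
  Classical.epsilon fun x => x ∈ X ∩ R

theorem commonElement_mem [NeZero k] {X R : Finset (Fin k)} (h : (X ∩ R).card = 1) :
    commonElement X R ∈ X ∩ R :=
  Classical.epsilon_spec (p := fun x => x ∈ X ∩ R) (Finset.card_pos.1 (by omega))

theorem commonElement_unique [NeZero k] {X R : Finset (Fin k)} (h : (X ∩ R).card = 1) {x : Fin k}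
    (hx : x ∈ X) (hR : x ∈ R) : x = commonElement X R :=
  Finset.card_le_one.1 h.le _ (Finset.mem_inter.2 ⟨hx, hR⟩) _ (commonElement_mem h)

open Classical in
/-- If every set in `𝒮` has exactly one element in `X`, then finding these elements is Mastermind:
the positions are the sets in `𝒮`, the colors are the numbers of the elements within their set.
Superfluous positions get color `0`. -/
noncomputable def groupSecret [NeZero n] [NeZero k] (𝒮 : Finset (Finset (Fin k)))
    (X : Finset (Fin k)) : Fin n → Fin n := fun i =>
  if h : ∃ R ∈ 𝒮, code n 𝒮 R = i then code n h.choose (commonElement X h.choose) else 0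

theorem groupSecret_code [NeZero n] [NeZero k] {𝒮 : Finset (Finset (Fin k))} (h𝒮 : 𝒮.card ≤ n)
    (X : Finset (Fin k)) {R : Finset (Fin k)} (hR : R ∈ 𝒮) :
    groupSecret 𝒮 X (code n 𝒮 R) = code n R (commonElement X R) := by
  have h : ∃ R' ∈ 𝒮, code n 𝒮 R' = code n 𝒮 R := ⟨R, hR, rfl⟩
  have h2 : h.choose = R := code_injOn h𝒮 h.choose_spec.1 hR h.choose_spec.2
  simp only [groupSecret, dif_pos h]
  rw [h2]

theorem groupSecret_of_notMem [NeZero n] [NeZero k] {𝒮 : Finset (Finset (Fin k))}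
    (X : Finset (Fin k)) {i : Fin n} (hi : ¬ ∃ R ∈ 𝒮, code n 𝒮 R = i) :
    groupSecret 𝒮 X i = 0 := dif_neg hi

/-- A family of small sets that separates the elements of `X`. -/
structure Separates (n : ℕ) (𝒮 : Finset (Finset (Fin k))) (X : Finset (Fin k)) : Prop where
  one : ∀ R ∈ 𝒮, (X ∩ R).card = 1
  small : ∀ R ∈ 𝒮, R.card ≤ n
  disjoint : ∀ R ∈ 𝒮, ∀ R' ∈ 𝒮, R ≠ R' → Disjoint R R'
  cover : ∀ x ∈ X, ∃ R ∈ 𝒮, x ∈ R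

theorem Separates.card_le [NeZero k] {𝒮 : Finset (Finset (Fin k))} {X : Finset (Fin k)}
    (h : Separates n 𝒮 X) (hX : X.card ≤ n) : 𝒮.card ≤ n := by
  refine (Finset.card_le_card_of_injOn (commonElement X) ?_ ?_).trans hX
  · exact fun R hR => (Finset.mem_inter.1 (commonElement_mem (h.one R hR))).1
  · intro R hR R' hR' he
    by_contra hne
    refine Finset.disjoint_left.1 (h.disjoint R hR R' hR' hne)
      (Finset.mem_inter.1 (commonElement_mem (h.one R hR))).2 ?_
    rw [he]
    exact (Finset.mem_inter.1 (commonElement_mem (h.one R' hR'))).2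

/-- Once the occurring colors are separated by small sets, they are found by solving Mastermind
with blanks for the group secret. -/
theorem learn_colors_of_separates [NeZero n] [NeZero k] {D : Set (Codeword n k)} (z : Fin k)
    (hz : ∀ c ∈ D, z ∉ colors c) (𝒮 : Finset (Finset (Fin k)))
    (h𝒮 : ∀ c ∈ D, Separates n 𝒮 (colors c)) {D' : Set (Fin n → Fin n)} {T : ℕ}
    (h : Learn (blankQueries n) (fun c => c) D' fun _ => T)
    (hD : ∀ c ∈ D, groupSecret 𝒮 (colors c) ∈ D') :
    Learn (queries blackWhite) (fun c : Codeword n k => colors c) D fun _ => T := by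
  classical
  rcases D.eq_empty_or_nonempty with rfl | ⟨c₀, hc₀⟩
  · exact .done (by simp)
  have hcard : 𝒮.card ≤ n := (h𝒮 c₀ hc₀).card_le (card_colors_le c₀)
  have hinj := code_injOn (n := n) hcard
  refine ((h.sim (fun c : Codeword n k => groupSecret 𝒮 (colors c)) 1 hD ?_).map ?_).mono
    subset_rfl fun c _ => by simp
  · rintro _ ⟨q, rfl⟩
    let T : Finset (Fin k) :=
      Finset.univ.filter fun x => ∃ R ∈ 𝒮, x ∈ R ∧ q (code n 𝒮 R) = some (code n R x)
    have hT : T.card ≤ n := by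
      refine le_trans ?_ hcard
      have hex : ∀ x ∈ T, ∃ R ∈ 𝒮, x ∈ R ∧ q (code n 𝒮 R) = some (code n R x) :=
        fun x hx => (Finset.mem_filter.1 hx).2
      refine Finset.card_le_card_of_injOn
        (fun x => if hx : x ∈ T then (hex x hx).choose else ∅) ?_ ?_
      · intro x hx
        simp only [Finset.mem_coe] at hx ⊢
        rw [dif_pos hx]
        exact (hex x hx).choose_spec.1
      · intro x hx y hy he
        simp only [Finset.mem_coe] at hx hy
        simp only [dif_pos hx, dif_pos hy] at he
        obtain ⟨h1, h2, h3⟩ := (hex x hx).choose_spec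
        obtain ⟨_, h5, h6⟩ := (hex y hy).choose_spec
        rw [← he] at h5 h6
        exact code_injOn ((h𝒮 c₀ hc₀).small _ h1) h2 h5
          (Option.some.inj (h3.symm.trans h6))
    refine (learn_card_colors_inter z hz T hT).map fun c hc c' hc' he => ?_
    have key : ∀ c ∈ D, (Finset.univ.filter fun i =>
        q i = some (groupSecret 𝒮 (colors c) i)).card = (colors c ∩ T).card +
        (Finset.univ.filter fun i => (¬ ∃ R ∈ 𝒮, code n 𝒮 R = i) ∧ q i = some 0).card := by
      intro c hc
      have hs := h𝒮 c hc
      set X := colors c with hX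
      set P := 𝒮.filter fun R => q (code n 𝒮 R) = some (code n R (commonElement X R)) with hP
      have h1 : (X ∩ T) = P.image (commonElement X) := by
        ext x
        simp only [Finset.mem_inter, Finset.mem_image, T, hP, Finset.mem_filter, Finset.mem_univ,
          true_and]
        constructor
        · rintro ⟨hx, R, hR, hxR, hqR⟩
          obtain rfl := commonElement_unique (hs.one R hR) hx hxR
          exact ⟨R, ⟨hR, hqR⟩, rfl⟩
        · rintro ⟨R, ⟨hR, hqR⟩, rfl⟩
          have := Finset.mem_inter.1 (commonElement_mem (hs.one R hR))
          exact ⟨this.1, R, hR, this.2, hqR⟩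
      have h2 : (Finset.univ.filter fun i => q i = some (groupSecret 𝒮 X i)) =
          P.image (code n 𝒮) ∪
            Finset.univ.filter fun i => (¬ ∃ R ∈ 𝒮, code n 𝒮 R = i) ∧ q i = some 0 := by
        ext i
        simp only [Finset.mem_union, Finset.mem_image, hP, Finset.mem_filter, Finset.mem_univ,
          true_and]
        by_cases hi : ∃ R ∈ 𝒮, code n 𝒮 R = i
        · obtain ⟨R, hR, rfl⟩ := hi
          rw [groupSecret_code hcard X hR]
          constructor
          · exact fun hq => Or.inl ⟨R, ⟨hR, hq⟩, rfl⟩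
          · rintro (⟨R', ⟨hR', hq⟩, he⟩ | ⟨h, _⟩)
            · obtain rfl := hinj hR' hR he
              exact hq
            · exact absurd ⟨R, hR, rfl⟩ h
        · rw [groupSecret_of_notMem X hi]
          constructor
          · exact fun hq => Or.inr ⟨hi, hq⟩
          · rintro (⟨R', ⟨hR', _⟩, he⟩ | ⟨_, h⟩)
            · exact absurd ⟨R', hR', he⟩ hi
            · exact h
      rw [h1, h2, Finset.card_union_of_disjoint, Finset.card_image_of_injOn,
        Finset.card_image_of_injOn]
      · intro R hR R' hR' he
        simp only [hP, Finset.coe_filter, Set.mem_ofPred_eq] at hR hR'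
        by_contra hne
        refine Finset.disjoint_left.1 (hs.disjoint R hR.1 R' hR'.1 hne)
          (Finset.mem_inter.1 (commonElement_mem (hs.one R hR.1))).2 ?_
        rw [he]
        exact (Finset.mem_inter.1 (commonElement_mem (hs.one R' hR'.1))).2
      · exact hinj.mono fun R hR => (Finset.mem_filter.1 hR).1
      · rw [Finset.disjoint_left]
        intro i hi hi'
        obtain ⟨R, hR, rfl⟩ := Finset.mem_image.1 hi
        exact (Finset.mem_filter.1 hi').2.1 ⟨R, (Finset.mem_filter.1 hR).1, rfl⟩
    refine (key c hc).trans (Eq.trans ?_ (key c' hc').symm)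
    rw [he]
  · intro c hc c' hc' he
    have hel : ∀ R ∈ 𝒮, commonElement (colors c) R = commonElement (colors c') R := by
      intro R hR
      have h1 := congrFun he (code n 𝒮 R)
      simp only [groupSecret_code hcard _ hR] at h1
      exact code_injOn ((h𝒮 c hc).small R hR)
        (Finset.mem_inter.1 (commonElement_mem ((h𝒮 c hc).one R hR))).2
        (Finset.mem_inter.1 (commonElement_mem ((h𝒮 c' hc').one R hR))).2 h1
    have himg : ∀ c ∈ D, colors c = 𝒮.image (commonElement (colors c)) := by
      intro c hc
      ext x
      constructor
      · intro hx
        obtain ⟨R, hR, hxR⟩ := (h𝒮 c hc).cover x hx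
        exact Finset.mem_image.2 ⟨R, hR, (commonElement_unique ((h𝒮 c hc).one R hR) hx hxR).symm⟩
      · intro hx
        obtain ⟨R, hR, rfl⟩ := Finset.mem_image.1 hx
        exact (Finset.mem_inter.1 (commonElement_mem ((h𝒮 c hc).one R hR))).1
    rw [himg c hc, himg c' hc']
    exact Finset.image_congr fun R hR => hel R hR

/-- The colors, divided into groups of at most `n`. -/
def colorGroup (n k : ℕ) (j : Fin (k / n + 1)) : Finset (Fin k) :=
  Finset.univ.filter fun f => (f : ℕ) / n = j

theorem card_colorGroup_le (hn : 1 ≤ n) (j : Fin (k / n + 1)) : (colorGroup n k j).card ≤ n := by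
  have h := Finset.card_le_card_of_injOn (s := colorGroup n k j) (t := Finset.range n)
    (fun f => (f : ℕ) % n) (fun f _ => by simpa using Nat.mod_lt _ hn) (by
      intro f hf g hg he
      simp only [colorGroup, Finset.coe_filter, Finset.mem_univ, true_and, Set.mem_ofPred_eq]
        at hf hg
      refine Fin.ext ?_
      rw [← Nat.div_add_mod (f : ℕ) n, ← Nat.div_add_mod (g : ℕ) n, hf, hg]
      simp only at he
      rw [he])
  simpa using h

theorem mem_colorGroup (f : Fin k) : f ∈ colorGroup n k
    ⟨f / n, Nat.lt_succ_of_le (Nat.div_le_div_right f.2.le)⟩ := by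
  simp [colorGroup]

/-- The sets that separate the colors `X` when each group of colors is bisected at random. -/
def colorSets {d : ℕ} (n : ℕ) (h : Fin d → Fin k → Bool) (X : Finset (Fin k)) :
    Finset (Finset (Fin k)) :=
  Finset.univ.biUnion fun j => splitSets d h (colorGroup n k j) X

/-- The number of bisections in all groups of colors. -/
def colorCost {d : ℕ} (n : ℕ) (h : Fin d → Fin k → Bool) (X : Finset (Fin k)) : ℕ :=
  ∑ j, splitCost d h (colorGroup n k j) X

theorem separates_colorSets {d : ℕ} (hn : 1 ≤ n) (h : Fin d → Fin k → Bool) (X : Finset (Fin k))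
    (hd : colorCost n h X < d) : Separates n (colorSets n h X) X where
  one R hR := by
    obtain ⟨j, _, hR⟩ := Finset.mem_biUnion.1 hR
    exact (splitSets_spec _ _ _ _ _ hR).2
  small R hR := by
    obtain ⟨j, _, hR⟩ := Finset.mem_biUnion.1 hR
    exact (Finset.card_le_card (splitSets_spec _ _ _ _ _ hR).1).trans (card_colorGroup_le hn j)
  disjoint R hR R' hR' hne := by
    obtain ⟨j, _, hR⟩ := Finset.mem_biUnion.1 hR
    obtain ⟨j', _, hR'⟩ := Finset.mem_biUnion.1 hR'
    by_cases hj : j = j'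
    · subst hj
      exact splitSets_disjoint _ _ _ _ _ _ hR hR' hne
    · refine Disjoint.mono (splitSets_spec _ _ _ _ _ hR).1 (splitSets_spec _ _ _ _ _ hR').1
        (Finset.disjoint_left.2 fun f hf hf' => hj (Fin.ext ?_))
      simp only [colorGroup, Finset.mem_filter, Finset.mem_univ, true_and] at hf hf'
      rw [← hf, ← hf']
  cover x hx := by
    obtain ⟨R, hR, hxR⟩ := exists_mem_splitSets d h _ X ((Finset.single_le_sum
      (f := fun j => splitCost d h (colorGroup n k j) X) (fun _ _ => Nat.zero_le _)
      (Finset.mem_univ _)).trans_lt hd) x hx (mem_colorGroup (n := n) x)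
    exact ⟨R, Finset.mem_biUnion.2 ⟨_, Finset.mem_univ _, hR⟩, hxR⟩

theorem rare_colorCost (hn : 1 ≤ n) (X : Finset (Fin k)) (hX : X.card ≤ n) :
    Rare 32 fun h : Fin (64 * n) → Fin k → Bool => 64 * n ≤ colorCost n h X := by
  refine Rare.markov (E := 2 * n) ?_ (by omega) (by omega)
  simp only [colorCost]
  rw [Finset.sum_comm]
  refine (Finset.sum_le_sum fun j _ => sum_splitCost_le (64 * n) _ X).trans ?_
  rw [← Finset.mul_sum, ← Finset.mul_sum]
  refine Nat.mul_le_mul_left _ (Nat.mul_le_mul_left _ ?_)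
  calc ∑ j, ((X ∩ colorGroup n k j).card - 1) ≤ ∑ j, (X ∩ colorGroup n k j).card :=
        Finset.sum_le_sum fun j _ => Nat.sub_le _ _
    _ = (Finset.univ.biUnion fun j => X ∩ colorGroup n k j).card := by
        rw [Finset.card_biUnion]
        intro j _ j' _ hj
        refine Finset.disjoint_left.2 fun f hf hf' => hj (Fin.ext ?_)
        simp only [colorGroup, Finset.mem_filter, Finset.mem_univ, true_and, Finset.mem_inter]
          at hf hf'
        rw [← hf.2, ← hf'.2]
    _ ≤ X.card := Finset.card_le_card (Finset.biUnion_subset.2 fun j _ => Finset.inter_subset_left)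
    _ ≤ n := hX

/-- With more colors than positions, an absent color is found among any `n + 1` colors. Then the
occurring colors are counted in each group, separated by random bisection, identified, and located:
the last two steps are Mastermind with blanks. -/
theorem bwmm_le_linear (hn : 1 ≤ n) (hk : n < k) :
    bwmm n k ≤ ((300000 * (n + k / n) : ℕ) : ℝ≥0∞) := by
  classical
  have : NeZero n := ⟨by omega⟩
  have : NeZero k := ⟨by omega⟩
  obtain ⟨Ω, _, _, good, hgood, hrare⟩ := exists_blank_solver n hn
  let Good : (Fin (64 * n) → Fin k → Bool) × (Ω × Ω) → Set (Codeword n k) := fun ω =>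
    {c | ¬ ((64 * n ≤ colorCost n ω.1 (colors c) ∨
      groupSecret (colorSets n ω.1 (colors c)) (colors c) ∉ good ω.2.1) ∨
      normalize c ∉ good ω.2.2)}
  have hlearn : ∀ ω, Learn (queries blackWhite) (fun c : Codeword n k => c) (Good ω)
      fun _ => (n + 1) + ((k / n + 1) + 64 * n + 50000 * n + 50000 * n) := by
    rintro ⟨h, ω₁, ω₂⟩
    set D := Good (h, ω₁, ω₂) with hD
    have hDc : ∀ c ∈ D, colorCost n h (colors c) < 64 * n ∧
        groupSecret (colorSets n h (colors c)) (colors c) ∈ good ω₁ ∧ normalize c ∈ good ω₂ := by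
      intro c hc
      have hc : ¬ ((64 * n ≤ colorCost n h (colors c) ∨
        groupSecret (colorSets n h (colors c)) (colors c) ∉ good ω₁) ∨
        normalize c ∉ good ω₂) := hc
      push Not at hc
      exact ⟨hc.1.1, hc.1.2, hc.2⟩
    -- One of `n + 1` colors does not occur.
    have hpresent : Learn (queries blackWhite) (fun (c : Codeword n k) (f : Fin (n + 1)) =>
        Fin.castLE hk f ∈ colors c) D fun _ => n + 1 := by
      refine ((Learn.family (𝒬 := queries (n := n) (k := k) blackWhite) (D := D)
        (f := fun (f : Fin (n + 1)) c => black c fun _ => Fin.castLE hk f) (κ := fun _ _ => 1)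
        fun f => learn_black_of_blackWhite _ D).map fun c _ c' _ he => ?_).mono subset_rfl
        fun c _ => by simp
      funext f
      rw [eq_iff_iff, ← not_iff_not, ← black_const_eq_zero_iff, ← black_const_eq_zero_iff]
      rw [congrFun he f]
    refine hpresent.bind fun b => ?_
    rcases (D ∩ {c | (fun f : Fin (n + 1) => Fin.castLE hk f ∈ colors c) = b}).eq_empty_or_nonempty
      with he | ⟨c₀, hc₀⟩
    · rw [he]; exact .done (by simp)
    set D₁ := D ∩ {c | (fun f : Fin (n + 1) => Fin.castLE hk f ∈ colors c) = b} with hD₁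
    obtain ⟨f, hf⟩ : ∃ f : Fin (n + 1), Fin.castLE hk f ∉ colors c₀ := by
      by_contra hall
      push Not at hall
      have h1 := Finset.card_le_card_of_injOn (s := (Finset.univ : Finset (Fin (n + 1))))
        (t := colors c₀) (Fin.castLE hk) (fun f _ => hall f) (Fin.castLE_injective hk).injOn
      have h2 := card_colors_le c₀
      simp at h1
      omega
    set z := Fin.castLE hk f with hz
    have hzD : ∀ c ∈ D₁, z ∉ colors c := by
      intro c hc hcz
      have h1 : (z ∈ colors c) = b f := congrFun hc.2 f
      have h2 : (z ∈ colors c₀) = b f := congrFun hc₀.2 f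
      exact hf (by rw [h2, ← h1]; exact hcz)
    have hcount : ∀ S j (D₂ : Set (Codeword n k)), D₂ ⊆ D₁ → S ⊆ colorGroup n k j →
        Learn (queries blackWhite) (fun c : Codeword n k => (colors c ∩ S).card) D₂ fun _ => 1 :=
      fun S j D₂ hD₂ hS => learn_card_colors_inter z (fun c hc => hzD c (hD₂ hc)) S
        ((Finset.card_le_card hS).trans (card_colorGroup_le hn j))
    have hgroups : Learn (queries blackWhite)
        (fun (c : Codeword n k) j => (colors c ∩ colorGroup n k j).card) D₁ fun _ => k / n + 1 :=
      (Learn.family (𝒬 := queries (n := n) (k := k) blackWhite) (D := D₁)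
        (f := fun j c => (colors c ∩ colorGroup n k j).card) (κ := fun _ _ => 1)
        fun j => hcount _ j D₁ subset_rfl subset_rfl).mono subset_rfl fun c _ => by simp
    have hsets : Learn (queries blackWhite) (fun c : Codeword n k => colorSets n h (colors c)) D₁
        fun _ => k / n + 1 + 64 * n := by
      refine (hgroups.bind
        (G := fun c j => splitSets (64 * n) h (colorGroup n k j) (colors c))
        (κ' := fun c => colorCost n h (colors c)) fun b => Learn.family fun j => ?_).map ?_
        |>.mono subset_rfl ?_
      · exact learn_splitSets (fun c : Codeword n k => colors c) (64 * n) h (colorGroup n k j) _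
          (fun S hS => hcount S j _ Set.inter_subset_left hS)
          fun c hc c' hc' => congrFun (hc.2.trans hc'.2.symm) j
      · intro c _ c' _ he
        exact Finset.biUnion_congr rfl fun j _ => congrFun he j
      · intro c hc
        have := (hDc c hc.1).1
        omega
    have hcolors : Learn (queries blackWhite) (fun c : Codeword n k => colors c) D₁
        fun _ => k / n + 1 + 64 * n + 50000 * n := by
      refine hsets.bind fun 𝒮 => ?_
      refine learn_colors_of_separates z (fun c hc => hzD c hc.1) 𝒮 ?_ (hgood ω₁) ?_
      · intro c hc
        rw [← show colorSets n h (colors c) = 𝒮 from hc.2]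
        exact separates_colorSets hn h _ (hDc c hc.1.1).1
      · intro c hc
        rw [← show colorSets n h (colors c) = 𝒮 from hc.2]
        exact (hDc c hc.1.1).2.1
    refine hcolors.bind fun X => ?_
    refine learn_of_blank (fun q => learn_black_of_blackWhite q _) (fun _ => z) ?_ X
      (fun c hc => hc.2) (hgood ω₂) fun c hc => (hDc c hc.1.1).2.2
    intro c hc i hi
    exact hzD c hc.1 (hi ▸ mem_colors c i)
  refine (randQueryComplexity_le_of_half Good _ hlearn fun c => ?_).trans ?_
  · have h1 : Rare 16 fun ω : (Fin (64 * n) → Fin k → Bool) × (Ω × Ω) =>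
        64 * n ≤ colorCost n ω.1 (colors c) :=
      Rare.fst (P := fun h => 64 * n ≤ colorCost n h (colors c))
        (le_trans (Nat.mul_le_mul_right _ (by norm_num)) (rare_colorCost hn _ (card_colors_le c)))
    have h2 : Rare 16 fun ω : (Fin (64 * n) → Fin k → Bool) × (Ω × Ω) =>
        groupSecret (colorSets n ω.1 (colors c)) (colors c) ∉ good ω.2.1 :=
      Rare.prod (Q := fun h (ω : Ω × Ω) =>
        groupSecret (colorSets n h (colors c)) (colors c) ∉ good ω.1) fun h =>
          Rare.fst (P := fun ω => groupSecret (colorSets n h (colors c)) (colors c) ∉ good ω)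
            (hrare _)
    have h3 : Rare 8 fun ω : (Fin (64 * n) → Fin k → Bool) × (Ω × Ω) =>
        normalize c ∉ good ω.2.2 :=
      Rare.prod (Q := fun _ (ω : Ω × Ω) => normalize c ∉ good ω.2) fun h =>
        Rare.prod (Q := fun _ ω => normalize c ∉ good ω) fun _ =>
          le_trans (Nat.mul_le_mul_right _ (by norm_num)) (hrare _)
    have h4 := Rare.or (K := 4) (Rare.or (K := 8) h1 h2) h3
    have h5 := h4.mono (Q := fun ω => c ∉ Good ω) fun ω hω => not_not.1 hω
    unfold Rare at h5
    rw [Nat.card_eq_fintype_card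
      (α := (Fin (64 * n) → Fin k → Bool) × (Ω × Ω))] at h5
    change 4 * Nat.card {ω // c ∉ Good ω} ≤ _ at h5
    omega
  · have : 1 ≤ k / n := (Nat.one_le_div_iff (by omega)).2 hk.le
    exact_mod_cast (show 2 * (n + 1 + (k / n + 1 + 64 * n + 50000 * n + 50000 * n) + 1) + 1 ≤
      300000 * (n + k / n) by omega)

/-- White pegs can be ignored. -/
theorem bwmm_le_bmm (n k : ℕ) : bwmm n k ≤ bmm n k := by
  refine le_iInf₂ fun μ hμ => ?_
  let g : DetStrategy ℕ n k → DetStrategy (ℕ × ℕ) n k := fun s l => s (l.map Prod.fst)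
  have hg : Measurable g := measurable_pi_lambda _ fun l => measurable_pi_apply _
  have hist : ∀ s c t, (history blackWhite (g s) c t).map Prod.fst = history black s c t := by
    intro s c t
    induction t with
    | zero => rfl
    | succ t ih =>
      simp only [history, List.map_cons, ih]
      simp only [g, ih, blackWhite]
  have hnum : ∀ s c, numQueries blackWhite (g s) c = numQueries black s c := by
    intro s c
    simp only [numQueries, g, hist]
  refine (iInf₂_le (μ.map g) (MeasureTheory.Measure.isProbabilityMeasure_map hg.aemeasurable)).trans
    (iSup_mono fun c => ?_)
  refine (MeasureTheory.lintegral_map_le _ g).trans (le_of_eq ?_)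
  simp only [hnum]

end

/-! ### Few colors: random queries -/

section

variable {n k : ℕ}

/-- An upper bound of order `1 / √m` for the probability `m.centralBinom / 4 ^ m`. -/
theorem centralBinom_sq_mul_le (m : ℕ) : m.centralBinom ^ 2 * (2 * m + 1) ≤ 16 ^ m := by
  induction m with
  | zero => simp
  | succ m ih =>
    have h := Nat.succ_mul_centralBinom_succ m
    refine Nat.le_of_mul_le_mul_left (c := (m + 1) ^ 2) ?_ (by positivity)
    calc (m + 1) ^ 2 * ((m + 1).centralBinom ^ 2 * (2 * (m + 1) + 1))
        = ((m + 1) * (m + 1).centralBinom) ^ 2 * (2 * (m + 1) + 1) := by ring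
      _ = (m.centralBinom ^ 2 * (2 * m + 1)) * (4 * (2 * m + 1) * (2 * (m + 1) + 1)) := by
        rw [h]; ring
      _ ≤ 16 ^ m * (16 * (m + 1) ^ 2) := Nat.mul_le_mul ih (by nlinarith)
      _ = (m + 1) ^ 2 * 16 ^ (m + 1) := by ring

/-- The positions in which two codewords differ. -/
def diffSet (c c' : Codeword n k) : Finset (Fin n) := Finset.univ.filter fun i => c i ≠ c' i

/-- The positions in which exactly one of the codewords `c` and `c'` agrees with the query `q`. -/
def hits (c c' q : Codeword n k) : Finset (Fin n) :=
  (diffSet c c').filter fun i => q i = c i ∨ q i = c' i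

/-- The queries with the same answer for the codewords `c` and `c'`. -/
def balanced (c c' : Codeword n k) : Finset (Codeword n k) :=
  Finset.univ.filter fun q => black c q = black c' q

/-- Exchange the colors of `c` and `c'` in the positions with `ε i = true`. -/
def flip (c c' : Codeword n k) (ε : Fin n → Bool) : Equiv.Perm (Codeword n k) :=
  Equiv.piCongrRight fun i => if ε i then Equiv.swap (c i) (c' i) else Equiv.refl _

/-- The positions in which the flipped query agrees with `c` and not with `c'`. -/
def plusSet (c c' q : Codeword n k) (ε : Fin n → Bool) : Finset (Fin n) :=
  (hits c c' q).filter fun i => (q i = c i) ↔ ε i = false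

theorem flip_mem_balanced_iff (c c' q : Codeword n k) (ε : Fin n → Bool) :
    flip c c' ε q ∈ balanced c c' ↔ 2 * (plusSet c c' q ε).card = (hits c c' q).card := by
  have h1 : ∀ c₀ : Codeword n k, black c₀ (flip c c' ε q) =
      ((Finset.univ.filter fun i => c i = c' i).filter fun i => flip c c' ε q i = c₀ i).card +
        ((diffSet c c').filter fun i => flip c c' ε q i = c₀ i).card := by
    intro c₀
    rw [black, ← Finset.card_filter_add_card_filter_not (fun i => c i = c' i),
      Finset.filter_comm, diffSet]
    congr 2
    exact Finset.filter_comm _ _ _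
  have h2 : ((Finset.univ.filter fun i => c i = c' i).filter fun i => flip c c' ε q i = c i) =
      (Finset.univ.filter fun i => c i = c' i).filter fun i => flip c c' ε q i = c' i :=
    Finset.filter_congr fun i hi => by rw [(Finset.mem_filter.1 hi).2]
  have hflip : ∀ i, flip c c' ε q i =
      if ε i then Equiv.swap (c i) (c' i) (q i) else q i := by
    intro i
    simp only [flip, Equiv.piCongrRight_apply, Pi.map_apply]
    split_ifs <;> rfl
  have h3 : ((diffSet c c').filter fun i => flip c c' ε q i = c i) = plusSet c c' q ε := by
    ext i
    simp only [plusSet, hits, Finset.mem_filter, hflip, and_assoc]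
    refine and_congr_right fun hi => ?_
    have hne : c i ≠ c' i := (Finset.mem_filter.1 hi).2
    cases hε : ε i
    · simp only [Bool.false_eq_true, if_false, iff_true]
      exact ⟨fun h => ⟨Or.inl h, h⟩, fun h => h.2⟩
    · simp only [if_true, Bool.true_eq_false, iff_false, Equiv.swap_apply_eq_iff,
        Equiv.swap_apply_left]
      constructor
      · intro h; exact ⟨Or.inr h, by rw [h]; exact hne.symm⟩
      · rintro ⟨h | h, h'⟩
        · exact absurd h h'
        · exact h
  have h4 : ((diffSet c c').filter fun i => flip c c' ε q i = c' i) =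
      hits c c' q \ plusSet c c' q ε := by
    ext i
    simp only [plusSet, hits, Finset.mem_filter, Finset.mem_sdiff, hflip, not_and]
    by_cases hi : i ∈ diffSet c c'
    swap
    · simp [hi]
    have hne : c i ≠ c' i := (Finset.mem_filter.1 hi).2
    simp only [hi, true_and]
    cases hε : ε i
    · simp only [Bool.false_eq_true, if_false, iff_true]
      constructor
      · intro h; exact ⟨Or.inr h, fun _ => by rw [h]; exact hne.symm⟩
      · rintro ⟨h | h, h'⟩
        · exact absurd h (h' (Or.inl h))
        · exact h
    · simp only [if_true, Bool.true_eq_false, iff_false, not_not, Equiv.swap_apply_eq_iff,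
        Equiv.swap_apply_right]
      constructor
      · intro h; exact ⟨Or.inl h, fun _ => h⟩
      · rintro ⟨h, h'⟩; exact h' h
  have h5 : plusSet c c' q ε ⊆ hits c c' q := Finset.filter_subset _ _
  have h6 := Finset.card_le_card h5
  simp only [balanced, Finset.mem_filter, Finset.mem_univ, true_and]
  rw [h1, h1, h2, h3, h4, Finset.card_sdiff_of_subset h5]
  omega

/-- A flipped query is balanced if exactly half of the hits are turned to `c`, which has probability
`O(1 / √m)` for `m` hits. -/
theorem card_flip_balanced_sq_le (c c' q : Codeword n k) :
    (Finset.univ.filter fun ε => flip c c' ε q ∈ balanced c c').card ^ 2 *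
      ((hits c c' q).card + 1) ≤ (2 ^ n) ^ 2 := by
  set Z := hits c c' q with hZ
  simp only [flip_mem_balanced_iff, ← hZ]
  rcases Nat.even_or_odd' Z.card with ⟨m, hm | hm⟩
  swap
  · rw [Finset.filter_false_of_mem fun ε _ h => by omega]
    simp
  have hle : (Finset.univ.filter fun ε => 2 * (plusSet c c' q ε).card = Z.card).card ≤
      m.centralBinom * 2 ^ (n - 2 * m) := by
    have h := Finset.card_le_card_of_injOn
      (s := Finset.univ.filter fun ε => 2 * (plusSet c c' q ε).card = Z.card)
      (t := (Z.powersetCard m) ×ˢ (Zᶜ).powerset)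
      (fun ε => (plusSet c c' q ε, Zᶜ.filter fun i => ε i = true)) (by
        intro ε hε
        have hε := (Finset.mem_filter.1 hε).2
        refine Finset.mem_coe.2 (Finset.mem_product.2 ⟨Finset.mem_powersetCard.2
          ⟨Finset.filter_subset _ _, ?_⟩, Finset.mem_powerset.2 (Finset.filter_subset _ _)⟩)
        simp only
        omega) (by
        intro ε _ ε' _ he
        obtain ⟨he1, he2⟩ := Prod.mk.inj he
        funext i
        by_cases hi : i ∈ Z
        · have h1 := Finset.ext_iff.1 he1 i
          simp only [plusSet, Finset.mem_filter, ← hZ, hi, true_and] at h1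
          cases h2 : ε i <;> cases h3 : ε' i <;> simp_all
        · have h1 := Finset.ext_iff.1 he2 i
          simp only [Finset.mem_filter, Finset.mem_compl, hi, not_false_eq_true, true_and] at h1
          cases h2 : ε i <;> cases h3 : ε' i <;> simp_all)
    rw [Finset.card_product, Finset.card_powersetCard, Finset.card_powerset, Finset.card_compl,
      Fintype.card_fin, hm] at h
    rwa [hm, Nat.centralBinom_eq_two_mul_choose]
  have hmn : 2 * m ≤ n := by
    rw [← hm]; exact (Finset.card_le_univ _).trans (by simp)
  calc _ ≤ (m.centralBinom * 2 ^ (n - 2 * m)) ^ 2 * (2 * m + 1) := by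
        rw [← hm] at hle ⊢
        gcongr
    _ = m.centralBinom ^ 2 * (2 * m + 1) * (2 ^ (n - 2 * m)) ^ 2 := by ring
    _ ≤ 16 ^ m * (2 ^ (n - 2 * m)) ^ 2 := Nat.mul_le_mul_right _ (centralBinom_sq_mul_le m)
    _ = (2 ^ (2 * m + (n - 2 * m))) ^ 2 := by
        rw [pow_add, mul_pow, pow_mul 2 2 m, pow_right_comm (2 ^ 2) m 2]; norm_num
    _ = (2 ^ n) ^ 2 := by rw [Nat.add_sub_cancel' hmn]

theorem card_flip_balanced_le (c c' q : Codeword n k) :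
    ((Finset.univ.filter fun ε => flip c c' ε q ∈ balanced c c').card : ℝ) ≤
      2 ^ n / √((hits c c' q).card + 1) := by
  have h : (((Finset.univ.filter fun ε => flip c c' ε q ∈ balanced c c').card : ℝ)) ^ 2 *
      ((hits c c' q).card + 1) ≤ (2 ^ n) ^ 2 := by
    exact_mod_cast card_flip_balanced_sq_le c c' q
  have h0 : (0 : ℝ) < (hits c c' q).card + 1 := by positivity
  rw [le_div_iff₀ (Real.sqrt_pos.2 h0)]
  refine le_of_sq_le_sq ?_ (by positivity)
  rw [mul_pow, Real.sq_sqrt h0.le]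
  exact h

/-- Bound for the number of queries that do not distinguish two codewords: given the positions in
which one of the codewords agrees with the query, it is a matter of fair coin flips which one. -/
theorem card_balanced_le_sum (c c' : Codeword n k) :
    ((balanced c c').card : ℝ) ≤ ∑ q : Codeword n k, 1 / √((hits c c' q).card + 1) := by
  have h1 : ∀ ε : Fin n → Bool, (balanced c c').card =
      (Finset.univ.filter fun q => flip c c' ε q ∈ balanced c c').card := by
    intro ε
    rw [← Finset.card_map (flip c c' ε).symm.toEmbedding]
    congr 1
    ext q
    simp only [Finset.mem_map_equiv, Equiv.symm_symm, Finset.mem_filter, Finset.mem_univ, true_and]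
  have h2 : (2 ^ n : ℝ) * (balanced c c').card =
      ∑ q : Codeword n k, ((Finset.univ.filter fun ε => flip c c' ε q ∈ balanced c c').card : ℝ) := by
    have h3 : 2 ^ n * (balanced c c').card =
        ∑ ε : Fin n → Bool, (Finset.univ.filter fun q => flip c c' ε q ∈ balanced c c').card := by
      rw [← Finset.sum_congr rfl fun ε _ => h1 ε, Finset.sum_const, Finset.card_univ]
      simp
    have h4 : ∑ ε : Fin n → Bool, (Finset.univ.filter fun q => flip c c' ε q ∈ balanced c c').card =
        ∑ q : Codeword n k, (Finset.univ.filter fun ε => flip c c' ε q ∈ balanced c c').card := by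
      simp only [Finset.card_filter]
      exact Finset.sum_comm
    exact_mod_cast h3.trans h4
  have hpos : (0 : ℝ) < 2 ^ n := by positivity
  refine le_of_mul_le_mul_left ?_ hpos
  rw [h2, Finset.mul_sum]
  refine Finset.sum_le_sum fun q _ => ?_
  rw [mul_one_div]
  exact card_flip_balanced_le c c' q

theorem card_no_hits_le (c c' : Codeword n k) (hk : 2 ≤ k) :
    ((Finset.univ.filter fun q => hits c c' q = ∅).card : ℝ) ≤
      k ^ n * Real.exp (-(2 * (diffSet c c').card / k)) := by
  have h1 : (Finset.univ.filter fun q => hits c c' q = ∅) =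
      Fintype.piFinset fun i => if i ∈ diffSet c c' then ({c i, c' i} : Finset (Fin k))ᶜ
        else Finset.univ := by
    ext q
    simp only [Finset.mem_filter, Finset.mem_univ, true_and, Fintype.mem_piFinset, hits,
      Finset.filter_eq_empty_iff]
    refine forall_congr' fun i => ?_
    by_cases hi : i ∈ diffSet c c' <;> simp [hi]
  have hk0 : (0 : ℝ) < k := by positivity
  have h2 : ((Finset.univ.filter fun q => hits c c' q = ∅).card : ℝ) =
      ∏ i : Fin n, (k : ℝ) * (if i ∈ diffSet c c' then (1 - 2 / k : ℝ) else 1) := by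
    rw [h1, Fintype.card_piFinset]
    push_cast
    refine Finset.prod_congr rfl fun i _ => ?_
    by_cases hi : i ∈ diffSet c c'
    · have hne : c i ≠ c' i := (Finset.mem_filter.1 hi).2
      rw [if_pos hi, if_pos hi, Finset.card_compl, Finset.card_pair hne, Fintype.card_fin,
        Nat.cast_sub hk]
      field_simp
      norm_num
    · simp [hi]
  rw [h2, Finset.prod_mul_distrib, Finset.prod_const, Finset.card_univ, Fintype.card_fin,
    Finset.prod_ite, Finset.prod_const_one, mul_one, Finset.prod_const]
  gcongr
  have h3 : (Finset.univ.filter fun i => i ∈ diffSet c c') = diffSet c c' := by simp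
  rw [h3]
  have h4 : (0 : ℝ) ≤ 1 - 2 / k := by
    rw [sub_nonneg, div_le_one hk0]; exact_mod_cast hk
  calc (1 - 2 / (k : ℝ)) ^ (diffSet c c').card ≤ Real.exp (-(2 / k)) ^ (diffSet c c').card := by
        gcongr; exact Real.one_sub_le_exp_neg _
    _ = Real.exp (-(2 * (diffSet c c').card / k)) := by
        rw [← Real.exp_nat_mul]; congr 1; ring

/-- A bound for codewords that differ in few positions: a query with at least one hit is balanced
with probability at most `3 / 4`. -/
theorem card_balanced_le_of_small (c c' : Codeword n k) (hk : 2 ≤ k) :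
    ((balanced c c').card : ℝ) ≤
      k ^ n * (0.75 + 0.25 * Real.exp (-(2 * (diffSet c c').card / k))) := by
  have h1 : ∀ q : Codeword n k, 1 / √((hits c c' q).card + 1) ≤
      0.75 + 0.25 * (if hits c c' q = ∅ then (1 : ℝ) else 0) := by
    intro q
    split_ifs with h
    · simp [h]; norm_num
    · have h2 : (1 : ℝ) ≤ (hits c c' q).card := by
        exact_mod_cast Finset.card_pos.2 (Finset.nonempty_iff_ne_empty.2 h)
      have h3 : (4 / 3 : ℝ) ≤ √((hits c c' q).card + 1) := Real.le_sqrt_of_sq_le (by linarith)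
      calc 1 / √(((hits c c' q).card : ℝ) + 1) ≤ 1 / (4 / 3) :=
            one_div_le_one_div_of_le (by norm_num) h3
        _ ≤ _ := by norm_num
  calc ((balanced c c').card : ℝ) ≤ ∑ q : Codeword n k, 1 / √((hits c c' q).card + 1) :=
        card_balanced_le_sum c c'
    _ ≤ ∑ q : Codeword n k, (0.75 + 0.25 * (if hits c c' q = ∅ then (1 : ℝ) else 0)) :=
        Finset.sum_le_sum fun q _ => h1 q
    _ = 0.75 * k ^ n + 0.25 * (Finset.univ.filter fun q => hits c c' q = ∅).card := by
        rw [Finset.sum_add_distrib, ← Finset.mul_sum, Finset.sum_boole, Finset.sum_const,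
          Finset.card_univ, Fintype.card_fun, Fintype.card_fin, Fintype.card_fin, nsmul_eq_mul]
        push_cast
        ring
    _ ≤ 0.75 * k ^ n + 0.25 * (k ^ n * Real.exp (-(2 * (diffSet c c').card / k))) := by
        gcongr; exact card_no_hits_le c c' hk
    _ = _ := by ring

/-- The expected number of hits is `2 * d / k`, where `d` is the number of positions in which the
codewords differ; by the second moment it is rarely less than half of that. -/
theorem card_few_hits_le (c c' : Codeword n k) (hne : c ≠ c') :
    ((Finset.univ.filter fun q => k * (hits c c' q).card ≤ (diffSet c c').card).card : ℝ) ≤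
      k ^ n * (2 * k / (diffSet c c').card) := by
  set d := (diffSet c c').card with hd
  have hd0 : 0 < d := by
    obtain ⟨i, hi⟩ := Function.ne_iff.1 hne
    exact Finset.card_pos.2 ⟨i, by simp [diffSet, hi]⟩
  have h1 := sum_sq_hits_le (diffSet c c') (fun i x => x = c i ∨ x = c' i) 2 (by
    intro i hi
    have : c i ≠ c' i := (Finset.mem_filter.1 hi).2
    rw [show (Finset.univ.filter fun x => x = c i ∨ x = c' i) = {c i, c' i} by ext; simp]
    exact Finset.card_pair this)
  rw [Fintype.card_fin, ← hd] at h1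
  set S := Finset.univ.filter fun q => k * (hits c c' q).card ≤ d with hS
  have h2 : (S.card : ℤ) * d ^ 2 ≤ ∑ q : Codeword n k,
      ((k * ((diffSet c c').filter fun i => q i = c i ∨ q i = c' i).card : ℤ) - d * (2 : ℕ)) ^ 2 := by
    rw [← nsmul_eq_mul]
    refine (Finset.card_nsmul_le_sum _ _ _ fun q hq => ?_).trans
      (Finset.sum_le_univ_sum_of_nonneg fun _ => sq_nonneg _)
    have hq : ((k * (hits c c' q).card : ℕ) : ℤ) ≤ d := by
      exact_mod_cast (Finset.mem_filter.1 hq).2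
    change (d : ℤ) ^ 2 ≤ (k * (hits c c' q).card - d * (2 : ℕ)) ^ 2
    push_cast at hq ⊢
    nlinarith
  have h3 : S.card * d ^ 2 ≤ Fintype.card (Codeword n k) * (d * (2 * k)) := by
    exact_mod_cast h2.trans h1
  rw [Fintype.card_fun, Fintype.card_fin, Fintype.card_fin] at h3
  have h4 : (S.card : ℝ) * d ^ 2 ≤ k ^ n * (d * (2 * k)) := by exact_mod_cast h3
  have hd0' : (0 : ℝ) < d := by exact_mod_cast hd0
  rw [← mul_div_assoc, le_div_iff₀ hd0']
  refine le_of_mul_le_mul_right ?_ hd0'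
  calc (S.card : ℝ) * d * d = S.card * d ^ 2 := by ring
    _ ≤ _ := h4
    _ = _ := by ring

/-- A bound for codewords that differ in many positions, as most queries have many hits. -/
theorem card_balanced_le_of_large (c c' : Codeword n k) (hk : 2 ≤ k) (hne : c ≠ c')
    {x : ℝ} (hx0 : 0 < x) (hx1 : x ≤ 1) (hx : k ≤ x ^ 2 * (diffSet c c').card) :
    ((balanced c c').card : ℝ) ≤ k ^ n * (3 * x) := by
  set d := (diffSet c c').card with hd
  have hk0 : (0 : ℝ) < k := by positivity
  have hd0 : (0 : ℝ) < d := by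
    by_contra h
    have : (d : ℝ) = 0 := le_antisymm (not_lt.1 h) (by positivity)
    rw [this] at hx
    linarith
  have h1 : ∀ q : Codeword n k, 1 / √((hits c c' q).card + 1) ≤
      x + (if k * (hits c c' q).card ≤ d then (1 : ℝ) else 0) := by
    intro q
    split_ifs with h
    · have : 1 / √(((hits c c' q).card : ℝ) + 1) ≤ 1 := by
        rw [div_le_one (by positivity)]
        exact Real.one_le_sqrt.2 (by linarith [Nat.cast_nonneg (α := ℝ) (hits c c' q).card])
      linarith
    · have h2 : (d : ℝ) < k * (hits c c' q).card := by exact_mod_cast not_le.1 h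
      rw [add_zero, div_le_iff₀ (by positivity)]
      have h3 : 1 / x ≤ √((hits c c' q).card + 1) := by
        refine Real.le_sqrt_of_sq_le ?_
        rw [div_pow, one_pow, div_le_iff₀ (by positivity)]
        have h4 : 1 * (k : ℝ) ≤ ((hits c c' q).card * x ^ 2) * k := by nlinarith [sq_nonneg x]
        have h5 := le_of_mul_le_mul_right h4 hk0
        nlinarith [sq_nonneg x]
      calc (1 : ℝ) = x * (1 / x) := by field_simp
        _ ≤ _ := by gcongr
  have h6 : 2 * k / (d : ℝ) ≤ 2 * x := by
    rw [div_le_iff₀ hd0]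
    have : x ^ 2 * d ≤ x * d := by gcongr; nlinarith
    linarith
  calc ((balanced c c').card : ℝ) ≤ ∑ q : Codeword n k, 1 / √((hits c c' q).card + 1) :=
        card_balanced_le_sum c c'
    _ ≤ ∑ q : Codeword n k, (x + (if k * (hits c c' q).card ≤ d then (1 : ℝ) else 0)) :=
        Finset.sum_le_sum fun q _ => h1 q
    _ = k ^ n * x + (Finset.univ.filter fun q => k * (hits c c' q).card ≤ d).card := by
        rw [Finset.sum_add_distrib, Finset.sum_boole, Finset.sum_const,
          Finset.card_univ, Fintype.card_fun, Fintype.card_fin, Fintype.card_fin, nsmul_eq_mul]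
        push_cast
        ring
    _ ≤ k ^ n * x + k ^ n * (2 * k / d) := by
        gcongr; exact card_few_hits_le c c' hne
    _ ≤ k ^ n * x + k ^ n * (2 * x) := by gcongr
    _ = _ := by ring

end

section

variable {n k : ℕ}

theorem mem_balanced_iff {c c' q : Codeword n k} : q ∈ balanced c c' ↔
    ((diffSet c c').filter fun i => q i = c i).card =
      ((diffSet c c').filter fun i => q i = c' i).card := by
  have h1 : ∀ c₀ : Codeword n k, black c₀ q =
      ((Finset.univ.filter fun i => c i = c' i).filter fun i => q i = c₀ i).card +
        ((diffSet c c').filter fun i => q i = c₀ i).card := by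
    intro c₀
    rw [black, ← Finset.card_filter_add_card_filter_not (fun i => c i = c' i),
      Finset.filter_comm, diffSet]
    congr 2
    exact Finset.filter_comm _ _ _
  have h2 : ((Finset.univ.filter fun i => c i = c' i).filter fun i => q i = c i) =
      (Finset.univ.filter fun i => c i = c' i).filter fun i => q i = c' i :=
    Finset.filter_congr fun i hi => by rw [(Finset.mem_filter.1 hi).2]
  simp only [balanced, Finset.mem_filter, Finset.mem_univ, true_and]
  rw [h1, h1, h2]
  omega

/-- The codeword that is `u` on `D` and constant outside. -/
def extend [NeZero k] (D : Finset (Fin n)) (u : D → Fin k) : Codeword n k :=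
  fun i => if h : i ∈ D then u ⟨i, h⟩ else 0

theorem diffSet_extend [NeZero k] (c c' : Codeword n k) :
    diffSet (extend (diffSet c c') fun i => c i) (extend (diffSet c c') fun i => c' i) =
      diffSet c c' := by
  ext i
  by_cases hi : i ∈ diffSet c c'
  · have := (Finset.mem_filter.1 hi).2
    simp [diffSet, extend, this]
  · simp only [hi, iff_false]
    rw [diffSet, Finset.mem_filter]
    simp [extend, hi]

theorem balanced_extend [NeZero k] (c c' : Codeword n k) :
    balanced (extend (diffSet c c') fun i => c i) (extend (diffSet c c') fun i => c' i) =
      balanced c c' := by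
  ext q
  rw [mem_balanced_iff, mem_balanced_iff, diffSet_extend]
  have h : ∀ c₀ : Codeword n k,
      ((diffSet c c').filter fun i => q i = extend (diffSet c c') (fun i => c₀ i) i) =
        (diffSet c c').filter fun i => q i = c₀ i :=
    fun c₀ => Finset.filter_congr fun i hi => by simp [extend, hi]
  rw [h, h]

/-- The union bound for a tuple of random queries. Whether a query distinguishes two codewords
depends on these only where they differ, so that only `k ^ (2 * D.card)` pairs have to be
considered that differ exactly in `D`. -/
theorem exists_distinguishing (hk : 2 ≤ k) (Q : ℕ) (p : ℕ → ℝ) (hp0 : ∀ d, 0 ≤ p d)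
    (hp : ∀ c c' : Codeword n k, c ≠ c' →
      ((balanced c c').card : ℝ) ≤ k ^ n * p (diffSet c c').card)
    (hsum : ∑ D ∈ Finset.univ.erase (∅ : Finset (Fin n)), (k : ℝ) ^ (2 * D.card) * p D.card ^ Q < 1) :
    ∃ t : Fin Q → Codeword n k, ∀ c c', (∀ j, black c (t j) = black c' (t j)) → c = c' := by
  have : NeZero k := ⟨by omega⟩
  by_contra! hcon
  let B : (D : Finset (Fin n)) → (D → Fin k) × (D → Fin k) → Finset (Fin Q → Codeword n k) :=
    fun D u => if diffSet (extend D u.1) (extend D u.2) = D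
      then Fintype.piFinset fun _ => balanced (extend D u.1) (extend D u.2) else ∅
  have hcover : (Finset.univ : Finset (Fin Q → Codeword n k)) ⊆
      (Finset.univ.erase (∅ : Finset (Fin n))).biUnion fun D => Finset.univ.biUnion (B D) := by
    intro t _
    obtain ⟨c, c', h, hne⟩ := hcon t
    simp only [Finset.mem_biUnion]
    obtain ⟨i, hi⟩ := Function.ne_iff.1 hne
    refine ⟨diffSet c c', Finset.mem_erase.2 ⟨Finset.ne_empty_of_mem (a := i)
      (by simp [diffSet, hi]), Finset.mem_univ _⟩, (fun i => c i, fun i => c' i),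
      Finset.mem_univ _, ?_⟩
    simp only [B]
    rw [if_pos (diffSet_extend c c'), balanced_extend, Fintype.mem_piFinset]
    exact fun j => by simp [balanced, h j]
  have hB : ∀ D ∈ Finset.univ.erase (∅ : Finset (Fin n)), ∀ u,
      ((B D u).card : ℝ) ≤ (k ^ n) ^ Q * p D.card ^ Q := by
    intro D hD u
    have h0 : (0 : ℝ) ≤ (k ^ n) ^ Q * p D.card ^ Q := by
      have := hp0 D.card
      positivity
    simp only [B]
    split_ifs with h
    · rw [Fintype.card_piFinset, Finset.prod_const, Finset.card_univ, Fintype.card_fin,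
        Nat.cast_pow, ← mul_pow]
      gcongr
      have hne : extend D u.1 ≠ extend D u.2 := by
        intro he
        refine (Finset.mem_erase.1 hD).1 ?_
        rw [← h, he]
        simp [diffSet]
      have := hp _ _ hne
      rwa [h] at this
    · simpa using h0
  have hcard : ((k : ℝ) ^ n) ^ Q ≤ ∑ D ∈ Finset.univ.erase (∅ : Finset (Fin n)),
      (k : ℝ) ^ (2 * D.card) * ((k ^ n) ^ Q * p D.card ^ Q) := by
    calc ((k : ℝ) ^ n) ^ Q = ((Finset.univ : Finset (Fin Q → Codeword n k)).card : ℝ) := by simp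
      _ ≤ ∑ D ∈ Finset.univ.erase (∅ : Finset (Fin n)), ∑ u, ((B D u).card : ℝ) := by
        have h := (Finset.card_le_card hcover).trans (Finset.card_biUnion_le.trans
          (Finset.sum_le_sum fun D _ => Finset.card_biUnion_le))
        exact_mod_cast h
      _ ≤ ∑ D ∈ Finset.univ.erase (∅ : Finset (Fin n)),
          ∑ _u : (D → Fin k) × (D → Fin k), ((k : ℝ) ^ n) ^ Q * p D.card ^ Q :=
        Finset.sum_le_sum fun D hD => Finset.sum_le_sum fun u _ => hB D hD u
      _ = _ := by
        refine Finset.sum_congr rfl fun D _ => ?_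
        rw [Finset.sum_const, Finset.card_univ, Fintype.card_prod, Fintype.card_fun,
          Fintype.card_fin, Fintype.card_coe, nsmul_eq_mul]
        push_cast
        ring
  have hpos : (0 : ℝ) < (k ^ n) ^ Q := by positivity
  have : ∑ D ∈ Finset.univ.erase (∅ : Finset (Fin n)),
      (k : ℝ) ^ (2 * D.card) * ((k ^ n) ^ Q * p D.card ^ Q) =
      (k ^ n) ^ Q * ∑ D ∈ Finset.univ.erase (∅ : Finset (Fin n)),
        (k : ℝ) ^ (2 * D.card) * p D.card ^ Q := by
    rw [Finset.mul_sum]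
    exact Finset.sum_congr rfl fun D _ => by ring
  rw [this] at hcard
  nlinarith

theorem sum_powers_lt_one (hn : 3 ≤ n) :
    ∑ D ∈ Finset.univ.erase (∅ : Finset (Fin n)),
      (((1 / (n : ℝ) ^ 2) ^ D.card) + (1 / 4 : ℝ) ^ n) < 1 := by
  have hn' : (3 : ℝ) ≤ n := by exact_mod_cast hn
  have h1 : ∑ D : Finset (Fin n), (1 / (n : ℝ) ^ 2) ^ D.card = (1 / (n : ℝ) ^ 2 + 1) ^ n := by
    have := Fintype.sum_pow_mul_eq_add_pow (Fin n) (1 / (n : ℝ) ^ 2) 1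
    simpa using this
  have h2 : (1 / (n : ℝ) ^ 2 + 1) ^ n ≤ 3 / 2 := by
    calc (1 / (n : ℝ) ^ 2 + 1) ^ n ≤ Real.exp (1 / (n : ℝ) ^ 2) ^ n := by
          gcongr; exact Real.add_one_le_exp _
      _ = Real.exp (1 / n) := by
          rw [← Real.exp_nat_mul]; congr 1; field_simp
      _ ≤ 1 / (1 - 1 / n) := by
          refine Real.exp_bound_div_one_sub_of_interval (by positivity) ?_
          rw [div_lt_one (by linarith)]; linarith
      _ ≤ 3 / 2 := by
          have : 1 / (n : ℝ) ≤ 1 / 3 := one_div_le_one_div_of_le (by norm_num) hn'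
          rw [div_le_iff₀ (by linarith)]; linarith
  have h3 : ∑ D ∈ Finset.univ.erase (∅ : Finset (Fin n)), (1 / (n : ℝ) ^ 2) ^ D.card ≤ 1 / 2 := by
    have := Finset.add_sum_erase Finset.univ
      (fun D : Finset (Fin n) => (1 / (n : ℝ) ^ 2) ^ D.card) (Finset.mem_univ ∅)
    simp only [Finset.card_empty, pow_zero] at this
    linarith
  have h4 : ∑ _D ∈ Finset.univ.erase (∅ : Finset (Fin n)), (1 / 4 : ℝ) ^ n ≤ 1 / 8 := by
    calc ∑ _D ∈ Finset.univ.erase (∅ : Finset (Fin n)), (1 / 4 : ℝ) ^ n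
        ≤ ∑ _D : Finset (Fin n), (1 / 4 : ℝ) ^ n :=
          Finset.sum_le_univ_sum_of_nonneg fun _ => by positivity
      _ = (1 / 2 : ℝ) ^ n := by
          rw [Finset.sum_const, Finset.card_univ, Fintype.card_finset, Fintype.card_fin,
            nsmul_eq_mul]
          push_cast
          rw [← mul_pow]; norm_num
      _ ≤ (1 / 2 : ℝ) ^ 3 := pow_le_pow_of_le_one (by norm_num) (by norm_num) hn
      _ = 1 / 8 := by norm_num
  rw [Finset.sum_add_distrib]
  linarith

/-- For few colors, `O(n log k / log n)` random queries distinguish all codewords. Two codewords at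
distance `d` are told apart by a query with a probability of order `d / n ^ (3 / 4)` for small `d`,
and with probability `1 - O(n ^ (-1 / 8))` if `d` is larger than `n ^ (3 / 4)`. -/
theorem exists_distinguishing_of_few_colors (hk : 2 ≤ k) (hkn : k ^ 2 ≤ n) (hn : 3 ^ 16 ≤ n) {Q : ℕ}
    (hQ : 3000 * (n * Real.log k / Real.log n) ≤ Q) :
    ∃ t : Fin Q → Codeword n k, ∀ c c', (∀ j, black c (t j) = black c' (t j)) → c = c' := by
  have hn0 : (0 : ℝ) < n := by
    have : 0 < n := by omega
    exact_mod_cast this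
  have hk0 : (0 : ℝ) < k := by positivity
  -- With `a = n ^ (1 / 8)`, the two ranges of the distance are separated by `a ^ 6`.
  obtain ⟨a, ha0, han⟩ : ∃ a : ℝ, 0 < a ∧ a ^ 8 = n :=
    ⟨(n : ℝ) ^ (1 / 8 : ℝ), by positivity, by rw [← Real.rpow_natCast, ← Real.rpow_mul hn0.le]; simp⟩
  have ha9 : 9 ≤ a := by
    refine le_of_pow_le_pow_left₀ (n := 8) (by norm_num) ha0.le ?_
    rw [han]; norm_num; exact_mod_cast hn
  have hka : (k : ℝ) ≤ a ^ 4 := by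
    refine le_of_sq_le_sq ?_ (by positivity)
    rw [← pow_mul, han]; exact_mod_cast hkn
  have hlogn : Real.log n = 8 * Real.log a := by
    rw [← han, Real.log_pow]; norm_num
  have hloga : Real.log a ≤ a := (Real.log_le_sub_one_of_pos ha0).trans (by linarith)
  have hlog3 : 2 * Real.log 3 ≤ Real.log a := by
    calc 2 * Real.log 3 = Real.log (3 ^ 2) := by rw [Real.log_pow]; norm_num
      _ ≤ Real.log a := Real.log_le_log (by norm_num) (by linarith)
  have hlog3' : 0 < Real.log 3 := Real.log_pos (by norm_num)
  have hla : 0 < Real.log a := by linarith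
  have hlog2 : Real.log 2 ≤ Real.log k := Real.log_le_log (by norm_num) (by exact_mod_cast hk)
  have hlog2' := Real.log_two_gt_d9
  have hlogk : Real.log k ≤ 4 * Real.log a := by
    calc Real.log k ≤ Real.log (a ^ 4) := Real.log_le_log hk0 hka
      _ = _ := by rw [Real.log_pow]; norm_num
  have hQ' : 3000 * (n * Real.log k) ≤ Q * (8 * Real.log a) := by
    rw [hlogn, ← mul_div_assoc, div_le_iff₀ (by linarith)] at hQ
    exact hQ
  have ha6 : (1 : ℝ) ≤ a ^ 2 := by nlinarith
  let p : ℕ → ℝ := fun d => if (d : ℝ) ≤ a ^ 6 then Real.exp (-(d / (8 * a ^ 6))) else 3 / a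
  refine exists_distinguishing hk Q p (fun d => ?_) (fun c c' hne => ?_) ?_
  · simp only [p]
    split_ifs <;> positivity
  · simp only [p]
    split_ifs with hd
    · refine (card_balanced_le_of_small c c' hk).trans ?_
      gcongr
      set d := (diffSet c c').card
      set t : ℝ := d / a ^ 6 with ht
      have ht0 : 0 ≤ t := by positivity
      have ht1 : t ≤ 1 := by rw [ht, div_le_one (by positivity)]; exact hd
      have h1 : t ≤ 2 * d / k := by
        rw [ht, div_le_div_iff₀ (by positivity) hk0]
        have : (k : ℝ) ≤ 2 * a ^ 6 := by nlinarith [pow_pos ha0 4]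
        nlinarith [Nat.cast_nonneg (α := ℝ) d]
      have h2 : Real.exp (-t) ≤ 1 - t / 2 := by
        have h3 := Real.add_one_le_exp t
        rw [Real.exp_neg, inv_le_comm₀ (Real.exp_pos _) (by linarith)]
        refine le_trans ?_ h3
        rw [inv_le_iff_one_le_mul₀ (by linarith)]
        nlinarith
      calc 0.75 + 0.25 * Real.exp (-(2 * d / k)) ≤ 0.75 + 0.25 * Real.exp (-t) := by gcongr
        _ ≤ 1 - t / 8 := by linarith
        _ ≤ Real.exp (-(t / 8)) := Real.one_sub_le_exp_neg _
        _ = _ := by congr 1; rw [ht]; field_simp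
    · have h1 := card_balanced_le_of_large c c' hk hne (x := 1 / a) (by positivity)
        (by rw [div_le_one ha0]; linarith) (by
          rw [div_pow, one_pow, div_mul_eq_mul_div, one_mul, le_div_iff₀ (by positivity)]
          nlinarith [not_le.1 hd, pow_pos ha0 2])
      exact h1.trans (le_of_eq (by ring))
  · refine lt_of_le_of_lt (Finset.sum_le_sum fun D hD => ?_)
      (sum_powers_lt_one (n := n) (le_trans (by norm_num) hn))
    set d := D.card
    have hdn : (d : ℝ) ≤ n := by
      exact_mod_cast (Finset.card_le_univ D).trans (by simp)
    have hkd : (k : ℝ) ^ (2 * d) = Real.exp (2 * d * Real.log k) := by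
      rw [← Real.exp_log hk0, ← Real.exp_nat_mul, Real.log_exp]
      push_cast
      rfl
    have hpos1 : (0 : ℝ) ≤ (1 / (n : ℝ) ^ 2) ^ d := by positivity
    have hpos2 : (0 : ℝ) ≤ (1 / 4 : ℝ) ^ n := by positivity
    simp only [p]
    split_ifs with hd
    · refine le_trans ?_ (le_add_of_nonneg_right hpos2)
      have h1 : (1 / (n : ℝ) ^ 2) ^ d = Real.exp (-(2 * d * Real.log n)) := by
        rw [one_div, inv_pow, ← pow_mul, ← Real.exp_log hn0, ← Real.exp_nat_mul, Real.log_exp,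
          Real.exp_neg]
        push_cast
        rfl
      rw [hkd, h1, ← Real.exp_nat_mul, ← Real.exp_add, Real.exp_le_exp]
      have h2 : 24 * a ^ 6 * Real.log n ≤ Q := by
        rw [hlogn]
        have h3 : 3000 * (a ^ 8 * 0.69) ≤ Q * (8 * Real.log a) := by
          refine le_trans ?_ hQ'
          rw [han]
          gcongr
          linarith
        have h4 : (24 * a ^ 6 * (8 * Real.log a)) * (8 * Real.log a) ≤ Q * (8 * Real.log a) := by
          refine le_trans ?_ h3
          have h5 : Real.log a ^ 2 ≤ a ^ 2 := by gcongr
          have h6 : (0 : ℝ) < a ^ 6 := by positivity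
          calc (24 * a ^ 6 * (8 * Real.log a)) * (8 * Real.log a)
              = 1536 * (a ^ 6 * Real.log a ^ 2) := by ring
            _ ≤ 1536 * (a ^ 6 * a ^ 2) := by gcongr
            _ ≤ 3000 * (a ^ 8 * 0.69) := by
                have : (0 : ℝ) < a ^ 8 := by positivity
                rw [← pow_add]; linarith
        exact le_of_mul_le_mul_right h4 (by linarith)
      have h3 : 3 * d * Real.log n ≤ Q * (d / (8 * a ^ 6)) := by
        rw [← mul_div_assoc, le_div_iff₀ (by positivity)]
        nlinarith [Nat.cast_nonneg (α := ℝ) d]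
      have h4 : 2 * d * Real.log k ≤ d * Real.log n := by
        rw [hlogn]; nlinarith [Nat.cast_nonneg (α := ℝ) d]
      linarith
    · refine le_trans ?_ (le_add_of_nonneg_left hpos1)
      have h1 : (1 / 4 : ℝ) ^ n = Real.exp (-(2 * n * Real.log 2)) := by
        rw [one_div, inv_pow, Real.exp_neg, show 2 * (n : ℝ) * Real.log 2 = n * Real.log (2 ^ 2) by
          rw [Real.log_pow]; push_cast; ring, Real.exp_nat_mul, Real.exp_log (by norm_num)]
        norm_num
      have h2 : 3 / a = Real.exp (Real.log 3 - Real.log a) := by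
        rw [Real.exp_sub, Real.exp_log (by norm_num), Real.exp_log ha0]
      rw [hkd, h1, h2, ← Real.exp_nat_mul, ← Real.exp_add, Real.exp_le_exp]
      have h3 : (Q : ℝ) * (Real.log 3 - Real.log a) ≤ -(Q * (Real.log a / 2)) := by
        nlinarith [Nat.cast_nonneg (α := ℝ) Q]
      have h4 : 2 * d * Real.log k ≤ 2 * n * Real.log k := by
        gcongr
      have h5 : n * Real.log 2 ≤ n * Real.log k := by gcongr
      have h6 : 0 ≤ n * Real.log k := mul_nonneg hn0.le (by linarith)
      linarith

/-- The random queries can be asked non-adaptively, and determine the codeword. -/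
theorem bmm_le_of_few_colors (hk : 2 ≤ k) (hkn : k ^ 2 ≤ n) (hn : 3 ^ 16 ≤ n) :
    bmm n k ≤ ((2 * (⌈3000 * (n * Real.log k / Real.log n)⌉₊ + 1) + 1 : ℕ) : ℝ≥0∞) := by
  have : NeZero k := ⟨by omega⟩
  obtain ⟨t, ht⟩ := exists_distinguishing_of_few_colors hk hkn hn (Nat.le_ceil _)
  have h := randQueryComplexity_le_of_half (answer := (black : Codeword n k → Codeword n k → ℕ))
    (Ω := Unit) (fun _ => Set.univ) ⌈3000 * (n * Real.log k / Real.log n)⌉₊ (fun _ => by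
      have h1 := Learn.family (𝒬 := queries (black : Codeword n k → Codeword n k → ℕ))
        (D := Set.univ) (f := fun j c => black c (t j)) (κ := fun _ _ => 1)
        fun j => Learn.query ⟨t j, rfl⟩
      refine (h1.map (G := fun c => c) fun c _ c' _ he => ht c c' fun j => congrFun he j).mono
        subset_rfl fun c _ => by simp) (by simp)
  exact_mod_cast h

end

/-! ### Lower bounds -/

section

section LowerBound

variable {A : Type} {n k : ℕ} {answer : Codeword n k → Codeword n k → A}

theorem measurableSet_history_eq [Countable A] (c : Codeword n k) (t : ℕ) (l : List A) :
    MeasurableSet {s : DetStrategy A n k | history answer s c t = l} := by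
  induction t generalizing l with
  | zero =>
    simp only [history]
    exact MeasurableSet.const _
  | succ t ih =>
    have h : {s : DetStrategy A n k | history answer s c (t + 1) = l} =
        ⋃ l', {s | history answer s c t = l'} ∩
          (fun s : DetStrategy A n k => s l') ⁻¹' {q | answer c q :: l' = l} := by
      ext s
      simp [history]
    rw [h]
    exact MeasurableSet.iUnion fun l' =>
      (ih l').inter (measurable_pi_apply l' (Set.toFinite _).measurableSet)

theorem measurable_numQueries [Countable A] (c : Codeword n k) :
    Measurable fun s : DetStrategy A n k => numQueries answer s c := by
  refine Measurable.iInf fun t => ?_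
  have h : MeasurableSet {s : DetStrategy A n k | s (history answer s c t) = c} := by
    have h' : {s : DetStrategy A n k | s (history answer s c t) = c} =
        ⋃ l, {s | history answer s c t = l} ∩ (fun s : DetStrategy A n k => s l) ⁻¹' {c} := by
      ext s
      simp
    rw [h']
    exact MeasurableSet.iUnion fun l => (measurableSet_history_eq c t l).inter
      (measurable_pi_apply l (Set.toFinite _).measurableSet)
  classical
  have h2 : (fun s : DetStrategy A n k => ⨅ (_ : s (history answer s c t) = c), ((t : ℝ≥0∞) + 1)) =
      fun s => if s (history answer s c t) = c then (t : ℝ≥0∞) + 1 else ⊤ := by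
    funext s
    split_ifs with hs <;> simp [hs]
  rw [h2]
  exact Measurable.ite h measurable_const measurable_const

theorem le_numQueries {s : DetStrategy A n k} {c : Codeword n k} {T : ℕ}
    (h : ∀ t < T, s (history answer s c t) ≠ c) : (T : ℝ≥0∞) + 1 ≤ numQueries answer s c := by
  refine le_iInf₂ fun t ht => ?_
  have : T ≤ t := not_lt.1 fun hlt => h t hlt ht
  gcongr

/-- Averaging over a family of codewords (Yao's principle): if every deterministic strategy needs
more than `T` queries for at least half of the family, then the complexity is at least
`(T + 1) / 2`. -/
theorem le_randQueryComplexity [Countable A] {ι : Type} [Fintype ι] [Nonempty ι]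
    (f : ι → Codeword n k) (T : ℕ)
    (h : ∀ s : DetStrategy A n k, ∃ S : Finset ι, 2 * S.card ≤ Fintype.card ι ∧
      ∀ i ∉ S, ∀ t < T, s (history answer s (f i) t) ≠ f i) :
    ENNReal.ofReal (((T : ℝ) + 1) / 2) ≤ randQueryComplexity answer := by
  classical
  refine le_iInf₂ fun μ hμ => ?_
  set I := ⨆ c : Codeword n k, ∫⁻ s, numQueries answer s c ∂μ with hI
  have h1 : ∀ s : DetStrategy A n k, ((Fintype.card ι * (T + 1) : ℕ) : ℝ≥0∞) ≤
      2 * ∑ i, numQueries answer s (f i) := by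
    intro s
    obtain ⟨S, hS, hs⟩ := h s
    have h2 : (Sᶜ.card : ℝ≥0∞) * (T + 1) ≤ ∑ i, numQueries answer s (f i) := by
      rw [← nsmul_eq_mul]
      refine (Finset.card_nsmul_le_sum _ _ _ fun i hi =>
        le_numQueries (hs i (Finset.mem_compl.1 hi))).trans
          (Finset.sum_le_sum_of_subset (Finset.subset_univ _))
    refine le_trans ?_ (mul_le_mul_right h2 2)
    have h3 : Fintype.card ι * (T + 1) ≤ 2 * (Sᶜ.card * (T + 1)) := by
      rw [← mul_assoc]
      refine Nat.mul_le_mul_right _ ?_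
      rw [Finset.card_compl]
      omega
    exact_mod_cast h3
  have h4 : ((Fintype.card ι * (T + 1) : ℕ) : ℝ≥0∞) ≤ 2 * (Fintype.card ι * I) := by
    calc ((Fintype.card ι * (T + 1) : ℕ) : ℝ≥0∞)
        = ∫⁻ _s, ((Fintype.card ι * (T + 1) : ℕ) : ℝ≥0∞) ∂μ := by simp
      _ ≤ ∫⁻ s, 2 * ∑ i, numQueries answer s (f i) ∂μ := MeasureTheory.lintegral_mono h1
      _ = 2 * ∑ i, ∫⁻ s, numQueries answer s (f i) ∂μ := by
        rw [MeasureTheory.lintegral_const_mul _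
          (Finset.measurable_sum _ fun i _ => measurable_numQueries (f i)),
          MeasureTheory.lintegral_finsetSum _ fun i _ => measurable_numQueries (f i)]
      _ ≤ 2 * ∑ _i : ι, I := by
        gcongr with i
        exact le_iSup (fun c => ∫⁻ s, numQueries answer s c ∂μ) (f i)
      _ = _ := by simp
  have hN : (Fintype.card ι : ℝ≥0∞) ≠ 0 := by exact_mod_cast Fintype.card_ne_zero
  rw [mul_left_comm, Nat.cast_mul, ENNReal.mul_le_mul_iff_right hN (ENNReal.natCast_ne_top _)] at h4
  rw [ENNReal.ofReal_div_of_pos (by norm_num)]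
  refine ENNReal.div_le_of_le_mul ?_
  rw [mul_comm]
  convert h4 using 1
  · rw [show (T : ℝ) + 1 = ((T + 1 : ℕ) : ℝ) by push_cast; rfl, ENNReal.ofReal_natCast]
  · simp

theorem card_image_history_le [DecidableEq A] (R : Finset A) (hR : ∀ c q, answer c q ∈ R)
    (s : DetStrategy A n k) (t : ℕ) :
    (Finset.univ.image fun c => history answer s c t).card ≤ R.card ^ t := by
  induction t with
  | zero => exact (Finset.card_le_one.2 (by simp [history]))
  | succ t ih =>
    have h : (Finset.univ.image fun c => history answer s c (t + 1)) ⊆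
        Finset.image₂ List.cons R (Finset.univ.image fun c => history answer s c t) := by
      intro l hl
      obtain ⟨c, -, rfl⟩ := Finset.mem_image.1 hl
      exact Finset.mem_image₂_of_mem (hR _ _) (Finset.mem_image_of_mem _ (Finset.mem_univ _))
    calc _ ≤ R.card * (Finset.univ.image fun c => history answer s c t).card :=
          (Finset.card_le_card h).trans (Finset.card_image₂_le _ _ _)
      _ ≤ R.card * R.card ^ t := Nat.mul_le_mul_left _ ih
      _ = _ := by ring

/-- The information-theoretic lower bound. -/
theorem le_randQueryComplexity_of_card [Countable A] [Nonempty (Codeword n k)] (R : Finset A)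
    (hR : ∀ c q, answer c q ∈ R) (hR2 : 2 ≤ R.card) (T : ℕ) (hT : 2 * R.card ^ T ≤ k ^ n) :
    ENNReal.ofReal (((T : ℝ) + 1) / 2) ≤ randQueryComplexity answer := by
  classical
  refine le_randQueryComplexity (fun c => c) T fun s =>
    ⟨(Finset.range T).biUnion fun t => Finset.univ.filter fun c => s (history answer s c t) = c,
      ?_, fun c hc t ht h => hc ?_⟩
  · have h1 : ∀ t, (Finset.univ.filter fun c => s (history answer s c t) = c).card ≤
        R.card ^ t := by
      intro t
      refine le_trans ?_ (card_image_history_le R hR s t)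
      refine Finset.card_le_card_of_injOn (fun c => history answer s c t)
        (fun c _ => Finset.mem_coe.2 (Finset.mem_image_of_mem _ (Finset.mem_univ _)))
        fun c hc c' hc' he => ?_
      rw [← (Finset.mem_filter.1 hc).2, ← (Finset.mem_filter.1 hc').2]
      exact congrArg s he
    have h2 : ∑ t ∈ Finset.range T, R.card ^ t ≤ R.card ^ T := by
      clear hT
      induction T with
      | zero => simp
      | succ T ih =>
        rw [Finset.sum_range_succ, pow_succ]
        nlinarith [pow_pos (show 0 < R.card by omega) T]
    have h3 := Finset.card_biUnion_le.trans ((Finset.sum_le_sum fun t _ => h1 t).trans h2)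
    rw [Fintype.card_fun, Fintype.card_fin, Fintype.card_fin]
    exact (Nat.mul_le_mul_left 2 h3).trans hT
  · exact Finset.mem_biUnion.2 ⟨t, Finset.mem_range.2 ht, Finset.mem_filter.2 ⟨Finset.mem_univ _, h⟩⟩

/-- A lower bound for finding a hidden color: a query gives no information about the colors
outside a set of at most `w` colors. -/
theorem le_randQueryComplexity_of_hidden [Countable A] (f : Fin k → Codeword n k)
    (H : Codeword n k → Finset (Fin k)) {w : ℕ} (hk : 1 ≤ k) (hw : 1 ≤ w)
    (hH : ∀ q, (H q).card ≤ w)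
    (heq : ∀ q, ∀ i ∉ H q, ∀ j ∉ H q, answer (f i) q = answer (f j) q)
    (hne : ∀ q, ∀ i ∉ H q, q ≠ f i) :
    ENNReal.ofReal ((k : ℝ) / (4 * w)) ≤ randQueryComplexity answer := by
  have : Nonempty (Fin k) := ⟨⟨0, hk⟩⟩
  refine le_trans (ENNReal.ofReal_le_ofReal ?_)
    (le_randQueryComplexity (answer := answer) f (k / (2 * w)) fun s => ?_)
  · have h1 : k < 2 * w * (k / (2 * w) + 1) := Nat.lt_mul_div_succ k (by omega)
    have h2 : (k : ℝ) ≤ 2 * w * ((k / (2 * w) : ℕ) + 1) := by exact_mod_cast h1.le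
    have hw0 : (0 : ℝ) < w := by exact_mod_cast hw
    rw [div_le_iff₀ (by positivity)]
    linarith
  · have key : ∀ T, ∃ S : Finset (Fin k), S.card ≤ w * T ∧
        (∀ i ∉ S, ∀ j ∉ S, history answer s (f i) T = history answer s (f j) T) ∧
        ∀ i ∉ S, ∀ t < T, s (history answer s (f i) t) ≠ f i := by
      intro T
      induction T with
      | zero => exact ⟨∅, by simp, by simp [history], by simp⟩
      | succ T ih =>
        obtain ⟨S, hS, h1, h2⟩ := ih
        by_cases hall : ∃ i₀, i₀ ∉ S
        swap
        · push Not at hall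
          exact ⟨S, hS.trans (Nat.mul_le_mul_left _ (Nat.le_succ _)),
            fun i hi => absurd (hall i) hi, fun i hi => absurd (hall i) hi⟩
        obtain ⟨i₀, hi₀⟩ := hall
        set q := s (history answer s (f i₀) T) with hq
        have hsq : ∀ i ∉ S, s (history answer s (f i) T) = q := fun i hi => by
          rw [h1 i hi i₀ hi₀]
        refine ⟨S ∪ H q, (Finset.card_union_le _ _).trans ?_, fun i hi j hj => ?_,
          fun i hi t ht => ?_⟩
        · have := hH q
          rw [mul_add, mul_one]
          omega
        · rw [Finset.mem_union, not_or] at hi hj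
          simp only [history]
          rw [hsq i hi.1, hsq j hj.1, h1 i hi.1 j hj.1, heq q i hi.2 j hj.2]
        · rw [Finset.mem_union, not_or] at hi
          rcases Nat.lt_succ_iff_lt_or_eq.1 ht with ht | rfl
          · exact h2 i hi.1 t ht
          · rw [hsq i hi.1]
            exact hne q i hi.2
    obtain ⟨S, hS, -, h⟩ := key (k / (2 * w))
    refine ⟨S, ?_, h⟩
    have := Nat.mul_div_le k (2 * w)
    rw [Fintype.card_fin]
    calc 2 * S.card ≤ 2 * (w * (k / (2 * w))) := Nat.mul_le_mul_left 2 hS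
      _ = 2 * w * (k / (2 * w)) := by ring
      _ ≤ k := this

end LowerBound

variable {n k : ℕ}

theorem black_le (c q : Codeword n k) : black c q ≤ n :=
  (Finset.card_le_univ _).trans (by simp)

/-- There are only `(n + 1) ^ 2` answers. -/
theorem information_bound_le_bwmm (hn : 2 ≤ n) (hk : 2 ≤ k) :
    ENNReal.ofReal (n * Real.log k / Real.log n / 16) ≤ bwmm n k := by
  have : NeZero k := ⟨by omega⟩
  set M := (n + 1) ^ 2 with hM
  set R := Finset.range (n + 1) ×ˢ Finset.range (n + 1) with hR
  have hRM : R.card = M := by simp [hR, hM, sq]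
  have hM2 : 2 ≤ M := by rw [hM]; nlinarith
  have hk2 : 2 ≤ k ^ n := hk.trans (Nat.le_self_pow (by omega) k)
  set T := Nat.log M (k ^ n / 2) with hT
  have hT1 : 2 * M ^ T ≤ k ^ n := by
    have := Nat.pow_log_le_self M (x := k ^ n / 2) (by omega)
    rw [← hT] at this
    omega
  have hT2 : k ^ n ≤ 2 * M ^ (T + 1) := by
    have := Nat.lt_pow_succ_log_self (b := M) (by omega) (k ^ n / 2)
    rw [← Nat.succ_eq_add_one, hT]
    omega
  refine le_trans (ENNReal.ofReal_le_ofReal ?_)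
    (le_randQueryComplexity_of_card (answer := (blackWhite : Codeword n k → Codeword n k → ℕ × ℕ))
      R (fun c q => ?_) (by omega) T (by rwa [hRM]))
  · have hn' : (2 : ℝ) ≤ n := by exact_mod_cast hn
    have hk' : (2 : ℝ) ≤ k := by exact_mod_cast hk
    have hlogn : 0 < Real.log n := Real.log_pos (by linarith)
    have hlog2 : 0 < Real.log 2 := Real.log_pos (by norm_num)
    have h1 : n * Real.log k ≤ Real.log 2 + (T + 1) * (2 * Real.log (n + 1)) := by
      have h := Real.log_le_log (by positivity) (show (k : ℝ) ^ n ≤ 2 * ((n + 1) ^ 2) ^ (T + 1) by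
        exact_mod_cast hT2)
      rw [Real.log_pow, Real.log_mul (by norm_num) (by positivity), Real.log_pow, Real.log_pow] at h
      exact_mod_cast h
    have h2 : Real.log (n + 1) ≤ 2 * Real.log n := by
      calc Real.log (n + 1) ≤ Real.log (n ^ 2) := Real.log_le_log (by positivity) (by nlinarith)
        _ = _ := by rw [Real.log_pow]; norm_num
    have h3 : 2 * Real.log 2 ≤ n * Real.log k := by
      gcongr
    have h4 : n * Real.log k / Real.log n ≤ 8 * (T + 1) := by
      rw [div_le_iff₀ hlogn]
      have h5 : ((T : ℝ) + 1) * (2 * Real.log (n + 1)) ≤ (T + 1) * (2 * (2 * Real.log n)) := by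
        gcongr
      linarith
    linarith
  · have h : (Finset.univ.sup fun σ : Equiv.Perm (Fin n) => black c (q ∘ σ)) ≤ n :=
      Finset.sup_le fun σ _ => black_le _ _
    have h' := black_le c q
    have h'' : white c q ≤ n := (Nat.sub_le _ _).trans h
    exact Finset.mem_product.2 ⟨Finset.mem_range.2 (by simp only [blackWhite]; omega),
      Finset.mem_range.2 (by simp only [blackWhite]; omega)⟩

/-- The hidden color is the one in the first position; all other positions have color `0`. -/
theorem color_bound_le_bmm (hn : 1 ≤ n) (hk : 1 ≤ k) :
    ENNReal.ofReal ((k : ℝ) / 4) ≤ bmm n k := by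
  have : NeZero k := ⟨by omega⟩
  have h := le_randQueryComplexity_of_hidden
    (answer := (black : Codeword n k → Codeword n k → ℕ))
    (fun i => Function.update (fun _ => 0) ⟨0, hn⟩ i) (fun q => {q ⟨0, hn⟩}) (w := 1) hk le_rfl
    (by simp) (fun q i hi j hj => ?_) fun q i hi he => ?_
  · rw [bmm]
    simpa using h
  · rw [Finset.mem_singleton] at hi hj
    unfold black
    congr 1
    refine Finset.filter_congr fun p _ => ?_
    by_cases hp : p = ⟨0, hn⟩
    · subst hp
      simp [Ne.symm hi, Ne.symm hj]
    · simp [Function.update_of_ne hp]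
  · refine hi (Finset.mem_singleton.2 ?_)
    rw [he]
    simp

/-- The hidden color is that of a monochromatic codeword; a query tests at most `n` colors. -/
theorem color_bound_le_bwmm (hn : 1 ≤ n) (hk : 1 ≤ k) :
    ENNReal.ofReal ((k : ℝ) / (4 * n)) ≤ bwmm n k := by
  refine le_randQueryComplexity_of_hidden
    (answer := (blackWhite : Codeword n k → Codeword n k → ℕ × ℕ))
    (fun i _ => i) (fun q => Finset.univ.image q) (w := n) hk hn
    (fun q => Finset.card_image_le.trans (by simp)) (fun q i hi j hj => ?_) fun q i hi he => ?_
  · have h0 : ∀ i ∉ Finset.univ.image q, ∀ σ : Equiv.Perm (Fin n),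
        black (fun _ => i) (q ∘ σ) = 0 := by
      intro i hi σ
      rw [black, Finset.card_eq_zero, Finset.filter_eq_empty_iff]
      intro p _ hp
      exact hi (Finset.mem_image.2 ⟨σ p, Finset.mem_univ _, hp⟩)
    have h1 : ∀ i ∉ Finset.univ.image q, black (fun _ => i) q = 0 := fun i hi => h0 i hi 1
    simp [blackWhite, white, h0 i hi, h0 j hj, h1 i hi, h1 j hj]
  · exact hi (Finset.mem_image.2 ⟨⟨0, hn⟩, Finset.mem_univ _, congrFun he _⟩)

end

/-! ### The order of magnitude -/

section

variable {n k : ℕ}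

theorem le_information_of_le (hn : 2 ≤ n) {r : ℝ}
    (h : Real.log n ≤ r * Real.log k) : (n : ℝ) ≤ r * (n * Real.log k / Real.log n) := by
  have hn' : (2 : ℝ) ≤ n := by exact_mod_cast hn
  have hlogn : 0 < Real.log n := Real.log_pos (by linarith)
  rw [← mul_div_assoc, le_div_iff₀ hlogn]
  nlinarith

/-- If `k ^ 2 > n` or `n` is bounded, then the linear bound is of the right order. -/
theorem bmm_le (hn : 2 ≤ n) (hk : 1 ≤ k) :
    bmm n k ≤ ENNReal.ofReal (6400000 * (n * Real.log k / Real.log n + k)) := by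
  set X := n * Real.log k / Real.log n with hX
  have hn' : (2 : ℝ) ≤ n := by exact_mod_cast hn
  have hk' : (1 : ℝ) ≤ k := by exact_mod_cast hk
  have hlogn : 0 < Real.log n := Real.log_pos (by linarith)
  have hX0 : 0 ≤ X := div_nonneg (mul_nonneg (by linarith) (Real.log_nonneg hk')) hlogn.le
  have hcast : ∀ N : ℕ, (N : ℝ) ≤ 6400000 * (X + k) →
      (N : ℝ≥0∞) ≤ ENNReal.ofReal (6400000 * (X + k)) := fun N hN => by
    rw [← ENNReal.ofReal_natCast]; exact ENNReal.ofReal_le_ofReal hN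
  rcases Nat.lt_or_ge k 2 with hk2 | hk2
  · obtain rfl : k = 1 := by omega
    have h := randQueryComplexity_le_of_half
      (answer := (black : Codeword n 1 → Codeword n 1 → ℕ))
      (Ω := Unit) (fun _ => Set.univ) 0
      (fun _ => Learn.done fun c _ c' _ => Subsingleton.elim c c') (by simp)
    refine le_trans (b := ((3 : ℕ) : ℝ≥0∞)) ?_ (hcast 3 ?_)
    · refine h.trans (le_of_eq ?_)
      norm_num
    · push_cast; linarith
  have hk2' : (2 : ℝ) ≤ k := by exact_mod_cast hk2
  by_cases hfew : k ^ 2 ≤ n ∧ 3 ^ 16 ≤ n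
  · refine (bmm_le_of_few_colors hk2 hfew.1 hfew.2).trans (hcast _ ?_)
    have := Nat.ceil_lt_add_one (a := 3000 * X) (by positivity)
    push_cast
    linarith
  · refine (bmm_le_linear (by omega) hk2).trans (hcast _ ?_)
    have hlog2 : Real.log 2 ≤ Real.log k := Real.log_le_log (by norm_num) hk2'
    have hlog2' : 0 < Real.log 2 := Real.log_pos (by norm_num)
    have h : Real.log n ≤ 32 * Real.log k := by
      rcases not_and_or.1 hfew with h | h
      · have h1 : (n : ℝ) ≤ k ^ 2 := by exact_mod_cast (not_le.1 h).le
        have h2 := Real.log_le_log (by linarith) h1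
        rw [Real.log_pow] at h2
        push_cast at h2
        linarith
      · have h1 : (n : ℝ) ≤ 2 ^ 32 := by
          have : n ≤ 2 ^ 32 := by omega
          exact_mod_cast this
        have h2 := Real.log_le_log (by linarith) h1
        rw [Real.log_pow] at h2
        push_cast at h2
        linarith
    have := le_information_of_le hn h
    rw [← hX] at this
    push_cast
    linarith

theorem bwmm_le (hn : 2 ≤ n) (hk : 2 ≤ k) :
    bwmm n k ≤ ENNReal.ofReal (25600000 * (n * Real.log k / Real.log n + k / n)) := by
  set X := n * Real.log k / Real.log n with hX
  have hn' : (2 : ℝ) ≤ n := by exact_mod_cast hn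
  have hk' : (2 : ℝ) ≤ k := by exact_mod_cast hk
  have hlogn : 0 < Real.log n := Real.log_pos (by linarith)
  have hlogk : Real.log 2 ≤ Real.log k := Real.log_le_log (by norm_num) hk'
  have hlog2 := Real.log_two_gt_d9
  have hX0 : 0 ≤ X := div_nonneg (mul_nonneg (by linarith) (by linarith)) hlogn.le
  have hkn0 : (0 : ℝ) ≤ k / n := by positivity
  rcases Nat.lt_or_ge n k with h | h
  · refine (bwmm_le_linear (by omega) h).trans ?_
    rw [← ENNReal.ofReal_natCast]
    refine ENNReal.ofReal_le_ofReal ?_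
    have h1 : Real.log n ≤ 1 * Real.log k := by
      rw [one_mul]; exact Real.log_le_log (by linarith) (by exact_mod_cast h.le)
    have h2 := le_information_of_le hn h1
    rw [← hX] at h2
    have h3 : ((k / n : ℕ) : ℝ) ≤ k / n := Nat.cast_div_le
    push_cast
    linarith
  · refine (bwmm_le_bmm n k).trans ((bmm_le hn (by omega)).trans (ENNReal.ofReal_le_ofReal ?_))
    -- For `k ≤ n` the term `k` is dominated, as `log x / x` is essentially decreasing.
    have h1 : (k : ℝ) ≤ 3 * X := by
      rw [hX, ← mul_div_assoc, le_div_iff₀ hlogn]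
      have hk0 : (0 : ℝ) < k := by linarith
      have hkn : (k : ℝ) ≤ n := by exact_mod_cast h
      have h2 : Real.log n ≤ Real.log k + (n / k - 1) := by
        have := Real.log_le_sub_one_of_pos (show (0 : ℝ) < n / k by positivity)
        rw [Real.log_div (by linarith) hk0.ne'] at this
        linarith
      calc (k : ℝ) * Real.log n ≤ k * (Real.log k + (n / k - 1)) := by gcongr
        _ = k * Real.log k + (n - k) := by field_simp
        _ ≤ n * Real.log k + n := by
          have : (k : ℝ) * Real.log k ≤ n * Real.log k := by gcongr
          linarith
        _ ≤ _ := by nlinarith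
    rw [← hX]
    linarith

end

end Mastermind

theorem theorem2 :
    (∃ a b : ℝ, 0 < a ∧ 0 < b ∧ ∀ n k : ℕ, 2 ≤ n → 2 ≤ k →
      ENNReal.ofReal (a * ((n : ℝ) * Real.log k / Real.log n + (k : ℝ) / n)) ≤
          Mastermind.bwmm n k ∧
        Mastermind.bwmm n k ≤
          ENNReal.ofReal (b * ((n : ℝ) * Real.log k / Real.log n + (k : ℝ) / n))) ∧
    (∃ a b : ℝ, 0 < a ∧ 0 < b ∧ ∀ n k : ℕ, 2 ≤ n → 1 ≤ k →
      ENNReal.ofReal (a * ((n : ℝ) * Real.log k / Real.log n + (k : ℝ))) ≤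
          Mastermind.bmm n k ∧
        Mastermind.bmm n k ≤
          ENNReal.ofReal (b * ((n : ℝ) * Real.log k / Real.log n + (k : ℝ)))) := by
  have combine : ∀ {x y : ℝ} {B : ℝ≥0∞}, ENNReal.ofReal (x / 16) ≤ B → ENNReal.ofReal (y / 4) ≤ B →
      ENNReal.ofReal (1 / 32 * (x + y)) ≤ B := by
    intro x y B hx hy
    rcases le_total (x / 16) (y / 4) with h | h
    · rcases le_or_gt 0 y with h0 | h0
      · exact (ENNReal.ofReal_le_ofReal (by linarith)).trans hy
      · rw [ENNReal.ofReal_of_nonpos (by linarith)]; exact zero_le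
    · rcases le_or_gt 0 x with h0 | h0
      · exact (ENNReal.ofReal_le_ofReal (by linarith)).trans hx
      · rw [ENNReal.ofReal_of_nonpos (by linarith)]; exact zero_le
  refine ⟨⟨1 / 32, 25600000, by norm_num, by norm_num, fun n k hn hk =>
      ⟨combine (Mastermind.information_bound_le_bwmm hn hk) ?_, Mastermind.bwmm_le hn hk⟩⟩,
    ⟨1 / 32, 6400000, by norm_num, by norm_num, fun n k hn hk =>
      ⟨combine ?_ (Mastermind.color_bound_le_bmm (by omega) hk), Mastermind.bmm_le hn hk⟩⟩⟩
  · rw [div_div, mul_comm (n : ℝ) 4]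
    exact Mastermind.color_bound_le_bwmm (by omega) (by omega)
  · rcases Nat.lt_or_ge k 2 with hk2 | hk2
    · obtain rfl : k = 1 := by omega
      simp
    · exact (Mastermind.information_bound_le_bwmm hn hk2).trans (Mastermind.bwmm_le_bmm n k)
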